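/- **Theorem 1.3 (Main Theorem III).** Let $\alpha,\beta,\gamma>0$, $\delta\in\mathbb R$, $\tilde u\in\mathbb R$ be constants and let $f\in C^2(\mathbb R)$. Consider the Cauchy problem for the generalized KdV–BBM–Burgers equation with fourth-order dissipation $$\partial_t u+\partial_x\big(f(u)\big)-\alpha\,\partial_t\partial_x^2u-\beta\,\partial_x^2u+\delta\,\partial_x^3u+\gamma\,\partial_x^4u=0\quad(t>0,\ x\in\mathbb R),\qquad u(0,x)=u_0(x),$$ with equal far-field states $u_-=u_+=\tilde u$. Assume $u_0-\tilde u\in L^2(\mathbb R)$ and $\partial_xu_0\in H^2(\mathbb R)$ (weak derivative). Then the problem has a unique global-in-time solution $u$ satisfying $$u-\tilde u\in C^0\big([0,\infty);H^3(\mathbb R)\big),\qquad \partial_xu\in L^2\big(0,\infty;H^3(\mathbb R)\big),\qquad \partial_tu\in L^2\big(0,\infty;H^2(\mathbb R)\big).$$ Here derivatives are weak derivatives, the equation holds for almost every $(t,x)$, uniqueness is within this class, and $u(t,\cdot)$ is identified with its continuous representative, which is of class $C^2$ for every $t\ge 0$. Moreover $$\lim_{t\to\infty}\Big(\sup_{x\in\mathbb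 R}|u(t,x)-\tilde u|+\sup_{x\in\mathbb R}|\partial_xu(t,x)|+\sup_{x\in\mathbb R}|\partial_x^2u(t,x)|\Big)=0.$$ -/

import Mathlib

open MeasureTheory Set Filter Topology
open scoped ContDiff ENNReal

noncomputable section

/-- `h` is a weak derivative of `g` on the open set `s ⊆ ℝ`, for functions with values in a real
normed space: both are locally integrable on `s`, and `∫ η' g = -∫ η h` for every scalar test
function `η ∈ C_c^∞(s)`. -/
def IsWeakDerivOn {E : Type*} [NormedAddCommGroup E] [NormedSpace ℝ E]
    (s : Set ℝ) (g h : ℝ → E) : Prop :=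
  LocallyIntegrableOn g s ∧ LocallyIntegrableOn h s ∧
    ∀ η : ℝ → ℝ, ContDiff ℝ ∞ η → HasCompactSupport η → tsupport η ⊆ s →
      ∫ x, deriv η x • g x = -∫ x, η x • h x

/-- The real Lebesgue space `L²(ℝ)`. -/
abbrev LTwo : Type := Lp ℝ 2 (volume : Measure ℝ)

theorem LTwo.locallyIntegrable (g : LTwo) : LocallyIntegrable (g : ℝ → ℝ) :=
  (Lp.memLp g).locallyIntegrable (by norm_num)

theorem isWeakDerivOn_univ_zero :
    IsWeakDerivOn univ ((0 : LTwo) : ℝ → ℝ) ((0 : LTwo) : ℝ → ℝ) := by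
  refine ⟨(LTwo.locallyIntegrable 0).locallyIntegrableOn _,
    (LTwo.locallyIntegrable 0).locallyIntegrableOn _, fun η _ _ _ => ?_⟩
  simp

theorem isWeakDerivOn_univ_add {g₁ g₂ h₁ h₂ : LTwo} (H₁ : IsWeakDerivOn univ (g₁ : ℝ → ℝ) h₁)
    (H₂ : IsWeakDerivOn univ (g₂ : ℝ → ℝ) h₂) :
    IsWeakDerivOn univ ((g₁ + g₂ : LTwo) : ℝ → ℝ) ((h₁ + h₂ : LTwo) : ℝ → ℝ) := by
  refine ⟨(LTwo.locallyIntegrable _).locallyIntegrableOn _,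
    (LTwo.locallyIntegrable _).locallyIntegrableOn _, fun η hη hc hs => ?_⟩
  have hd : Continuous (deriv η) := hη.continuous_deriv (by simp)
  have key : ∀ (θ : ℝ → ℝ), Continuous θ → HasCompactSupport θ → ∀ a b : LTwo,
      ∫ x, θ x • ((a + b : LTwo) : ℝ → ℝ) x = (∫ x, θ x • a x) + ∫ x, θ x • b x := by
    intro θ hθ hθc a b
    rw [← integral_add
      ((LTwo.locallyIntegrable a).integrable_smul_left_of_hasCompactSupport hθ hθc)
      ((LTwo.locallyIntegrable b).integrable_smul_left_of_hasCompactSupport hθ hθc)]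
    refine integral_congr_ae ?_
    filter_upwards [Lp.coeFn_add a b] with x hx
    rw [hx, Pi.add_apply, smul_add]
  rw [key _ hd hc.deriv, key _ hη.continuous hc, H₁.2.2 η hη hc hs, H₂.2.2 η hη hc hs]
  ring

theorem isWeakDerivOn_univ_smul (c : ℝ) {g h : LTwo} (H : IsWeakDerivOn univ (g : ℝ → ℝ) h) :
    IsWeakDerivOn univ ((c • g : LTwo) : ℝ → ℝ) ((c • h : LTwo) : ℝ → ℝ) := by
  refine ⟨(LTwo.locallyIntegrable _).locallyIntegrableOn _,
    (LTwo.locallyIntegrable _).locallyIntegrableOn _, fun η hη hc hs => ?_⟩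
  have key : ∀ (θ : ℝ → ℝ) (a : LTwo),
      ∫ x, θ x • ((c • a : LTwo) : ℝ → ℝ) x = c * ∫ x, θ x • a x := by
    intro θ a
    rw [← integral_const_mul]
    refine integral_congr_ae ?_
    filter_upwards [Lp.coeFn_smul c a] with x hx
    rw [hx, Pi.smul_apply]
    simp only [smul_eq_mul]
    ring
  rw [key, key, H.2.2 η hη hc hs]
  ring

/-- The Sobolev space `H^k(ℝ)`: an element is an `L²` function listed together with its weak
derivatives of orders `0, …, k`, all in `L²`.  The norm inherited from the `ℓ²`-product is
`‖v‖_{H^k} = (∑_{j ≤ k} ‖∂^j v‖²_{L²})^{1/2}`.  Weak derivatives are unique in `L²`, so an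
element is determined by its entry of index `0`. -/
def SobolevSpace (k : ℕ) : Submodule ℝ (PiLp 2 fun _ : Fin (k + 1) => LTwo) where
  carrier := {v | ∀ j : Fin k, IsWeakDerivOn univ (v j.castSucc : ℝ → ℝ) (v j.succ : ℝ → ℝ)}
  zero_mem' := fun _ => isWeakDerivOn_univ_zero
  add_mem' := fun ha hb j => isWeakDerivOn_univ_add (ha j) (hb j)
  smul_mem' := fun c _ hx j => isWeakDerivOn_univ_smul c (hx j)

/-- The weak derivative `∂^j v ∈ L²(ℝ)` of `v ∈ H^k(ℝ)`, for `j ≤ k`; `wderiv v 0` is the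
function `v` itself. -/
def wderiv {k : ℕ} (v : SobolevSpace k) (j : Fin (k + 1)) : LTwo :=
  (v : PiLp 2 fun _ : Fin (k + 1) => LTwo) j

/-- `u = u(t, x)` (only the times `t ≥ 0` matter) is a global solution of
`u_t + f(u)_x - α u_{txx} - β u_{xx} + δ u_{xxx} + γ u_{xxxx} = 0`, `u(0, ·) = u₀`, in the class
`u - c ∈ C([0, ∞); H³)`, `u_x ∈ L²(0, ∞; H³)`, `u_t ∈ L²(0, ∞; H²)`.

Each `u(t, ·)` is the continuous representative.  The curves `φ`, `p`, `q` are `u - c`, `u_x`,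
`u_t` as curves in Sobolev spaces; `L²(0, ∞; H^k)` is the Bochner space, `u_x` is the weak
derivative in `x`, and `u_t` is the weak derivative of the `L²`-valued curve `u - c` on
`(0, ∞)`.  The equation holds almost everywhere. -/
def IsGlobalSolution (α β γ δ c : ℝ) (f u₀ : ℝ → ℝ) (u : ℝ → ℝ → ℝ) : Prop :=
  (∀ t, 0 ≤ t → Continuous (u t)) ∧
  u 0 =ᵐ[volume] u₀ ∧
  ∃ (φ p : ℝ → SobolevSpace 3) (q : ℝ → SobolevSpace 2),
    (∀ t, 0 ≤ t → (fun x => u t x - c) =ᵐ[volume] wderiv (φ t) 0) ∧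
    ContinuousOn φ (Ici 0) ∧
    (∀ᵐ t ∂volume.restrict (Ioi 0), IsWeakDerivOn univ (u t) (wderiv (p t) 0)) ∧
    MemLp p 2 (volume.restrict (Ioi 0)) ∧
    IsWeakDerivOn (Ioi 0) (fun t => wderiv (φ t) 0) (fun t => wderiv (q t) 0) ∧
    MemLp q 2 (volume.restrict (Ioi 0)) ∧
    ∀ᵐ t ∂volume.restrict (Ioi 0), ∃ F : ℝ → ℝ,
      IsWeakDerivOn univ (fun x => f (u t x)) F ∧
      ∀ᵐ x, wderiv (q t) 0 x + F x - α * wderiv (q t) 2 x - β * wderiv (p t) 1 x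
        + δ * wderiv (p t) 2 x + γ * wderiv (p t) 3 x = 0

end

/-!
The problem is solved on the Fourier side.  Write `u = c + Re 𝓕 ψ`, so that `∂_x` becomes
multiplication by `i k` with the wave number `k = -2πξ`, and apply `(1 - α ∂_x²)⁻¹`.  The equation
turns into

  `ψ' = -m ψ - σ N(ψ)`,  `m = (γ k⁴ + β k² - i δ k³) / (1 + α k²)`,  `σ = i k / (1 + α k²)`,

where `N` is the map `v ↦ f(c + v) - f(c)` in the Fourier representation.  The symbol `m` has
nonnegative real part, and `σ` is bounded: the dispersive term `α ∂_t ∂_x² u` makes the flux a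
bounded perturbation in `L²`.  As `m` is unbounded, solutions are understood after integration in
time and restriction to bounded windows of frequencies (`FourierSol`).

If `f` is replaced by a flux with globally bounded derivative (`exists_truncation`), `N` is
Lipschitz on `L²` and Banach's fixed point theorem for Duhamel's formula yields a global solution
(`exists_fourierSol`).  Two energy inequalities, obtained by multiplying with a weight `a(k)`,
control it.

* The weight `1 + α k²` gives the `H¹` law, in which the flux does no work since
  `∫ v_x g(v) dx = 0` (`energy_flux_free`).  Hence `v = u - c` is bounded by a constant that
  depends on the datum alone; a truncation beyond this bound is never active, and the solution
  solves the original equation (`exists_smoothSol`).  The law also makes `∂_x v` and `∂_x² v`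
  square integrable in space and time.
* The weight `(1 + α k²)(k² + k⁴)` gives an `H³` inequality (`energy_high`) whose right-hand side is
  `∫∫ |∂_x g(v)|²`, finite by the first law.  It holds on every set of frequencies; on the
  complements of large windows it shows that high-frequency tails are small uniformly in time,
  and hence continuity in `H³` (`SmoothSol.continuousOn_bessel`).  The energy is integrable in
  time and can grow after time `s` only by the tail `∫_s^∞`, so that it tends to `0`
  (`SmoothSol.tendsto_high`).

The supremum of `|∂_x^j v|` is at most the `L¹` norm of `k^j ψ`, which the interpolation inequality
`sq_lintegral_enorm_le` bounds by a small multiple of the bounded `L²` norm and a large multiple of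
the decaying energy.  This proves the decay.

For uniqueness, every solution of the class is shown to satisfy the integrated equation on the
Fourier side (`IsGlobalSolution.exists_fourierSol`), where the values on a bounded time interval
are bounded by the `H³` norm, and a common truncation of the flux applies.  Two such solutions
agree by the energy inequality for their difference and Grönwall's inequality
(`FourierSol.eq_of_lipschitz`).
-/

/-! ### Bounded multipliers, frequency windows and weighted energies -/

noncomputable section

/-- The complex space `L²(ℝ; ℂ)`, used both for functions of `x` and of the frequency. -/
abbrev CLTwo : Type := Lp ℂ 2 (volume : Measure ℝ)

/-- A bounded measurable Fourier symbol. -/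
def BddSymbol (s : ℝ → ℂ) : Prop := Measurable s ∧ ∃ C, ∀ ξ, ‖s ξ‖ ≤ C

theorem BddSymbol.memLp {s : ℝ → ℂ} (hs : BddSymbol s) (ψ : CLTwo) :
    MemLp (fun ξ => s ξ * ψ ξ) 2 volume := by
  obtain ⟨hm, C, hC⟩ := hs
  refine (Lp.memLp ψ).of_le_mul (c := C) (hm.aestronglyMeasurable.mul (Lp.aestronglyMeasurable ψ))
    (Eventually.of_forall fun ξ => ?_)
  rw [norm_mul]
  exact mul_le_mul_of_nonneg_right (hC ξ) (norm_nonneg _)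

theorem norm_toLp_mul_le {s : ℝ → ℂ} (hs : BddSymbol s) {C : ℝ} (hC : ∀ ξ, ‖s ξ‖ ≤ C)
    (ψ : CLTwo) : ‖(hs.memLp ψ).toLp _‖ ≤ C * ‖ψ‖ := by
  refine Lp.norm_le_mul_norm_of_ae_le_mul ?_
  filter_upwards [(hs.memLp ψ).coeFn_toLp] with ξ hξ
  rw [hξ, norm_mul]
  exact mul_le_mul_of_nonneg_right (hC ξ) (norm_nonneg _)

open Classical in
/-- Multiplication by a symbol as a bounded operator on `L²`; it is `0` unless the symbol is
bounded and measurable. -/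
def mulOp (s : ℝ → ℂ) : CLTwo →L[ℂ] CLTwo :=
  if hs : BddSymbol s then
    LinearMap.mkContinuous
      { toFun := fun ψ => (hs.memLp ψ).toLp _
        map_add' := fun ψ χ => by
          refine Lp.ext ?_
          filter_upwards [(hs.memLp (ψ + χ)).coeFn_toLp, (hs.memLp ψ).coeFn_toLp,
            (hs.memLp χ).coeFn_toLp, Lp.coeFn_add ψ χ,
            Lp.coeFn_add ((hs.memLp ψ).toLp _) ((hs.memLp χ).toLp _)] with ξ h1 h2 h3 h4 h5
          rw [h1, h5, h4, Pi.add_apply, Pi.add_apply, h2, h3, mul_add]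
        map_smul' := fun c ψ => by
          refine Lp.ext ?_
          filter_upwards [(hs.memLp (c • ψ)).coeFn_toLp, (hs.memLp ψ).coeFn_toLp,
            Lp.coeFn_smul c ψ, Lp.coeFn_smul c ((hs.memLp ψ).toLp _)] with ξ h1 h2 h3 h4
          rw [h1, RingHom.id_apply, h4, h3, Pi.smul_apply, Pi.smul_apply, h2, smul_eq_mul,
            smul_eq_mul]
          ring }
      hs.2.choose (fun ψ => norm_toLp_mul_le hs hs.2.choose_spec ψ)
  else 0

theorem coeFn_mulOp {s : ℝ → ℂ} (hs : BddSymbol s) (ψ : CLTwo) :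
    mulOp s ψ =ᵐ[volume] fun ξ => s ξ * ψ ξ := by
  rw [mulOp, dif_pos hs]
  exact (hs.memLp ψ).coeFn_toLp

theorem norm_mulOp_apply_le {s : ℝ → ℂ} {C : ℝ} (hC : ∀ ξ, ‖s ξ‖ ≤ C) (ψ : CLTwo) :
    ‖mulOp s ψ‖ ≤ C * ‖ψ‖ := by
  by_cases hs : BddSymbol s
  · rw [mulOp, dif_pos hs]
    exact norm_toLp_mul_le hs hC ψ
  · rw [mulOp, dif_neg hs]
    simpa using mul_nonneg ((norm_nonneg _).trans (hC 0)) (norm_nonneg ψ)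

theorem norm_mulOp_le {s : ℝ → ℂ} {C : ℝ} (hC : ∀ ξ, ‖s ξ‖ ≤ C) : ‖mulOp s‖ ≤ C :=
  ContinuousLinearMap.opNorm_le_bound _ ((norm_nonneg _).trans (hC 0)) (norm_mulOp_apply_le hC)

theorem BddSymbol.mul {s r : ℝ → ℂ} (hs : BddSymbol s) (hr : BddSymbol r) :
    BddSymbol (fun ξ => s ξ * r ξ) := by
  obtain ⟨hm, C, hC⟩ := hs
  obtain ⟨hm', C', hC'⟩ := hr
  refine ⟨hm.mul hm', C * C', fun ξ => ?_⟩
  rw [norm_mul]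
  exact mul_le_mul (hC ξ) (hC' ξ) (norm_nonneg _) ((norm_nonneg _).trans (hC ξ))

theorem BddSymbol.add {s r : ℝ → ℂ} (hs : BddSymbol s) (hr : BddSymbol r) :
    BddSymbol (fun ξ => s ξ + r ξ) := by
  obtain ⟨hm, C, hC⟩ := hs
  obtain ⟨hm', C', hC'⟩ := hr
  exact ⟨hm.add hm', C + C', fun ξ => (norm_add_le _ _).trans (add_le_add (hC ξ) (hC' ξ))⟩

theorem BddSymbol.neg {s : ℝ → ℂ} (hs : BddSymbol s) : BddSymbol (fun ξ => - s ξ) := by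
  obtain ⟨hm, C, hC⟩ := hs
  exact ⟨hm.neg, C, fun ξ => by rw [norm_neg]; exact hC ξ⟩

theorem BddSymbol.const_mul {s : ℝ → ℂ} (c : ℂ) (hs : BddSymbol s) :
    BddSymbol (fun ξ => c * s ξ) :=
  BddSymbol.mul ⟨measurable_const, ‖c‖, fun _ => le_rfl⟩ hs

theorem mulOp_mulOp {s r : ℝ → ℂ} (hs : BddSymbol s) (hr : BddSymbol r) (ψ : CLTwo) :
    mulOp s (mulOp r ψ) = mulOp (fun ξ => s ξ * r ξ) ψ := by
  refine Lp.ext ?_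
  filter_upwards [coeFn_mulOp hs (mulOp r ψ), coeFn_mulOp hr ψ, coeFn_mulOp (hs.mul hr) ψ]
    with ξ h1 h2 h3
  rw [h1, h2, h3, mul_assoc]

theorem mulOp_add {s r : ℝ → ℂ} (hs : BddSymbol s) (hr : BddSymbol r) :
    mulOp (fun ξ => s ξ + r ξ) = mulOp s + mulOp r := by
  refine ContinuousLinearMap.ext fun ψ => Lp.ext ?_
  filter_upwards [coeFn_mulOp (hs.add hr) ψ, coeFn_mulOp hs ψ, coeFn_mulOp hr ψ,
    Lp.coeFn_add (mulOp s ψ) (mulOp r ψ)] with ξ h1 h2 h3 h4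
  rw [add_apply, h4, h1, Pi.add_apply, h2, h3, add_mul]

theorem mulOp_const_mul {s : ℝ → ℂ} (c : ℂ) (hs : BddSymbol s) :
    mulOp (fun ξ => c * s ξ) = c • mulOp s := by
  refine ContinuousLinearMap.ext fun ψ => Lp.ext ?_
  filter_upwards [coeFn_mulOp (hs.const_mul c) ψ, coeFn_mulOp hs ψ,
    Lp.coeFn_smul c (mulOp s ψ)] with ξ h1 h2 h3
  rw [smul_apply, h3, h1, Pi.smul_apply, h2, smul_eq_mul, mul_assoc]

theorem mulOp_neg {s : ℝ → ℂ} (hs : BddSymbol s) : mulOp (fun ξ => - s ξ) = - mulOp s := by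
  have := mulOp_const_mul (-1) hs
  simpa using this

theorem mulOp_one : mulOp (fun _ => 1) = ContinuousLinearMap.id ℂ CLTwo := by
  refine ContinuousLinearMap.ext fun ψ => Lp.ext ?_
  filter_upwards [coeFn_mulOp (s := fun _ => 1) ⟨measurable_const, 1, by simp⟩ ψ] with ξ h1
  rw [h1, one_mul, ContinuousLinearMap.id_apply]

/-- Dominated convergence for multiplication operators. -/
theorem tendsto_mulOp {ι : Type*} {l : Filter ι} [l.IsCountablyGenerated] {s : ι → ℝ → ℂ}
    {s₀ : ℝ → ℂ} {C : ℝ} (hm : ∀ i, Measurable (s i)) (hm₀ : Measurable s₀)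
    (hC : ∀ i ξ, ‖s i ξ‖ ≤ C) (hC₀ : ∀ ξ, ‖s₀ ξ‖ ≤ C)
    (h : ∀ ξ, Tendsto (fun i => s i ξ) l (𝓝 (s₀ ξ))) (ψ : CLTwo) :
    Tendsto (fun i => mulOp (s i) ψ) l (𝓝 (mulOp s₀ ψ)) := by
  have hb : ∀ i, BddSymbol (s i) := fun i => ⟨hm i, C, hC i⟩
  have hb₀ : BddSymbol s₀ := ⟨hm₀, C, hC₀⟩
  rw [tendsto_iff_norm_sub_tendsto_zero]
  have key : ∀ i, ‖mulOp (s i) ψ - mulOp s₀ ψ‖ ^ 2 = ∫ ξ, ‖s i ξ - s₀ ξ‖ ^ 2 * ‖ψ ξ‖ ^ 2 := by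
    intro i
    have := @inner_self_eq_norm_sq_to_K ℂ _ _ _ _ (mulOp (s i) ψ - mulOp s₀ ψ)
    rw [L2.inner_def] at this
    have h2 : ∫ ξ, ((‖s i ξ - s₀ ξ‖ ^ 2 * ‖ψ ξ‖ ^ 2 : ℝ) : ℂ)
        = ((‖mulOp (s i) ψ - mulOp s₀ ψ‖ : ℝ) : ℂ) ^ 2 := by
      rw [← Complex.coe_algebraMap, ← this]
      refine integral_congr_ae ?_
      filter_upwards [coeFn_mulOp (hb i) ψ, coeFn_mulOp hb₀ ψ,
        Lp.coeFn_sub (mulOp (s i) ψ) (mulOp s₀ ψ)] with ξ h1 h2 h3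
      rw [h3, Pi.sub_apply, h1, h2, ← sub_mul, inner_self_eq_norm_sq_to_K, norm_mul]
      push_cast
      simp [mul_pow]
    rw [integral_complex_ofReal] at h2
    exact_mod_cast h2.symm
  have hsq : Tendsto (fun i => ‖mulOp (s i) ψ - mulOp s₀ ψ‖ ^ 2) l (𝓝 0) := by
    simp_rw [key]
    have hint : Integrable (fun ξ => ‖ψ ξ‖ ^ 2) volume := (Lp.memLp ψ).integrable_norm_pow (by norm_num)
    have : Tendsto (fun i => ∫ ξ, ‖s i ξ - s₀ ξ‖ ^ 2 * ‖ψ ξ‖ ^ 2) l (𝓝 (∫ ξ : ℝ, (0 : ℝ))) := by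
      refine tendsto_integral_filter_of_dominated_convergence (fun ξ => (2 * C) ^ 2 * ‖ψ ξ‖ ^ 2)
        (Eventually.of_forall fun i => ?_) (Eventually.of_forall fun i =>
          Eventually.of_forall fun ξ => ?_) (hint.const_mul _) (Eventually.of_forall fun ξ => ?_)
      · exact (((hm i).sub hm₀).norm.pow_const 2).aestronglyMeasurable.mul hint.aestronglyMeasurable
      · rw [Real.norm_of_nonneg (by positivity)]
        have h1 : ‖s i ξ - s₀ ξ‖ ≤ 2 * C := (norm_sub_le _ _).trans (by
          linarith [hC i ξ, hC₀ ξ])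
        gcongr
      · have h1 : Tendsto (fun i => ‖s i ξ - s₀ ξ‖) l (𝓝 0) :=
          tendsto_iff_norm_sub_tendsto_zero.1 (h ξ)
        simpa using (h1.pow 2).mul_const (‖ψ ξ‖ ^ 2)
    simpa using this
  have := hsq.sqrt
  simpa [Real.sqrt_sq (norm_nonneg _)] using this

/-- A bounded measurable set of frequencies. -/
def Window (B : Set ℝ) : Prop := MeasurableSet B ∧ ∃ n : ℕ, B ⊆ Icc (-n : ℝ) n

theorem window_Icc (n : ℕ) : Window (Icc (-n : ℝ) n) := ⟨measurableSet_Icc, n, subset_rfl⟩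

theorem Window.bddSymbol {B : Set ℝ} (hB : Window B) {s : ℝ → ℂ} (hs : Continuous s) :
    BddSymbol (B.indicator s) := by
  obtain ⟨hm, n, hn⟩ := hB
  obtain ⟨C, hC⟩ := (isCompact_Icc (a := (-n : ℝ)) (b := n)).exists_bound_of_continuousOn
    hs.continuousOn
  refine ⟨hs.measurable.indicator hm, C, fun ξ => ?_⟩
  by_cases h : ξ ∈ B
  · rw [indicator_of_mem h]
    exact hC ξ (hn h)
  · rw [indicator_of_notMem h, norm_zero]
    exact (norm_nonneg _).trans (hC 0 (by simp))

/-- Multiplication by a symbol cut off to a window of frequencies. -/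
def win (B : Set ℝ) (s : ℝ → ℂ) : CLTwo →L[ℂ] CLTwo := mulOp (B.indicator s)

theorem coeFn_win {B : Set ℝ} (hB : Window B) {s : ℝ → ℂ} (hs : Continuous s) (ψ : CLTwo) :
    win B s ψ =ᵐ[volume] fun ξ => B.indicator s ξ * ψ ξ :=
  coeFn_mulOp (hB.bddSymbol hs) ψ

theorem win_win {B : Set ℝ} (hB : Window B) {s r : ℝ → ℂ} (hs : Continuous s) (hr : Continuous r)
    (ψ : CLTwo) : win B s (win B r ψ) = win B (fun ξ => s ξ * r ξ) ψ := by
  rw [win, win, mulOp_mulOp (hB.bddSymbol hs) (hB.bddSymbol hr), win]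
  congr 2
  ext ξ
  by_cases h : ξ ∈ B <;> simp [h]

theorem win_mulOp {B : Set ℝ} (hB : Window B) {s r : ℝ → ℂ} (hs : Continuous s)
    (hr : BddSymbol r) (ψ : CLTwo) : win B s (mulOp r ψ) = win B (fun ξ => s ξ * r ξ) ψ := by
  rw [win, mulOp_mulOp (hB.bddSymbol hs) hr, win]
  congr 2
  ext ξ
  by_cases h : ξ ∈ B <;> simp [h]

/-- The bounded windows exhaust the frequency line. -/
theorem tendsto_win_one (ψ : CLTwo) :
    Tendsto (fun n : ℕ => win (Icc (-n : ℝ) n) 1 ψ) atTop (𝓝 ψ) := by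
  have h1 : mulOp (fun _ => 1) ψ = ψ := by rw [mulOp_one]; rfl
  have := tendsto_mulOp (l := atTop) (s := fun n : ℕ => (Icc (-n : ℝ) n).indicator 1)
    (s₀ := fun _ => 1) (C := 1) (fun n => measurable_one.indicator measurableSet_Icc)
    measurable_const (fun n ξ => ?_) (fun ξ => by simp) (fun ξ => ?_) ψ
  · rwa [h1] at this
  · by_cases h : ξ ∈ Icc (-n : ℝ) n <;> simp only [h, indicator_of_mem, indicator_of_notMem,
      not_false_eq_true] <;> simp
  · refine tendsto_const_nhds.congr' ?_
    filter_upwards [eventually_ge_atTop ⌈|ξ|⌉₊] with n hn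
    have h : |ξ| ≤ n := (Nat.le_ceil _).trans (by exact_mod_cast hn)
    rw [indicator_of_mem (show ξ ∈ Icc (-n : ℝ) n from abs_le.1 h)]
    rfl

theorem eq_of_forall_win_eq {ψ χ : CLTwo} (h : ∀ B, Window B → win B 1 ψ = win B 1 χ) : ψ = χ :=
  tendsto_nhds_unique (tendsto_win_one ψ)
    ((tendsto_win_one χ).congr fun n => (h _ (window_Icc n)).symm)

/-- The weighted energy `∫_B a |ψ|²` of `ψ` over the frequencies in `B`. -/
def wE (B : Set ℝ) (a : ℝ → ℝ) (ψ : CLTwo) : ℝ≥0∞ :=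
  ∫⁻ ξ in B, ENNReal.ofReal (a ξ) * ‖ψ ξ‖ₑ ^ 2

theorem aemeasurable_enorm_sq (ψ : CLTwo) : AEMeasurable (fun ξ => ‖ψ ξ‖ₑ ^ 2) volume :=
  (Lp.aestronglyMeasurable ψ).enorm.pow_const 2

theorem enorm_sq_eq_lintegral (ψ : CLTwo) : ‖ψ‖ₑ ^ 2 = ∫⁻ ξ, ‖ψ ξ‖ₑ ^ 2 := by
  rw [Lp.enorm_def, eLpNorm_eq_lintegral_rpow_enorm_toReal (by norm_num) (by norm_num)]
  simp only [ENNReal.toReal_ofNat, one_div]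
  rw [← ENNReal.rpow_natCast, ← ENNReal.rpow_mul]
  norm_num

theorem wE_one (ψ : CLTwo) : wE univ (fun _ => 1) ψ = ‖ψ‖ₑ ^ 2 := by
  rw [enorm_sq_eq_lintegral]
  simp [wE]

theorem enorm_mulOp_sq {s : ℝ → ℂ} (hs : BddSymbol s) (ψ : CLTwo) :
    ‖mulOp s ψ‖ₑ ^ 2 = wE univ (fun ξ => ‖s ξ‖ ^ 2) ψ := by
  rw [enorm_sq_eq_lintegral, wE, Measure.restrict_univ]
  refine lintegral_congr_ae ?_
  filter_upwards [coeFn_mulOp hs ψ] with ξ h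
  rw [h, enorm_mul, mul_pow, ENNReal.ofReal_pow (norm_nonneg _), ofReal_norm]

theorem wE_mono_set {B B' : Set ℝ} (h : B ⊆ B') (a : ℝ → ℝ) (ψ : CLTwo) : wE B a ψ ≤ wE B' a ψ :=
  lintegral_mono_set h

theorem wE_mono {B : Set ℝ} (hB : MeasurableSet B) {a b : ℝ → ℝ} (h : ∀ ξ ∈ B, a ξ ≤ b ξ)
    (ψ : CLTwo) : wE B a ψ ≤ wE B b ψ :=
  setLIntegral_mono' hB fun ξ hξ => by gcongr; exact h ξ hξ

theorem wE_const_mul (B : Set ℝ) {a : ℝ → ℝ} {c : ℝ} (hc : 0 ≤ c) (ψ : CLTwo) :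
    wE B (fun ξ => c * a ξ) ψ = ENNReal.ofReal c * wE B a ψ := by
  rw [wE, wE, ← lintegral_const_mul' _ _ ENNReal.ofReal_ne_top]
  refine lintegral_congr fun ξ => ?_
  rw [ENNReal.ofReal_mul hc, mul_assoc]

theorem wE_add (B : Set ℝ) {a b : ℝ → ℝ} (ha : Measurable a) (ha0 : ∀ ξ, 0 ≤ a ξ)
    (hb0 : ∀ ξ, 0 ≤ b ξ) (ψ : CLTwo) :
    wE B (fun ξ => a ξ + b ξ) ψ = wE B a ψ + wE B b ψ := by
  rw [wE, wE, wE, ← lintegral_add_left']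
  · refine lintegral_congr fun ξ => ?_
    rw [ENNReal.ofReal_add (ha0 ξ) (hb0 ξ), add_mul]
  · exact (ha.ennreal_ofReal.aemeasurable.mul (aemeasurable_enorm_sq ψ)).restrict

/-- A weighted energy finite on the whole line has vanishing high-frequency tails. -/
theorem tendsto_wE_compl {a : ℝ → ℝ} {ψ : CLTwo} (h : wE univ a ψ ≠ ⊤) :
    Tendsto (fun n : ℕ => wE (Icc (-n : ℝ) n)ᶜ a ψ) atTop (𝓝 0) := by
  have hm : Tendsto (fun n : ℕ => (volume.withDensity
      fun ξ => ENNReal.ofReal (a ξ) * ‖ψ ξ‖ₑ ^ 2) (Icc (-n : ℝ) n)ᶜ) atTop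
      (𝓝 ((volume.withDensity
      fun ξ => ENNReal.ofReal (a ξ) * ‖ψ ξ‖ₑ ^ 2) (⋂ n : ℕ, (Icc (-n : ℝ) n)ᶜ))) := by
    refine tendsto_measure_iInter_atTop (fun n => measurableSet_Icc.compl.nullMeasurableSet)
      (fun i j hij => compl_subset_compl.2 (Icc_subset_Icc ?_ ?_)) ⟨0, ?_⟩
    · simpa using hij
    · simpa using hij
    · refine ne_top_of_le_ne_top h ?_
      rw [withDensity_apply _ measurableSet_Icc.compl]
      exact lintegral_mono_set (subset_univ _)
  have he : (⋂ n : ℕ, (Icc (-n : ℝ) n)ᶜ) = (∅ : Set ℝ) := by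
    refine eq_empty_of_forall_notMem fun ξ hξ => ?_
    refine mem_iInter.1 hξ ⌈|ξ|⌉₊ ?_
    exact abs_le.1 (Nat.le_ceil _)
  rw [he, measure_empty] at hm
  refine hm.congr fun n => ?_
  rw [withDensity_apply _ measurableSet_Icc.compl, wE]

/-- Weighted energies are limits of their truncations to bounded windows. -/
theorem wE_eq_iSup (B : Set ℝ) (a : ℝ → ℝ) (ψ : CLTwo) :
    wE B a ψ = ⨆ n : ℕ, wE (B ∩ Icc (-n : ℝ) n) a ψ := by
  have hU : B = ⋃ n : ℕ, (B ∩ Icc (-n : ℝ) n) := by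
    rw [← inter_iUnion]
    refine (inter_eq_left.2 fun ξ _ => mem_iUnion.2 ⟨⌈|ξ|⌉₊, ?_⟩).symm
    exact abs_le.1 (Nat.le_ceil _)
  conv_lhs => rw [wE, hU]
  rw [setLIntegral_iUnion_of_directed]
  · rfl
  · refine Monotone.directed_le fun i j hij => inter_subset_inter_right _ (Icc_subset_Icc ?_ ?_)
    · simpa using hij
    · simpa using hij

theorem monotone_wE_inter (B : Set ℝ) (a : ℝ → ℝ) (ψ : CLTwo) :
    Monotone fun n : ℕ => wE (B ∩ Icc (-n : ℝ) n) a ψ := fun i j hij =>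
  wE_mono_set (inter_subset_inter_right _ (Icc_subset_Icc (by simpa using hij)
    (by simpa using hij))) a ψ

theorem Window.inter {B : Set ℝ} (hB : MeasurableSet B) (n : ℕ) : Window (B ∩ Icc (-n : ℝ) n) :=
  ⟨hB.inter measurableSet_Icc, n, inter_subset_right⟩

/-- The quadratic form `∫_B a |ψ|²` for a window `B`. -/
def qE (B : Set ℝ) (a : ℝ → ℝ) (ψ : CLTwo) : ℝ := ∫ ξ in B, a ξ * ‖ψ ξ‖ ^ 2

theorem inner_win_eq {B : Set ℝ} (hB : Window B) {s : ℝ → ℂ} (hs : Continuous s) (ψ χ : CLTwo) :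
    inner ℂ (win B s ψ) χ = ∫ ξ in B, inner ℂ (s ξ * ψ ξ) (χ ξ) := by
  rw [L2.inner_def, ← integral_indicator hB.1]
  refine integral_congr_ae ?_
  filter_upwards [coeFn_win hB hs ψ] with ξ h
  rw [h]
  by_cases h : ξ ∈ B <;> simp [h]

theorem integrableOn_inner_win {B : Set ℝ} (hB : Window B) {s : ℝ → ℂ} (hs : Continuous s)
    (ψ χ : CLTwo) : IntegrableOn (fun ξ => inner ℂ (s ξ * ψ ξ) (χ ξ)) B := by
  rw [← integrable_indicator_iff hB.1]
  refine (L2.integrable_inner (𝕜 := ℂ) (win B s ψ) χ).congr ?_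
  filter_upwards [coeFn_win hB hs ψ] with ξ h
  rw [h]
  by_cases h : ξ ∈ B <;> simp [h]

theorem inner_ofReal_mul_self (r : ℝ) (z : ℂ) :
    inner ℂ ((r : ℂ) * z) z = ((r * ‖z‖ ^ 2 : ℝ) : ℂ) := by
  have h : (r : ℂ) * z = (r : ℂ) • z := rfl
  rw [h, inner_smul_left, inner_self_eq_norm_sq_to_K, Complex.conj_ofReal]
  push_cast
  rfl

theorem re_inner_win_self {B : Set ℝ} (hB : Window B) {a : ℝ → ℝ} (ha : Continuous a)
    (ψ : CLTwo) : (inner ℂ (win B (fun ξ => (a ξ : ℂ)) ψ) ψ).re = qE B a ψ := by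
  have hs : Continuous fun ξ => (a ξ : ℂ) := Complex.continuous_ofReal.comp ha
  rw [inner_win_eq hB hs, qE]
  simp_rw [inner_ofReal_mul_self]
  rw [integral_complex_ofReal, Complex.ofReal_re]

theorem integrableOn_qE {B : Set ℝ} (hB : Window B) {a : ℝ → ℝ} (ha : Continuous a)
    (ψ : CLTwo) : IntegrableOn (fun ξ => a ξ * ‖ψ ξ‖ ^ 2) B := by
  have := (integrableOn_inner_win hB (Complex.continuous_ofReal.comp ha) ψ ψ).re
  refine this.congr (Eventually.of_forall fun ξ => ?_)
  simp only [Function.comp_apply]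
  rw [inner_ofReal_mul_self]
  exact Complex.ofReal_re _

theorem ofReal_qE {B : Set ℝ} (hB : Window B) {a : ℝ → ℝ} (ha : Continuous a)
    (ha0 : ∀ ξ, 0 ≤ a ξ) (ψ : CLTwo) : ENNReal.ofReal (qE B a ψ) = wE B a ψ := by
  rw [qE, ofReal_integral_eq_lintegral_ofReal (integrableOn_qE hB ha ψ)
    (Eventually.of_forall fun ξ => mul_nonneg (ha0 ξ) (by positivity)), wE]
  refine lintegral_congr fun ξ => ?_
  rw [ENNReal.ofReal_mul (ha0 ξ), ENNReal.ofReal_pow (norm_nonneg _), ofReal_norm]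

theorem qE_nonneg {B : Set ℝ} {a : ℝ → ℝ} (ha0 : ∀ ξ, 0 ≤ a ξ) (ψ : CLTwo) :
    0 ≤ qE B a ψ := integral_nonneg fun ξ => mul_nonneg (ha0 ξ) (by positivity)

theorem continuous_qE {B : Set ℝ} (hB : Window B) {a : ℝ → ℝ} (ha : Continuous a) :
    Continuous (qE B a) := by
  have : qE B a = fun ψ => (inner ℂ (win B (fun ξ => (a ξ : ℂ)) ψ) ψ).re := by
    ext ψ; rw [re_inner_win_self hB ha]
  rw [this]
  fun_prop

/-- Weighted energies along a continuous curve depend measurably on time. -/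
theorem measurable_wE_comp {B : Set ℝ} (hB : MeasurableSet B) {a : ℝ → ℝ} (ha : Continuous a)
    (ha0 : ∀ ξ, 0 ≤ a ξ) {ψ : ℝ → CLTwo} (hψ : Continuous ψ) :
    Measurable fun t => wE B a (ψ t) := by
  have h : (fun t => wE B a (ψ t))
      = fun t => ⨆ n : ℕ, ENNReal.ofReal (qE (B ∩ Icc (-n : ℝ) n) a (ψ t)) := by
    ext t
    rw [wE_eq_iSup B]
    exact iSup_congr fun n => (ofReal_qE (Window.inter hB n) ha ha0 _).symm
  rw [h]
  exact Measurable.iSup fun n =>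
    (((continuous_qE (Window.inter hB n) ha).comp hψ).measurable).ennreal_ofReal

theorem inner_win_comm {B : Set ℝ} (hB : Window B) {a : ℝ → ℝ} (ha : Continuous a)
    (ψ χ : CLTwo) : inner ℂ (win B (fun ξ => (a ξ : ℂ)) ψ) χ
      = inner ℂ ψ (win B (fun ξ => (a ξ : ℂ)) χ) := by
  have hs : Continuous fun ξ => (a ξ : ℂ) := Complex.continuous_ofReal.comp ha
  rw [L2.inner_def, L2.inner_def]
  refine integral_congr_ae ?_
  filter_upwards [coeFn_win hB hs ψ, coeFn_win hB hs χ] with ξ h h'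
  rw [h, h']
  by_cases h : ξ ∈ B <;> simp [h]
  ring

end

/-! ### The integrated equation on the Fourier side and its energy inequality -/

noncomputable section

/-- `ψ` solves `ψ' = -m ψ - σ G` on `[0, T]`, in `L²` of the frequency line.  As `m` may be
unbounded, the equation is integrated in time and cut off to bounded windows of frequencies. -/
structure FourierSol (m σ : ℝ → ℂ) (T : ℝ) (ψ G : ℝ → CLTwo) : Prop where
  cont : Continuous ψ
  cont_forcing : Continuous G
  eq : ∀ B, Window B → ∀ t ∈ Icc 0 T, win B 1 (ψ t)
    = win B 1 (ψ 0) + ∫ s in (0 : ℝ)..t, (-(win B m (ψ s)) - win B σ (G s))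

theorem FourierSol.sub {m σ : ℝ → ℂ} {T : ℝ} {ψ G ψ' G' : ℝ → CLTwo}
    (h : FourierSol m σ T ψ G) (h' : FourierSol m σ T ψ' G') :
    FourierSol m σ T (fun t => ψ t - ψ' t) (fun t => G t - G' t) := by
  have c1 := h.cont
  have c2 := h.cont_forcing
  have c3 := h'.cont
  have c4 := h'.cont_forcing
  refine ⟨c1.sub c3, c2.sub c4, fun B hB t ht => ?_⟩
  rw [map_sub, map_sub, h.eq B hB t ht, h'.eq B hB t ht, add_sub_add_comm,
    ← intervalIntegral.integral_sub]
  · congr 2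
    ext1 s
    simp only [map_sub]
    abel
  · exact Continuous.intervalIntegrable (by fun_prop) _ _
  · exact Continuous.intervalIntegrable (by fun_prop) _ _

/-- The pointwise density of the derivative of `∫_B a |ψ|²` along `ψ' = -m ψ - σ G`. -/
def energyRate (B : Set ℝ) (m σ : ℝ → ℂ) (a : ℝ → ℝ) (ψ G : CLTwo) : ℝ :=
  2 * (inner ℂ (win B (fun ξ => (a ξ : ℂ)) ψ) (-(win B m ψ) - win B σ G)).re

theorem ae_rate {B : Set ℝ} (hB : Window B) {m σ : ℝ → ℂ} (hm : Continuous m)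
    (hσ : Continuous σ) (ψ G : CLTwo) :
    ∀ᵐ ξ, ξ ∈ B → (-(win B m ψ) - win B σ G : CLTwo) ξ = -(m ξ * ψ ξ) - σ ξ * G ξ := by
  filter_upwards [coeFn_win hB hm ψ, coeFn_win hB hσ G,
    Lp.coeFn_sub (-(win B m ψ)) (win B σ G), Lp.coeFn_neg (win B m ψ)] with ξ h1 h2 h3 h4 hξ
  rw [h3, Pi.sub_apply, h4, Pi.neg_apply, h1, h2, indicator_of_mem hξ, indicator_of_mem hξ]

theorem re_inner_eq_setIntegral {B : Set ℝ} (hB : Window B) {a : ℝ → ℝ} (ha : Continuous a)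
    (ψ χ : CLTwo) : (inner ℂ (win B (fun ξ => (a ξ : ℂ)) ψ) χ).re
      = ∫ ξ in B, a ξ * (inner ℂ (ψ ξ) (χ ξ)).re := by
  have hs : Continuous fun ξ => (a ξ : ℂ) := Complex.continuous_ofReal.comp ha
  rw [inner_win_eq hB hs]
  refine (integral_re (𝕜 := ℂ) (integrableOn_inner_win hB hs ψ χ)).symm.trans ?_
  refine integral_congr_ae (Eventually.of_forall fun ξ => ?_)
  have h : (a ξ : ℂ) * ψ ξ = (a ξ : ℂ) • ψ ξ := rfl
  simp only [h, inner_smul_left, Complex.conj_ofReal]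
  exact Complex.re_ofReal_mul _ _

theorem integrableOn_re_inner {B : Set ℝ} (hB : Window B) {a : ℝ → ℝ} (ha : Continuous a)
    (ψ χ : CLTwo) : IntegrableOn (fun ξ => a ξ * (inner ℂ (ψ ξ) (χ ξ)).re) B := by
  have hs : Continuous fun ξ => (a ξ : ℂ) := Complex.continuous_ofReal.comp ha
  refine (integrableOn_inner_win hB hs ψ χ).re.congr (Eventually.of_forall fun ξ => ?_)
  have h : (a ξ : ℂ) * ψ ξ = (a ξ : ℂ) • ψ ξ := rfl
  simp only [h, inner_smul_left, Complex.conj_ofReal]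
  exact Complex.re_ofReal_mul _ _

/-- An inequality between symbols at each frequency bounds the rate of the energy. -/
theorem energyRate_le {B : Set ℝ} (hB : Window B) {m σ : ℝ → ℂ} (hm : Continuous m)
    (hσ : Continuous σ) {a b κ : ℝ → ℝ} (ha : Continuous a) (hb : Continuous b)
    (hκ : Continuous κ)
    (hab : ∀ ξ (y g : ℂ), 2 * (a ξ * (inner ℂ y (-(m ξ * y) - σ ξ * g)).re)
      ≤ -(b ξ * ‖y‖ ^ 2) + κ ξ * ‖g‖ ^ 2) (ψ G : CLTwo) :
    energyRate B m σ a ψ G ≤ -(qE B b ψ) + qE B κ G := by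
  have hi : IntegrableOn (fun ξ => -(b ξ * ‖ψ ξ‖ ^ 2)) B := (integrableOn_qE hB hb ψ).neg
  rw [energyRate, re_inner_eq_setIntegral hB ha, qE, qE, ← integral_neg, ← integral_const_mul,
    ← integral_add hi (integrableOn_qE hB hκ G)]
  refine integral_mono_ae ((integrableOn_re_inner hB ha _ _).const_mul 2)
    (hi.add (integrableOn_qE hB hκ G)) ?_
  refine (ae_restrict_iff' hB.1).2 ?_
  filter_upwards [ae_rate hB hm hσ ψ G] with ξ h hξ
  rw [h hξ]
  exact hab ξ _ _

/-- The rate of the energy when the forcing enters only through the pairing with `d ψ`. -/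
theorem energyRate_eq {B : Set ℝ} (hB : Window B) {m σ d : ℝ → ℂ} (hm : Continuous m)
    (hσ : Continuous σ) (hd : Continuous d) {a b : ℝ → ℝ} (ha : Continuous a) (hb : Continuous b)
    (hab : ∀ ξ (y g : ℂ), 2 * (a ξ * (inner ℂ y (-(m ξ * y) - σ ξ * g)).re)
      = -(b ξ * ‖y‖ ^ 2) + 2 * (inner ℂ (d ξ * y) g).re) (ψ G : CLTwo) :
    energyRate B m σ a ψ G = -(qE B b ψ) + 2 * (inner ℂ (win B d ψ) G).re := by
  have h1 : (inner ℂ (win B d ψ) G).re = ∫ ξ in B, (inner ℂ (d ξ * ψ ξ) (G ξ)).re := by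
    rw [inner_win_eq hB hd]
    exact (integral_re (𝕜 := ℂ) (integrableOn_inner_win hB hd ψ G)).symm
  have hi : IntegrableOn (fun ξ => (inner ℂ (d ξ * ψ ξ) (G ξ)).re) B :=
    (integrableOn_inner_win hB hd ψ G).re
  have hi' : IntegrableOn (fun ξ => -(b ξ * ‖ψ ξ‖ ^ 2)) B := (integrableOn_qE hB hb ψ).neg
  rw [energyRate, re_inner_eq_setIntegral hB ha, qE, h1, ← integral_neg, ← integral_const_mul,
    ← integral_const_mul, ← integral_add hi' (hi.const_mul 2)]
  refine integral_congr_ae ((ae_restrict_iff' hB.1).2 ?_)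
  filter_upwards [ae_rate hB hm hσ ψ G] with ξ h hξ
  rw [h hξ]
  exact hab ξ _ _

theorem continuous_energyRate (B : Set ℝ) (m σ : ℝ → ℂ) (a : ℝ → ℝ) {ψ G : ℝ → CLTwo}
    (hψ : Continuous ψ) (hG : Continuous G) :
    Continuous fun t => energyRate B m σ a (ψ t) (G t) := by
  unfold energyRate
  fun_prop

/-- The energy identity on a bounded window of frequencies. -/
theorem FourierSol.energy_identity {m σ : ℝ → ℂ} {T : ℝ} {ψ G : ℝ → CLTwo}
    (h : FourierSol m σ T ψ G) {B : Set ℝ} (hB : Window B) {a : ℝ → ℝ} (ha : Continuous a)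
    {s t : ℝ} (hs : 0 ≤ s) (hst : s ≤ t) (ht : t ≤ T) :
    qE B a (ψ t) - qE B a (ψ s) = ∫ τ in s..t, energyRate B m σ a (ψ τ) (G τ) := by
  have c1 := h.cont
  have c2 := h.cont_forcing
  have hs' : Continuous fun ξ => (a ξ : ℂ) := Complex.continuous_ofReal.comp ha
  set A : CLTwo →L[ℂ] CLTwo := win B (fun ξ => (a ξ : ℂ)) with hA
  set r : ℝ → CLTwo := fun τ => -(win B m (ψ τ)) - win B σ (G τ) with hr
  have hrc : Continuous r := by fun_prop
  -- `Y` is differentiable for all times and agrees with the windowed solution on `[0, T]`.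
  set Y : ℝ → CLTwo := fun τ => win B 1 (ψ 0) + ∫ x in (0 : ℝ)..τ, r x with hY
  have hYd : ∀ τ, HasDerivAt Y (r τ) τ := fun τ =>
    (intervalIntegral.integral_hasDerivAt_right (hrc.intervalIntegrable _ _)
      (hrc.stronglyMeasurableAtFilter _ _) hrc.continuousAt).const_add _
  have hYψ : ∀ τ ∈ Icc s t, win B 1 (ψ τ) = Y τ := fun τ hτ =>
    h.eq B hB τ ⟨hs.trans hτ.1, hτ.2.trans ht⟩
  have hAw : ∀ χ, A (win B 1 χ) = A χ := by
    intro χ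
    rw [hA, win_win hB hs' continuous_one]
    simp
  have hsym : ∀ χ χ', inner ℂ (A χ) χ' = inner ℂ χ (A χ') := inner_win_comm hB ha
  have hq : ∀ χ, qE B a χ = (inner ℂ (A (win B 1 χ)) (win B 1 χ)).re := by
    intro χ
    rw [hAw, hsym, hAw, ← hsym, hA, re_inner_win_self hB ha]
  have hderiv : ∀ τ, HasDerivAt (fun τ => (inner ℂ (A (Y τ)) (Y τ)).re)
      (2 * (inner ℂ (A (Y τ)) (r τ)).re) τ := by
    intro τ
    have h1 : HasDerivAt (fun τ => A (Y τ)) (A (r τ)) τ :=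
      (A.restrictScalars ℝ).hasFDerivAt.comp_hasDerivAt τ (hYd τ)
    have h2 := (HasDerivAt.inner ℂ h1 (hYd τ))
    have h3 := Complex.reCLM.hasFDerivAt.comp_hasDerivAt τ h2
    have h4 : (inner ℂ (A (r τ)) (Y τ)).re = (inner ℂ (A (Y τ)) (r τ)).re := by
      rw [hsym, ← inner_conj_symm, Complex.conj_re]
    have h5 : 2 * (inner ℂ (A (Y τ)) (r τ)).re
        = Complex.reCLM (inner ℂ (A (Y τ)) (r τ) + inner ℂ (A (r τ)) (Y τ)) := by
      rw [Complex.reCLM_apply, Complex.add_re, h4]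
      ring
    rw [h5]
    exact h3
  have hYc : Continuous Y := continuous_iff_continuousAt.2 fun τ => (hYd τ).continuousAt
  have hftc := intervalIntegral.integral_eq_sub_of_hasDerivAt (a := s) (b := t)
    (fun τ _ => hderiv τ) (Continuous.intervalIntegrable (by fun_prop) _ _)
  rw [hq, hq, hYψ t ⟨hst, le_rfl⟩, hYψ s ⟨le_rfl, hst⟩, ← hftc]
  refine intervalIntegral.integral_congr fun τ hτ => ?_
  rw [uIcc_of_le hst] at hτ
  simp only [energyRate]
  rw [← hYψ τ hτ, hAw]

/-- The weighted energy inequality, on an arbitrary measurable set of frequencies. -/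
theorem FourierSol.energy_le {m σ : ℝ → ℂ} {T : ℝ} {ψ G : ℝ → CLTwo}
    (h : FourierSol m σ T ψ G) (hm : Continuous m) (hσ : Continuous σ) {a b κ : ℝ → ℝ}
    (ha : Continuous a) (hb : Continuous b) (hκ : Continuous κ) (ha0 : ∀ ξ, 0 ≤ a ξ)
    (hb0 : ∀ ξ, 0 ≤ b ξ) (hκ0 : ∀ ξ, 0 ≤ κ ξ)
    (hab : ∀ ξ (y g : ℂ), 2 * (a ξ * (inner ℂ y (-(m ξ * y) - σ ξ * g)).re)
      ≤ -(b ξ * ‖y‖ ^ 2) + κ ξ * ‖g‖ ^ 2)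
    {B : Set ℝ} (hB : MeasurableSet B) {s t : ℝ} (hs : 0 ≤ s) (hst : s ≤ t) (ht : t ≤ T) :
    wE B a (ψ t) + ∫⁻ τ in Ioc s t, wE B b (ψ τ)
      ≤ wE B a (ψ s) + ∫⁻ τ in Ioc s t, wE B κ (G τ) := by
  have c1 := h.cont
  have c2 := h.cont_forcing
  have key : ∀ B, Window B → wE B a (ψ t) + ∫⁻ τ in Ioc s t, wE B b (ψ τ)
      ≤ wE B a (ψ s) + ∫⁻ τ in Ioc s t, wE B κ (G τ) := by
    intro B hB
    have hbc : Continuous fun τ => qE B b (ψ τ) := (continuous_qE hB hb).comp c1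
    have hκc : Continuous fun τ => qE B κ (G τ) := (continuous_qE hB hκ).comp c2
    have e1 : ∫⁻ τ in Ioc s t, wE B b (ψ τ) = ENNReal.ofReal (∫ τ in s..t, qE B b (ψ τ)) := by
      rw [intervalIntegral.integral_of_le hst, ofReal_integral_eq_lintegral_ofReal
        hbc.integrableOn_Ioc (Eventually.of_forall fun τ => qE_nonneg hb0 _)]
      exact lintegral_congr fun τ => (ofReal_qE hB hb hb0 _).symm
    have e2 : ∫⁻ τ in Ioc s t, wE B κ (G τ) = ENNReal.ofReal (∫ τ in s..t, qE B κ (G τ)) := by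
      rw [intervalIntegral.integral_of_le hst, ofReal_integral_eq_lintegral_ofReal
        hκc.integrableOn_Ioc (Eventually.of_forall fun τ => qE_nonneg hκ0 _)]
      exact lintegral_congr fun τ => (ofReal_qE hB hκ hκ0 _).symm
    rw [e1, e2, ← ofReal_qE hB ha ha0, ← ofReal_qE hB ha ha0,
      ← ENNReal.ofReal_add (qE_nonneg ha0 _)
        (intervalIntegral.integral_nonneg hst fun τ _ => qE_nonneg hb0 _),
      ← ENNReal.ofReal_add (qE_nonneg ha0 _)
        (intervalIntegral.integral_nonneg hst fun τ _ => qE_nonneg hκ0 _)]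
    refine ENNReal.ofReal_le_ofReal ?_
    have hid := h.energy_identity hB ha hs hst ht
    have hle : ∫ τ in s..t, energyRate B m σ a (ψ τ) (G τ)
        ≤ ∫ τ in s..t, (-(qE B b (ψ τ)) + qE B κ (G τ)) :=
      intervalIntegral.integral_mono_on hst
        ((continuous_energyRate B m σ a c1 c2).intervalIntegrable _ _)
        ((hbc.neg.add hκc).intervalIntegrable _ _)
        fun τ _ => energyRate_le hB hm hσ ha hb hκ hab _ _
    have hbi : IntervalIntegrable (fun τ => -(qE B b (ψ τ))) volume s t :=
      hbc.neg.intervalIntegrable _ _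
    rw [intervalIntegral.integral_add hbi
      (hκc.intervalIntegrable _ _), intervalIntegral.integral_neg] at hle
    linarith
  -- exhaust `B` by windows
  have lim1 : wE B a (ψ t) + ∫⁻ τ in Ioc s t, wE B b (ψ τ)
      = ⨆ n : ℕ, (wE (B ∩ Icc (-n : ℝ) n) a (ψ t)
        + ∫⁻ τ in Ioc s t, wE (B ∩ Icc (-n : ℝ) n) b (ψ τ)) := by
    have hmono : Monotone fun n : ℕ => ∫⁻ τ in Ioc s t, wE (B ∩ Icc (-n : ℝ) n) b (ψ τ) :=
      fun i j hij => lintegral_mono fun τ => monotone_wE_inter B b _ hij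
    rw [← ENNReal.iSup_add_iSup_of_monotone (monotone_wE_inter B a _) hmono,
      ← wE_eq_iSup, ← lintegral_iSup]
    · simp_rw [← wE_eq_iSup]
    · exact fun n => measurable_wE_comp (Window.inter hB n).1 hb hb0 c1
    · exact fun i j hij τ => monotone_wE_inter B b _ hij
  rw [lim1]
  refine iSup_le fun n => (key _ (Window.inter hB n)).trans ?_
  exact add_le_add (wE_mono_set inter_subset_left _ _)
    (lintegral_mono fun τ => wE_mono_set inter_subset_left _ _)

end

/-! ### Existence for Lipschitz fluxes -/

noncomputable section

/-- The semigroup `e^{-t m}` of multiplication operators, extended by the identity to `t < 0`. -/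
def evol (m : ℝ → ℂ) (t : ℝ) : CLTwo →L[ℂ] CLTwo :=
  mulOp fun ξ => Complex.exp (-((max t 0 : ℝ) : ℂ) * m ξ)

theorem norm_evol_symbol_le {m : ℝ → ℂ} {l : ℝ} (hl : ∀ ξ, l ≤ (m ξ).re) (t ξ : ℝ) :
    ‖Complex.exp (-((max t 0 : ℝ) : ℂ) * m ξ)‖ ≤ Real.exp (-(l * max t 0)) := by
  rw [Complex.norm_exp, Real.exp_le_exp, ← Complex.ofReal_neg, Complex.re_ofReal_mul]
  nlinarith [hl ξ, le_max_right t 0]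

theorem bddSymbol_evol {m : ℝ → ℂ} (hm : Continuous m) {l : ℝ} (hl : ∀ ξ, l ≤ (m ξ).re) (t : ℝ) :
    BddSymbol fun ξ => Complex.exp (-((max t 0 : ℝ) : ℂ) * m ξ) :=
  ⟨by fun_prop, _, norm_evol_symbol_le hl t⟩

theorem norm_evol_apply_le {m : ℝ → ℂ} {l : ℝ} (hl : ∀ ξ, l ≤ (m ξ).re) (t : ℝ) (v : CLTwo) :
    ‖evol m t v‖ ≤ Real.exp (-(l * max t 0)) * ‖v‖ :=
  norm_mulOp_apply_le (norm_evol_symbol_le hl t) v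

theorem evol_zero (m : ℝ → ℂ) (v : CLTwo) : evol m 0 v = v := by
  have : evol m 0 = ContinuousLinearMap.id ℂ CLTwo := by
    rw [← mulOp_one, evol]
    congr 1
    ext ξ
    simp
  rw [this]
  rfl

/-- Strong continuity of the semigroup, jointly in time and in the vector. -/
theorem continuous_evol_apply {X : Type*} [TopologicalSpace X] {m : ℝ → ℂ} (hm : Continuous m)
    (hre : ∀ ξ, 0 ≤ (m ξ).re) {r : X → ℝ} {v : X → CLTwo} (hr : Continuous r)
    (hv : Continuous v) : Continuous fun x => evol m (r x) (v x) := by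
  have hone : ∀ t w, ‖evol m t w‖ ≤ ‖w‖ := fun t w => by
    simpa using norm_evol_apply_le hre t w
  have hstrong : ∀ w, Continuous fun t => evol m t w := by
    intro w
    refine continuous_iff_continuousAt.2 fun t => ?_
    refine tendsto_mulOp (C := 1) (fun t => (bddSymbol_evol hm hre t).1)
      (bddSymbol_evol hm hre t).1 (fun s ξ => ?_) (fun ξ => ?_) (fun ξ => ?_) w
    · simpa using norm_evol_symbol_le hre s ξ
    · simpa using norm_evol_symbol_le hre t ξ
    · have : Continuous fun s : ℝ => Complex.exp (-((max s 0 : ℝ) : ℂ) * m ξ) := by fun_prop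
      exact this.tendsto t
  refine continuous_iff_continuousAt.2 fun x => ?_
  have h1 : Tendsto (fun y => evol m (r y) (v y - v x)) (𝓝 x) (𝓝 0) := by
    refine squeeze_zero_norm (fun y => hone _ _) ?_
    have := (hv.sub (continuous_const (y := v x))).norm.tendsto x
    simpa using this
  have h2 : Tendsto (fun y => evol m (r y) (v x)) (𝓝 x) (𝓝 (evol m (r x) (v x))) :=
    ((hstrong (v x)).comp hr).tendsto x
  have h3 := h1.add h2
  rw [zero_add] at h3
  refine h3.congr fun y => ?_
  rw [← map_add, sub_add_cancel]

/-- On a window the semigroup is a differentiable group. -/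
theorem hasDerivAt_win_exp {m : ℝ → ℂ} (hm : Continuous m) {B : Set ℝ} (hB : Window B) (t : ℝ) :
    HasDerivAt (fun t : ℝ => win B fun ξ => Complex.exp (-(t : ℂ) * m ξ))
      (win B fun ξ => -(m ξ * Complex.exp (-(t : ℂ) * m ξ))) t := by
  obtain ⟨n, hn⟩ := hB.2
  obtain ⟨M, hM⟩ := (isCompact_Icc (a := (-n : ℝ)) (b := n)).exists_bound_of_continuousOn
    hm.continuousOn
  have hec : ∀ t : ℝ, Continuous fun ξ => Complex.exp (-(t : ℂ) * m ξ) := fun t => by fun_prop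
  obtain ⟨E, hE⟩ := (isCompact_Icc (a := (-n : ℝ)) (b := n)).exists_bound_of_continuousOn
    (hec t).continuousOn
  have hM0 : 0 ≤ M := (norm_nonneg _).trans (hM 0 (by simp))
  have hE0 : 0 ≤ E := (norm_nonneg _).trans (hE 0 (by simp))
  rw [hasDerivAt_iff_isLittleO_nhds_zero]
  have hO : (fun h : ℝ => (win B fun ξ => Complex.exp (-((t + h : ℝ) : ℂ) * m ξ))
      - (win B fun ξ => Complex.exp (-(t : ℂ) * m ξ))
      - h • win B fun ξ => -(m ξ * Complex.exp (-(t : ℂ) * m ξ))) =O[𝓝 0] fun h : ℝ => h ^ 2 := by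
    -- the constant is that of `|e^z - 1 - z| ≤ |z|²` for `z = -h m(ξ)`, `|m| ≤ M` on the window
    refine Asymptotics.IsBigO.of_bound (E * M ^ 2) ?_
    have hev : ∀ᶠ h : ℝ in 𝓝 0, |h| * M ≤ 1 := by
      have : Continuous fun h : ℝ => |h| * M := by fun_prop
      have h0 := this.tendsto 0
      simp only [abs_zero, zero_mul] at h0
      exact (h0.eventually (gt_mem_nhds zero_lt_one)).mono fun h hh => hh.le
    filter_upwards [hev] with h hh
    have hc1 := hB.bddSymbol (hec (t + h))
    have hc2 := hB.bddSymbol (hec t)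
    have hc3 : BddSymbol (B.indicator fun ξ => -(m ξ * Complex.exp (-(t : ℂ) * m ξ))) :=
      hB.bddSymbol (by fun_prop)
    have heq : (win B fun ξ => Complex.exp (-((t + h : ℝ) : ℂ) * m ξ))
        - (win B fun ξ => Complex.exp (-(t : ℂ) * m ξ))
        - h • (win B fun ξ => -(m ξ * Complex.exp (-(t : ℂ) * m ξ)))
        = mulOp (fun ξ => B.indicator (fun ξ => Complex.exp (-((t + h : ℝ) : ℂ) * m ξ)) ξ
          + -(B.indicator (fun ξ => Complex.exp (-(t : ℂ) * m ξ)) ξ)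
          + -((h : ℂ) * B.indicator (fun ξ => -(m ξ * Complex.exp (-(t : ℂ) * m ξ))) ξ)) := by
      rw [mulOp_add (hc1.add hc2.neg) (hc3.const_mul _).neg, mulOp_add hc1 hc2.neg,
        mulOp_neg hc2, mulOp_neg (hc3.const_mul _), mulOp_const_mul _ hc3]
      simp only [win, sub_eq_add_neg]
      rfl
    rw [heq]
    refine norm_mulOp_le fun ξ => ?_
    by_cases hξ : ξ ∈ B
    · simp only [indicator_of_mem hξ]
      have h1 : Complex.exp (-((t + h : ℝ) : ℂ) * m ξ) + -Complex.exp (-(t : ℂ) * m ξ)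
          + -((h : ℂ) * -(m ξ * Complex.exp (-(t : ℂ) * m ξ)))
          = Complex.exp (-(t : ℂ) * m ξ)
            * (Complex.exp (-(h : ℂ) * m ξ) - 1 - -(h : ℂ) * m ξ) := by
        have : -((t + h : ℝ) : ℂ) * m ξ = -(t : ℂ) * m ξ + -(h : ℂ) * m ξ := by push_cast; ring
        rw [this, Complex.exp_add]
        ring
      have hn1 : ‖-(h : ℂ) * m ξ‖ ≤ |h| * M := by
        rw [norm_mul, norm_neg, Complex.norm_real, Real.norm_eq_abs]
        exact mul_le_mul_of_nonneg_left (hM ξ (hn hξ)) (abs_nonneg _)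
      rw [h1, norm_mul]
      calc _ ≤ E * ‖-(h : ℂ) * m ξ‖ ^ 2 := mul_le_mul (hE ξ (hn hξ))
            (Complex.norm_exp_sub_one_sub_id_le (hn1.trans hh)) (norm_nonneg _) hE0
        _ ≤ E * (|h| * M) ^ 2 := by gcongr
        _ = E * M ^ 2 * ‖h ^ 2‖ := by rw [norm_pow, Real.norm_eq_abs]; ring
    · simp only [indicator_of_notMem hξ]
      simp
      positivity
  refine hO.trans_isLittleO ?_
  exact Asymptotics.isLittleO_pow_id one_lt_two

/-- A mild solution, given by Duhamel's formula, is a solution. -/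
theorem fourierSol_of_mild {m σ : ℝ → ℂ} (hm : Continuous m) (hre : ∀ ξ, 0 ≤ (m ξ).re)
    (hσb : BddSymbol σ) {ψ G : ℝ → CLTwo} (hψ : Continuous ψ)
    (hG : Continuous G) {ψ₀ : CLTwo} (h : ∀ t, 0 ≤ t → ψ t = evol m t ψ₀
      - ∫ s in (0 : ℝ)..t, evol m (t - s) (mulOp σ (G s))) (T : ℝ) : FourierSol m σ T ψ G := by
  refine ⟨hψ, hG, fun B hB t ht => ?_⟩
  -- on the window the semigroup extends to a group, so Duhamel's integral can be written as
  -- `U t` applied to a differentiable curve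
  set U : ℝ → (CLTwo →L[ℂ] CLTwo) := fun t => win B fun ξ => Complex.exp (-(t : ℂ) * m ξ) with hU
  have hec : ∀ t : ℝ, Continuous fun ξ => Complex.exp (-(t : ℂ) * m ξ) := fun t => by fun_prop
  have hUd : ∀ t, HasDerivAt U (-((win B m).comp (U t))) t := by
    intro t
    convert hasDerivAt_win_exp hm hB t using 1
    refine ContinuousLinearMap.ext fun v => ?_
    have h1 : (win B fun ξ => -(m ξ * Complex.exp (-(t : ℂ) * m ξ)))
        = -(win B fun ξ => m ξ * Complex.exp (-(t : ℂ) * m ξ)) := by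
      rw [win, win, ← mulOp_neg (s := B.indicator fun ξ => m ξ * Complex.exp (-(t : ℂ) * m ξ))
        (hB.bddSymbol (hm.mul (hec t)))]
      congr 1
      ext ξ
      by_cases hξ : ξ ∈ B <;> simp [hξ]
    rw [h1]
    simp only [neg_apply, ContinuousLinearMap.comp_apply, hU]
    rw [win_win hB hm (hec t)]
  have hUc : Continuous U := continuous_iff_continuousAt.2 fun t => (hUd t).continuousAt
  have hUU : ∀ t s v, U t (U s v) = U (t + s) v := by
    intro t s v
    simp only [hU]
    rw [win_win hB (hec t) (hec s)]
    congr 2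
    ext ξ
    rw [← Complex.exp_add]
    push_cast
    ring_nf
  have hU0 : U 0 = win B 1 := by
    simp only [hU]
    congr 1
    ext ξ
    simp
  have hevol : ∀ t, 0 ≤ t → ∀ v, win B 1 (evol m t v) = U t v := by
    intro t ht v
    rw [evol, win_mulOp hB continuous_one (bddSymbol_evol hm hre t)]
    simp [hU, max_eq_left ht]
  set g : ℝ → CLTwo := fun s => mulOp σ (G s) with hg
  have hgc : Continuous g := by fun_prop
  set Y : ℝ → CLTwo := fun t => ψ₀ - ∫ s in (0 : ℝ)..t, U (-s) (g s) with hY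
  have hIc : Continuous fun s => U (-s) (g s) := by fun_prop
  have hYd : ∀ t, HasDerivAt Y (-(U (-t) (g t))) t := fun t =>
    (intervalIntegral.integral_hasDerivAt_right (hIc.intervalIntegrable _ _)
      (hIc.stronglyMeasurableAtFilter _ _) hIc.continuousAt).const_sub _
  have hYψ : ∀ t, 0 ≤ t → win B 1 (ψ t) = U t (Y t) := by
    intro t ht
    rw [h t ht, map_sub, hevol t ht, hY]
    simp only [map_sub]
    have hi : IntervalIntegrable (fun s => evol m (t - s) (g s)) volume 0 t :=
      (continuous_evol_apply hm hre (by fun_prop) hgc).intervalIntegrable _ _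
    rw [← ContinuousLinearMap.intervalIntegral_comp_comm _ hi,
      ← ContinuousLinearMap.intervalIntegral_comp_comm _ (hIc.intervalIntegrable _ _)]
    congr 1
    refine intervalIntegral.integral_congr fun s hs => ?_
    rw [uIcc_of_le ht] at hs
    simp only [hUU]
    rw [hevol _ (sub_nonneg.2 hs.2), sub_eq_add_neg]
  have hd : ∀ t, HasDerivAt (fun t => U t (Y t)) (-(win B m (U t (Y t))) - win B 1 (g t)) t := by
    intro t
    have hUr : HasDerivAt (fun t => (U t).restrictScalars ℝ)
        ((-((win B m).comp (U t))).restrictScalars ℝ) t :=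
      (ContinuousLinearMap.restrictScalarsL ℂ CLTwo CLTwo ℝ ℝ).hasFDerivAt.comp_hasDerivAt t
        (hUd t)
    have h1 := hUr.clm_apply (hYd t)
    simp only [ContinuousLinearMap.coe_restrictScalars', neg_apply,
      ContinuousLinearMap.comp_apply, map_neg, hUU, add_neg_cancel, hU0] at h1
    rwa [sub_eq_add_neg]
  have hYc : Continuous Y := continuous_iff_continuousAt.2 fun t => (hYd t).continuousAt
  have hftc := intervalIntegral.integral_eq_sub_of_hasDerivAt (a := 0) (b := t)
    (fun τ _ => hd τ) (Continuous.intervalIntegrable (by fun_prop) _ _)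
  rw [hYψ t ht.1, hYψ 0 le_rfl, eq_add_of_sub_eq' hftc.symm]
  congr 1
  refine intervalIntegral.integral_congr fun s hs => ?_
  rw [uIcc_of_le ht.1] at hs
  have hm1 : win B m (U s (Y s)) = win B m (ψ s) := by
    rw [← hYψ s hs.1, win_win hB hm continuous_one]
    simp
  have hσ1 : win B 1 (g s) = win B σ (G s) := by
    rw [hg, win_mulOp hB continuous_one hσb]
    simp
  simp only [hm1, hσ1]

/-- A lower bound `l` of `Re m` gives Duhamel's integral the norm bound `∫₀^∞ e^{-l s} ds = 1 / l`. -/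
theorem norm_duhamel_le {m : ℝ → ℂ} {l : ℝ} (hl0 : 0 < l)
    (hl : ∀ ξ, l ≤ (m ξ).re) {h : ℝ → CLTwo} {M : ℝ} (hM : ∀ s, ‖h s‖ ≤ M) {t : ℝ}
    (ht : 0 ≤ t) : ‖∫ s in (0 : ℝ)..t, evol m (t - s) (h s)‖ ≤ M / l := by
  have hM0 : 0 ≤ M := (norm_nonneg _).trans (hM 0)
  have hd : ∀ s : ℝ, HasDerivAt (fun s => M / l * Real.exp (-(l * (t - s))))
      (Real.exp (-(l * (t - s))) * M) s := by
    intro s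
    have h1 : HasDerivAt (fun s => -(l * (t - s))) l s := by
      have h2 : HasDerivAt (fun s => t - s) (-1) s := by
        simpa using (hasDerivAt_id s).const_sub t
      have h3 := (h2.const_mul l).fun_neg
      rwa [mul_neg, mul_one, neg_neg] at h3
    have h4 : Real.exp (-(l * (t - s))) * M = M / l * (Real.exp (-(l * (t - s))) * l) := by
      field_simp
    rw [h4]
    exact h1.exp.const_mul (M / l)
  have hc : Continuous fun s => Real.exp (-(l * (t - s))) * M := by fun_prop
  calc _ ≤ ∫ s in (0 : ℝ)..t, Real.exp (-(l * (t - s))) * M := by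
        refine intervalIntegral.norm_integral_le_of_norm_le ht ?_ (hc.intervalIntegrable _ _)
        refine Eventually.of_forall fun s hs => (norm_evol_apply_le hl _ _).trans ?_
        rw [max_eq_left (sub_nonneg.2 hs.2)]
        exact mul_le_mul_of_nonneg_left (hM s) (Real.exp_pos _).le
    _ = M / l * Real.exp (-(l * (t - t))) - M / l * Real.exp (-(l * (t - 0))) :=
        intervalIntegral.integral_eq_sub_of_hasDerivAt (fun s _ => hd s)
          (hc.intervalIntegrable _ _)
    _ ≤ M / l := by
        have : 0 ≤ M / l * Real.exp (-(l * (t - 0))) := by positivity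
        simp only [sub_self, mul_zero, neg_zero, Real.exp_zero, mul_one]
        linarith

/-- Global solvability for a globally Lipschitz nonlinearity: Banach's fixed point theorem for
Duhamel's formula, in the space of curves bounded after multiplication by `e^{-l t}`. -/
theorem exists_fourierSol {m σ : ℝ → ℂ} (hm : Continuous m) (hre : ∀ ξ, 0 ≤ (m ξ).re)
    (hσb : BddSymbol σ) {N : CLTwo → CLTwo} {K : NNReal}
    (hN : LipschitzWith K N) (hN0 : N 0 = 0) (ψ₀ : CLTwo) :
    ∃ ψ : ℝ → CLTwo, Continuous ψ ∧ ψ 0 = ψ₀ ∧ ∀ T, FourierSol m σ T ψ fun t => N (ψ t) := by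
  obtain ⟨hσm, C, hC⟩ := hσb
  have hC0 : 0 ≤ C := (norm_nonneg _).trans (hC 0)
  -- in the weighted norm Duhamel's operator has Lipschitz constant `C K / l ≤ 1 / 2`
  set l : ℝ := 2 * (C * K) + 1 with hldef
  have hl0 : 0 < l := by positivity
  set ml : ℝ → ℂ := fun ξ => m ξ + l with hml
  have hmlc : Continuous ml := by fun_prop
  have hmlre : ∀ ξ, l ≤ (ml ξ).re := fun ξ => by
    simp only [hml, Complex.add_re, Complex.ofReal_re]
    linarith [hre ξ]
  have hmlre0 : ∀ ξ, 0 ≤ (ml ξ).re := fun ξ => hl0.le.trans (hmlre ξ)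
  -- the forcing in the weighted unknown `e^{-l t} ψ`
  set F : (ℝ → CLTwo) → ℝ → CLTwo := fun y s =>
    mulOp σ (Real.exp (-(l * s)) • N (Real.exp (l * s) • y s)) with hF
  have hNc : Continuous N := hN.continuous
  have hFc : ∀ y, Continuous y → Continuous (F y) := fun y hy => by
    simp only [hF]; fun_prop
  have hFl : ∀ y z s, ‖F y s - F z s‖ ≤ C * K * ‖y s - z s‖ := by
    intro y z s
    simp only [hF]
    rw [← map_sub, ← smul_sub]
    refine (norm_mulOp_apply_le hC _).trans ?_
    rw [mul_assoc]
    refine mul_le_mul_of_nonneg_left ?_ hC0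
    rw [norm_smul, Real.norm_of_nonneg (Real.exp_pos _).le]
    have h1 := hN.dist_le_mul (Real.exp (l * s) • y s) (Real.exp (l * s) • z s)
    rw [dist_eq_norm, dist_eq_norm, ← smul_sub, norm_smul,
      Real.norm_of_nonneg (Real.exp_pos _).le] at h1
    calc _ ≤ Real.exp (-(l * s)) * (K * (Real.exp (l * s) * ‖y s - z s‖)) := by gcongr
      _ = Real.exp (-(l * s)) * Real.exp (l * s) * (K * ‖y s - z s‖) := by ring
      _ = K * ‖y s - z s‖ := by rw [← Real.exp_add]; simp
  have hF0 : F 0 = 0 := by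
    ext1 s
    simp [hF, hN0]
  set D : (ℝ → CLTwo) → ℝ → CLTwo := fun y t =>
    ∫ s in (0 : ℝ)..(max t 0), evol ml (max t 0 - s) (F y s) with hD
  have hDi : ∀ y, Continuous y → ∀ r, Continuous fun s => evol ml (r - s) (F y s) :=
    fun y hy r => continuous_evol_apply hmlc hmlre0 (by fun_prop) (hFc y hy)
  have hDc : ∀ y, Continuous y → Continuous (D y) := by
    intro y hy
    refine intervalIntegral.continuous_parametric_intervalIntegral_of_continuous (a₀ := 0)
      (f := fun t s => evol ml (max t 0 - s) (F y s)) ?_ (by fun_prop)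
    exact continuous_evol_apply hmlc hmlre0 (by fun_prop) ((hFc y hy).comp continuous_snd)
  have hDl : ∀ y z, Continuous y → Continuous z → ∀ M, (∀ s, ‖y s - z s‖ ≤ M) → ∀ t,
      ‖D y t - D z t‖ ≤ C * K * M / l := by
    intro y z hy hz M hM t
    simp only [hD]
    rw [← intervalIntegral.integral_sub ((hDi y hy _).intervalIntegrable _ _)
      ((hDi z hz _).intervalIntegrable _ _)]
    simp_rw [← map_sub]
    refine norm_duhamel_le hl0 hmlre (h := fun s => F y s - F z s) (fun s => ?_)
      (le_max_right _ _)
    exact (hFl y z s).trans (mul_le_mul_of_nonneg_left (hM s) (by positivity))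
  have hD0 : D 0 = 0 := by
    ext1 t
    simp [hD, hF0]
  have hΦc : ∀ y : BoundedContinuousFunction ℝ CLTwo,
      Continuous fun t => evol ml t ψ₀ - D y t := fun y =>
    (continuous_evol_apply hmlc hmlre0 continuous_id continuous_const).sub (hDc y y.continuous)
  have hΦb : ∀ (y : BoundedContinuousFunction ℝ CLTwo) t,
      ‖evol ml t ψ₀ - D y t‖ ≤ ‖ψ₀‖ + C * K * ‖y‖ / l := by
    intro y t
    refine (norm_sub_le _ _).trans (add_le_add ?_ ?_)
    · simpa using norm_evol_apply_le hmlre0 t ψ₀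
    · have := hDl y 0 y.continuous continuous_zero ‖y‖
        (fun s => by simpa using y.norm_coe_le_norm s) t
      simpa [hD0] using this
  set Φ : BoundedContinuousFunction ℝ CLTwo → BoundedContinuousFunction ℝ CLTwo := fun y =>
    BoundedContinuousFunction.ofNormedAddCommGroup _ (hΦc y) _ (hΦb y) with hΦ
  have hcontr : ContractingWith (1 / 2) Φ := by
    refine ⟨by norm_num, LipschitzWith.of_dist_le_mul fun y z => ?_⟩
    refine (BoundedContinuousFunction.dist_le (by positivity)).2 fun t => ?_
    have h1 : dist (Φ y t) (Φ z t) = ‖D y t - D z t‖ := by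
      rw [dist_eq_norm, ← norm_neg]
      congr 1
      simp only [hΦ, BoundedContinuousFunction.coe_ofNormedAddCommGroup]
      abel
    rw [h1]
    refine (hDl y z y.continuous z.continuous (dist y z) (fun s => ?_) t).trans ?_
    · rw [← dist_eq_norm]
      exact BoundedContinuousFunction.dist_coe_le_dist s
    · rw [div_le_iff₀ hl0]
      have : (0 : ℝ) ≤ dist y z := dist_nonneg
      push_cast
      rw [hldef]
      nlinarith
  obtain ⟨y, hy⟩ : ∃ y, Φ y = y := ⟨_, hcontr.fixedPoint_isFixedPt⟩
  have hyt : ∀ t, y t = evol ml t ψ₀ - D y t := fun t => by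
    conv_lhs => rw [← hy]
    rfl
  have hevol : ∀ t, 0 ≤ t → ∀ v, Real.exp (l * t) • evol ml t v = evol m t v := by
    intro t ht v
    have hc : (Real.exp (l * t) • evol ml t v : CLTwo)
        = ((Real.exp (l * t) : ℝ) : ℂ) • evol ml t v := rfl
    rw [hc, evol, ← smul_apply, ← mulOp_const_mul _ (bddSymbol_evol hmlc hmlre0 t), evol]
    congr 2
    ext ξ
    rw [Complex.ofReal_exp, ← Complex.exp_add, max_eq_left ht, hml]
    congr 1
    push_cast
    ring
  have hψc : Continuous fun t => Real.exp (l * t) • y t := by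
    have := y.continuous
    fun_prop
  refine ⟨fun t => Real.exp (l * t) • y t, hψc, ?_, fun T => ?_⟩
  · simp [hyt 0, evol_zero, hD]
  · refine fourierSol_of_mild hm hre ⟨hσm, C, hC⟩ hψc (hNc.comp hψc) (ψ₀ := ψ₀)
      (fun t ht => ?_) T
    rw [hyt t, smul_sub, hevol t ht, hD]
    simp only [max_eq_left ht]
    rw [← intervalIntegral.integral_smul]
    congr 1
    refine intervalIntegral.integral_congr fun s hs => ?_
    rw [uIcc_of_le ht] at hs
    simp only [hF]
    have h1 : Real.exp (l * t) = Real.exp (l * s) * Real.exp (l * (t - s)) := by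
      rw [← Real.exp_add]; ring_nf
    rw [h1, mul_smul, hevol _ (sub_nonneg.2 hs.2), ← ContinuousLinearMap.map_smul_of_tower,
      ← ContinuousLinearMap.map_smul_of_tower, smul_smul, ← Real.exp_add]
    simp

end

/-! ### The symbols of the equation and its energy estimates -/

noncomputable section

/-- The wave number belonging to the frequency `ξ`.  Functions of `x` are written as Fourier
transforms `v = 𝓕 ψ`, so that `∂_x` acts on `ψ` as multiplication by `i` times this number. -/
def wav (ξ : ℝ) : ℝ := -(2 * Real.pi * ξ)

theorem continuous_wav : Continuous wav := by unfold wav; fun_prop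

/-- The symbol of `∂_x`. -/
def dsym (ξ : ℝ) : ℂ := Complex.I * (wav ξ : ℂ)

theorem continuous_dsym : Continuous dsym := by
  have := continuous_wav
  unfold dsym; fun_prop

theorem norm_dsym (ξ : ℝ) : ‖dsym ξ‖ = |wav ξ| := by simp [dsym]

theorem norm_dsym_sq (ξ : ℝ) : ‖dsym ξ‖ ^ 2 = wav ξ ^ 2 := by rw [norm_dsym, sq_abs]

/-- The symbol of `(1 - α ∂²)⁻¹ (γ ∂⁴ + δ ∂³ - β ∂²)`. -/
def linSym (α β γ δ : ℝ) (ξ : ℝ) : ℂ :=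
  (((γ * wav ξ ^ 4 + β * wav ξ ^ 2 : ℝ) : ℂ) - Complex.I * ((δ * wav ξ ^ 3 : ℝ) : ℂ))
    / ((1 + α * wav ξ ^ 2 : ℝ) : ℂ)

/-- The symbol of `(1 - α ∂²)⁻¹ ∂`. -/
def fluxSym (α : ℝ) (ξ : ℝ) : ℂ := dsym ξ / ((1 + α * wav ξ ^ 2 : ℝ) : ℂ)

section Symbols

variable {α β γ δ : ℝ}

theorem bbm_pos (hα : 0 < α) (ξ : ℝ) : 0 < 1 + α * wav ξ ^ 2 := by positivity

theorem bbm_ne_zero (hα : 0 < α) (ξ : ℝ) : ((1 + α * wav ξ ^ 2 : ℝ) : ℂ) ≠ 0 :=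
  Complex.ofReal_ne_zero.2 (bbm_pos hα ξ).ne'

theorem continuous_linSym (hα : 0 < α) : Continuous (linSym α β γ δ) := by
  have := continuous_wav
  unfold linSym
  exact Continuous.div (by fun_prop) (by fun_prop) (bbm_ne_zero hα)

theorem continuous_fluxSym (hα : 0 < α) : Continuous (fluxSym α) := by
  have := continuous_wav
  have := continuous_dsym
  unfold fluxSym
  exact Continuous.div (by fun_prop) (by fun_prop) (bbm_ne_zero hα)

theorem linSym_re (ξ : ℝ) : (linSym α β γ δ ξ).re
    = (γ * wav ξ ^ 4 + β * wav ξ ^ 2) / (1 + α * wav ξ ^ 2) := by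
  rw [linSym, Complex.div_ofReal_re, Complex.sub_re, Complex.ofReal_re, Complex.re_mul_ofReal,
    Complex.I_re, zero_mul, sub_zero]

theorem linSym_im (ξ : ℝ) : (linSym α β γ δ ξ).im
    = -(δ * wav ξ ^ 3) / (1 + α * wav ξ ^ 2) := by
  rw [linSym, Complex.div_ofReal_im, Complex.sub_im, Complex.ofReal_im, Complex.im_mul_ofReal,
    Complex.I_im, one_mul, zero_sub]

theorem fluxSym_re (ξ : ℝ) : (fluxSym α ξ).re = 0 := by
  rw [fluxSym, Complex.div_ofReal_re, dsym]
  simp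

theorem fluxSym_im (ξ : ℝ) : (fluxSym α ξ).im = wav ξ / (1 + α * wav ξ ^ 2) := by
  rw [fluxSym, Complex.div_ofReal_im, dsym]
  simp

theorem linSym_re_nonneg (hα : 0 < α) (hβ : 0 < β) (hγ : 0 < γ) (ξ : ℝ) :
    0 ≤ (linSym α β γ δ ξ).re := by
  rw [linSym_re]
  have := bbm_pos hα ξ
  positivity

/-- The fourth-order operator loses only two derivatives after inversion of `1 - α ∂²`. -/
theorem norm_linSym_sq_le (hα : 0 < α) (hβ : 0 < β) (hγ : 0 < γ) :
    ∃ C, 0 ≤ C ∧ ∀ ξ, ‖linSym α β γ δ ξ‖ ^ 2 ≤ C * wav ξ ^ 4 := by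
  refine ⟨(γ / α + β) ^ 2 + δ ^ 2 / α, by positivity, fun ξ => ?_⟩
  have h := bbm_pos hα ξ
  rw [Complex.sq_norm, Complex.normSq_apply, linSym_re, linSym_im]
  set k := wav ξ
  have h1 : (γ * k ^ 4 + β * k ^ 2) / (1 + α * k ^ 2) ≤ (γ / α + β) * k ^ 2 := by
    rw [div_le_iff₀ h]
    have e : (γ / α + β) * k ^ 2 * (1 + α * k ^ 2)
        = γ * k ^ 4 + β * k ^ 2 + (γ / α * k ^ 2 + α * β * k ^ 4) := by
      field_simp
      ring
    rw [e]
    have : 0 ≤ γ / α * k ^ 2 + α * β * k ^ 4 := by positivity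
    linarith
  have h0 : 0 ≤ (γ * k ^ 4 + β * k ^ 2) / (1 + α * k ^ 2) := by positivity
  have h2 : -(δ * k ^ 3) / (1 + α * k ^ 2) * (-(δ * k ^ 3) / (1 + α * k ^ 2))
      ≤ δ ^ 2 / α * k ^ 4 := by
    rw [div_mul_div_comm, div_le_iff₀ (by positivity)]
    have e : δ ^ 2 / α * k ^ 4 * ((1 + α * k ^ 2) * (1 + α * k ^ 2))
        = -(δ * k ^ 3) * -(δ * k ^ 3) + (δ ^ 2 / α * k ^ 4 + δ ^ 2 * k ^ 6
          + δ ^ 2 * α * k ^ 8) := by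
      field_simp
      ring
    rw [e]
    have : 0 ≤ δ ^ 2 / α * k ^ 4 + δ ^ 2 * k ^ 6 + δ ^ 2 * α * k ^ 8 := by positivity
    linarith
  have h3 := mul_le_mul h1 h1 h0 (by positivity)
  nlinarith

theorem norm_fluxSym_sq (hα : 0 < α) (ξ : ℝ) :
    ‖fluxSym α ξ‖ ^ 2 = wav ξ ^ 2 / (1 + α * wav ξ ^ 2) ^ 2 := by
  rw [fluxSym, norm_div, div_pow, norm_dsym_sq, Complex.norm_real,
    Real.norm_of_nonneg (bbm_pos hα ξ).le]

theorem bddSymbol_fluxSym (hα : 0 < α) : BddSymbol (fluxSym α) := by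
  refine ⟨(continuous_fluxSym hα).measurable, √(1 / α), fun ξ => ?_⟩
  refine Real.le_sqrt_of_sq_le ?_
  have := bbm_pos hα ξ
  rw [norm_fluxSym_sq hα, div_le_div_iff₀ (by positivity) hα]
  nlinarith [sq_nonneg (α * wav ξ ^ 2), mul_nonneg hα.le (sq_nonneg (wav ξ))]

theorem re_inner_complex (y z : ℂ) : (inner ℂ y z).re = y.re * z.re + y.im * z.im := by
  rw [RCLike.inner_apply]
  simp
  ring

/-- The third-order term is skew and drops out of the energy. -/
theorem re_inner_rate (hα : 0 < α) (ξ : ℝ) (y g : ℂ) :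
    (1 + α * wav ξ ^ 2) * (inner ℂ y (-(linSym α β γ δ ξ * y) - fluxSym α ξ * g)).re
      = -((γ * wav ξ ^ 4 + β * wav ξ ^ 2) * ‖y‖ ^ 2) + (inner ℂ (dsym ξ * y) g).re := by
  have h := (bbm_pos hα ξ).ne'
  rw [re_inner_complex, re_inner_complex, Complex.sq_norm, Complex.normSq_apply]
  simp only [Complex.sub_re, Complex.sub_im, Complex.neg_re, Complex.neg_im, Complex.mul_re,
    Complex.mul_im, linSym_re, linSym_im, fluxSym_re, fluxSym_im, dsym, Complex.I_re,
    Complex.I_im, Complex.ofReal_re, Complex.ofReal_im]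
  field_simp
  ring

theorem re_inner_dsym_le (ξ : ℝ) (y g : ℂ) :
    (inner ℂ (dsym ξ * y) g).re ≤ |wav ξ| * ‖y‖ * ‖g‖ := by
  refine (Complex.re_le_norm _).trans ((norm_inner_le_norm _ _).trans ?_)
  rw [norm_mul, norm_dsym]

/-- The basic energy law: after multiplication by the weight `1 + α k²` of the `H¹` energy, the
flux enters only through `⟪∂ψ, G⟫`. -/
theorem energy_law_basic (hα : 0 < α) (ξ : ℝ) (y g : ℂ) :
    2 * ((1 + α * wav ξ ^ 2) * (inner ℂ y (-(linSym α β γ δ ξ * y) - fluxSym α ξ * g)).re)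
      = -((2 * (γ * wav ξ ^ 4 + β * wav ξ ^ 2)) * ‖y‖ ^ 2) + 2 * (inner ℂ (dsym ξ * y) g).re := by
  rw [re_inner_rate hα]
  ring

/-- The basic energy law with the flux absorbed into the dissipation, for a forcing in `L²`. -/
theorem energy_law_low (hα : 0 < α) (hβ : 0 < β) (ξ : ℝ) (y g : ℂ) :
    2 * ((1 + α * wav ξ ^ 2) * (inner ℂ y (-(linSym α β γ δ ξ * y) - fluxSym α ξ * g)).re)
      ≤ -((β * wav ξ ^ 2 + 2 * γ * wav ξ ^ 4) * ‖y‖ ^ 2) + 1 / β * ‖g‖ ^ 2 := by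
  rw [energy_law_basic hα]
  have h := re_inner_dsym_le ξ y g
  have h2 : 2 * (|wav ξ| * ‖y‖ * ‖g‖) ≤ β * wav ξ ^ 2 * ‖y‖ ^ 2 + 1 / β * ‖g‖ ^ 2 := by
    have e : β * wav ξ ^ 2 * ‖y‖ ^ 2 + 1 / β * ‖g‖ ^ 2 - 2 * (|wav ξ| * ‖y‖ * ‖g‖)
        = 1 / β * (β * |wav ξ| * ‖y‖ - ‖g‖) ^ 2 := by
      rw [← sq_abs (wav ξ)]
      field_simp
      ring
    have : 0 ≤ 1 / β * (β * |wav ξ| * ‖y‖ - ‖g‖) ^ 2 := by positivity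
    linarith
  nlinarith

/-- The energy law for the weight `(1 + α k²)(k² + k⁴)`; half of the dissipation absorbs the
flux, of which only `|k g|²` remains. -/
theorem energy_law_high (hα : 0 < α) (hβ : 0 < β) (hγ : 0 < γ) (ξ : ℝ) (y g : ℂ) :
    2 * (((1 + α * wav ξ ^ 2) * (wav ξ ^ 2 + wav ξ ^ 4))
        * (inner ℂ y (-(linSym α β γ δ ξ * y) - fluxSym α ξ * g)).re)
      ≤ -((β * wav ξ ^ 4 + γ * wav ξ ^ 8) * ‖y‖ ^ 2)
        + ((1 / β + 1 / γ) * wav ξ ^ 2) * ‖g‖ ^ 2 := by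
  have h := re_inner_dsym_le ξ y g
  have h0 := re_inner_rate (β := β) (γ := γ) (δ := δ) hα ξ y g
  have hsq : |wav ξ| ^ 2 = wav ξ ^ 2 := sq_abs _
  have hsq4 : wav ξ ^ 4 = |wav ξ| ^ 4 := by
    rw [show 4 = 2 * 2 from rfl, pow_mul, pow_mul, hsq]
  have hsq8 : wav ξ ^ 8 = |wav ξ| ^ 8 := by
    rw [show 8 = 2 * 4 from rfl, pow_mul, pow_mul, hsq]
  set X := (inner ℂ y (-(linSym α β γ δ ξ * y) - fluxSym α ξ * g)).re
  set r := (inner ℂ (dsym ξ * y) g).re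
  have e1 : 2 * (((1 + α * wav ξ ^ 2) * (wav ξ ^ 2 + wav ξ ^ 4)) * X)
      = 2 * (wav ξ ^ 2 + wav ξ ^ 4) * ((1 + α * wav ξ ^ 2) * X) := by ring
  rw [e1, h0, ← hsq, hsq4, hsq8]
  set k := |wav ξ|
  have hk : 0 ≤ k := abs_nonneg _
  set n := ‖y‖
  set q := ‖g‖
  have h3 : 2 * (k ^ 2 + k ^ 4) * r ≤ 2 * (k ^ 2 + k ^ 4) * (k * n * q) := by gcongr
  have h4 : 0 ≤ 1 / β * (β * k ^ 2 * n - k * q) ^ 2 + 1 / γ * (γ * k ^ 4 * n - k * q) ^ 2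
    + 2 * (β + γ) * k ^ 6 * n ^ 2 := by positivity
  have e2 : 1 / β * (β * k ^ 2 * n - k * q) ^ 2 + 1 / γ * (γ * k ^ 4 * n - k * q) ^ 2
      = β * k ^ 4 * n ^ 2 + γ * k ^ 8 * n ^ 2 + (1 / β + 1 / γ) * k ^ 2 * q ^ 2
        - 2 * (k ^ 2 + k ^ 4) * (k * n * q) := by
    field_simp
    ring
  rw [e2] at h4
  nlinarith

end Symbols

/-- The properties of the nonlinear flux used on the Fourier side.  The third field is the chain
rule for the flux, the fourth says that `∫ v_x g(v) = 0`. -/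
structure FluxMap (N : CLTwo → CLTwo) (K : NNReal) : Prop where
  lip : LipschitzWith K N
  zero : N 0 = 0
  deriv_le : ∀ ψ, wE univ (fun ξ => wav ξ ^ 4) ψ ≠ ⊤ →
    wE univ (fun ξ => wav ξ ^ 2) (N ψ) ≤ (K : ℝ≥0∞) ^ 2 * wE univ (fun ξ => wav ξ ^ 2) ψ
  orth : ∀ ψ, wE univ (fun ξ => wav ξ ^ 4) ψ ≠ ⊤ →
    Tendsto (fun n : ℕ => (inner ℂ (win (Icc (-n : ℝ) n) dsym ψ) (N ψ)).re) atTop (𝓝 0)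

theorem wE_ne_top_of_le {a b : ℝ → ℝ} {C : ℝ} (hC : 0 ≤ C) (hab : ∀ ξ, a ξ ≤ C * b ξ) {ψ : CLTwo}
    (h : wE univ b ψ ≠ ⊤) : wE univ a ψ ≠ ⊤ := by
  refine ne_top_of_le_ne_top ?_ (wE_mono MeasurableSet.univ (fun ξ _ => hab ξ) ψ)
  rw [wE_const_mul _ hC]
  exact ENNReal.mul_ne_top ENNReal.ofReal_ne_top h

theorem lintegral_wE_ne_top_of_le {μ : Measure ℝ} {a b : ℝ → ℝ} {C : ℝ} (hC : 0 ≤ C)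
    (hab : ∀ ξ, a ξ ≤ C * b ξ) {ψ : ℝ → CLTwo} (h : ∫⁻ t, wE univ b (ψ t) ∂μ ≠ ⊤) :
    ∫⁻ t, wE univ a (ψ t) ∂μ ≠ ⊤ := by
  have h1 : ∫⁻ t, wE univ a (ψ t) ∂μ ≤ ∫⁻ t, ENNReal.ofReal C * wE univ b (ψ t) ∂μ := by
    refine lintegral_mono fun t => ?_
    rw [← wE_const_mul _ hC]
    exact wE_mono MeasurableSet.univ (fun ξ _ => hab ξ) _
  refine ne_top_of_le_ne_top ?_ h1
  rw [lintegral_const_mul' _ _ ENNReal.ofReal_ne_top]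
  exact ENNReal.mul_ne_top ENNReal.ofReal_ne_top h

theorem lintegral_Ioi_le_of_forall {f : ℝ → ℝ≥0∞} {C : ℝ≥0∞}
    (h : ∀ t, 0 ≤ t → ∫⁻ τ in Ioc 0 t, f τ ≤ C) : ∫⁻ τ in Ioi 0, f τ ≤ C := by
  have hU : Ioi (0 : ℝ) = ⋃ n : ℕ, Ioc 0 (n : ℝ) := by
    ext x
    simp only [mem_Ioi, mem_iUnion, mem_Ioc, exists_and_left]
    exact ⟨fun hx => ⟨hx, ⌈x⌉₊, Nat.le_ceil x⟩, fun hx => hx.1⟩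
  rw [hU, setLIntegral_iUnion_of_directed]
  · exact iSup_le fun n => h n n.cast_nonneg
  · exact Monotone.directed_le fun i j hij => Ioc_subset_Ioc_right (by exact_mod_cast hij)

section Uniqueness

variable {α β γ δ : ℝ}

/-- Two solutions with the same initial value whose forcings depend Lipschitz continuously on
them agree: the `L²` energy inequality for the difference, and Grönwall's inequality. -/
theorem FourierSol.eq_of_lipschitz (hα : 0 < α) (hβ : 0 < β) (hγ : 0 < γ) {T : ℝ}
    {ψ G ψ' G' : ℝ → CLTwo}
    (h : FourierSol (linSym α β γ δ) (fluxSym α) T ψ G)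
    (h' : FourierSol (linSym α β γ δ) (fluxSym α) T ψ' G') (h0 : ψ 0 = ψ' 0) {K : ℝ}
    (hK : ∀ t ∈ Icc 0 T, ‖G t - G' t‖ ≤ K * ‖ψ t - ψ' t‖) :
    ∀ t ∈ Icc 0 T, ψ t = ψ' t := by
  have hz := h.sub h'
  set z : ℝ → CLTwo := fun t => ψ t - ψ' t with hzdef
  have hzc : Continuous z := hz.cont
  have hw := continuous_wav
  have hkey : ∀ t ∈ Icc 0 T, ‖z t‖ ^ 2 ≤ K ^ 2 / β * ∫ τ in (0 : ℝ)..t, ‖z τ‖ ^ 2 := by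
    intro t ht
    have hE := hz.energy_le (a := fun ξ => 1 + α * wav ξ ^ 2)
      (b := fun ξ => β * wav ξ ^ 2 + 2 * γ * wav ξ ^ 4) (κ := fun _ => 1 / β)
      (continuous_linSym hα) (continuous_fluxSym hα) (by fun_prop) (by fun_prop) (by fun_prop)
      (fun ξ => by positivity) (fun ξ => by positivity) (fun ξ => by positivity)
      (energy_law_low hα hβ) MeasurableSet.univ le_rfl ht.1 ht.2
    have h1 : ‖z t‖ₑ ^ 2 ≤ wE univ (fun ξ => 1 + α * wav ξ ^ 2) (z t) := by
      rw [← wE_one]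
      refine wE_mono MeasurableSet.univ (fun ξ _ => ?_) _
      have : 0 ≤ α * wav ξ ^ 2 := by positivity
      linarith
    have h2 : wE univ (fun ξ => 1 + α * wav ξ ^ 2) (z 0) = 0 := by
      have : z 0 = 0 := by simp [hzdef, h0]
      rw [this, wE]
      refine (lintegral_congr_ae ?_).trans lintegral_zero
      rw [Measure.restrict_univ]
      filter_upwards [Lp.coeFn_zero ℂ 2 (volume : Measure ℝ)] with ξ hξ
      rw [hξ]
      simp
    have hint : Continuous fun τ => K ^ 2 / β * ‖z τ‖ ^ 2 := by fun_prop
    have h3 : ∫⁻ τ in Ioc 0 t, wE univ (fun _ => 1 / β) (G τ - G' τ)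
        ≤ ENNReal.ofReal (∫ τ in (0 : ℝ)..t, K ^ 2 / β * ‖z τ‖ ^ 2) := by
      rw [intervalIntegral.integral_of_le ht.1, ofReal_integral_eq_lintegral_ofReal
        hint.integrableOn_Ioc (Eventually.of_forall fun τ => by positivity)]
      refine setLIntegral_mono' measurableSet_Ioc fun τ hτ => ?_
      have e : wE univ (fun _ => 1 / β) (G τ - G' τ)
          = ENNReal.ofReal (1 / β * ‖G τ - G' τ‖ ^ 2) := by
        have := wE_const_mul univ (a := fun _ => 1) (c := 1 / β) (by positivity) (G τ - G' τ)
        simp only [mul_one] at this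
        rw [this, wE_one, ENNReal.ofReal_mul (by positivity), ENNReal.ofReal_pow (norm_nonneg _),
          ofReal_norm]
      rw [e]
      refine ENNReal.ofReal_le_ofReal ?_
      have hb := hK τ ⟨hτ.1.le, hτ.2.trans ht.2⟩
      calc 1 / β * ‖G τ - G' τ‖ ^ 2 ≤ 1 / β * (K * ‖z τ‖) ^ 2 := by gcongr
        _ = K ^ 2 / β * ‖z τ‖ ^ 2 := by ring
    have h4 : ENNReal.ofReal (‖z t‖ ^ 2)
        ≤ ENNReal.ofReal (∫ τ in (0 : ℝ)..t, K ^ 2 / β * ‖z τ‖ ^ 2) := by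
      rw [ENNReal.ofReal_pow (norm_nonneg _), ofReal_norm]
      rw [h2, zero_add] at hE
      exact h1.trans (le_self_add.trans (hE.trans h3))
    have h5 : 0 ≤ ∫ τ in (0 : ℝ)..t, K ^ 2 / β * ‖z τ‖ ^ 2 :=
      intervalIntegral.integral_nonneg ht.1 fun τ _ => by positivity
    rw [← intervalIntegral.integral_const_mul]
    exact (ENNReal.ofReal_le_ofReal_iff h5).1 h4
  have hsc : Continuous fun τ => ‖z τ‖ ^ 2 := by fun_prop
  have hud : ∀ t, HasDerivAt (fun t => ∫ τ in (0 : ℝ)..t, ‖z τ‖ ^ 2) (‖z t‖ ^ 2) t := fun t =>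
    intervalIntegral.integral_hasDerivAt_right (hsc.intervalIntegrable _ _)
      (hsc.stronglyMeasurableAtFilter _ _) hsc.continuousAt
  have hu0 := eq_zero_of_abs_deriv_le_mul_abs_self_of_eq_zero_right (a := 0) (b := T)
    (K := K ^ 2 / β) (f := fun t => ∫ τ in (0 : ℝ)..t, ‖z τ‖ ^ 2) (f' := fun t => ‖z t‖ ^ 2)
    (fun t _ => (hud t).continuousAt.continuousWithinAt)
    (fun t _ => (hud t).hasDerivWithinAt) (by simp) (fun t ht => by
      rw [Real.norm_of_nonneg (by positivity), Real.norm_of_nonneg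
        (intervalIntegral.integral_nonneg ht.1 fun τ _ => by positivity)]
      exact hkey t ⟨ht.1, ht.2.le⟩)
  intro t ht
  have h1 := hkey t ht
  rw [show (∫ τ in (0 : ℝ)..t, ‖z τ‖ ^ 2) = 0 from hu0 t ht, mul_zero] at h1
  have h2 : ‖z t‖ = 0 := by nlinarith [norm_nonneg (z t)]
  exact sub_eq_zero.1 (norm_eq_zero.1 h2)

end Uniqueness

section APriori

variable {α β γ δ : ℝ} {N : CLTwo → CLTwo} {K : NNReal} {ψ : ℝ → CLTwo}

theorem lintegral_wE_const_ne_top {G : ℝ → CLTwo} (hG : Continuous G) {c : ℝ} (hc : 0 ≤ c)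
    (s t : ℝ) : ∫⁻ τ in Ioc s t, wE univ (fun _ => c) (G τ) ≠ ⊤ := by
  have e : ∀ τ, wE univ (fun _ => c) (G τ) = ENNReal.ofReal (c * ‖G τ‖ ^ 2) := by
    intro τ
    have := wE_const_mul univ (a := fun _ => 1) hc (G τ)
    simp only [mul_one] at this
    rw [this, wE_one, ENNReal.ofReal_mul hc, ENNReal.ofReal_pow (norm_nonneg _), ofReal_norm]
  simp_rw [e]
  have hint : Continuous fun τ => c * ‖G τ‖ ^ 2 := by fun_prop
  rw [← ofReal_integral_eq_lintegral_ofReal (hint.integrableOn_Ioc (a := s) (b := t))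
    (Eventually.of_forall fun τ => by positivity)]
  exact ENNReal.ofReal_ne_top

/-- The `H¹` energy inequality without the cancellation of the flux; it bounds the energy on
bounded time intervals. -/
theorem energy_low (hα : 0 < α) (hβ : 0 < β) (hγ : 0 < γ) {T : ℝ} {G : ℝ → CLTwo}
    (h : FourierSol (linSym α β γ δ) (fluxSym α) T ψ G) {t : ℝ} (ht : t ∈ Icc 0 T) :
    wE univ (fun ξ => 1 + α * wav ξ ^ 2) (ψ t)
        + ∫⁻ τ in Ioc 0 t, wE univ (fun ξ => β * wav ξ ^ 2 + 2 * γ * wav ξ ^ 4) (ψ τ)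
      ≤ wE univ (fun ξ => 1 + α * wav ξ ^ 2) (ψ 0)
        + ∫⁻ τ in Ioc 0 t, wE univ (fun _ => 1 / β) (G τ) := by
  have hw := continuous_wav
  exact h.energy_le (continuous_linSym hα) (continuous_fluxSym hα) (by fun_prop) (by fun_prop)
    (by fun_prop) (fun ξ => by positivity) (fun ξ => by positivity) (fun ξ => by positivity)
    (energy_law_low hα hβ) MeasurableSet.univ le_rfl ht.1 ht.2

/-- The `H¹` energy law: the flux does no work. -/
theorem energy_flux_free (hα : 0 < α) (hβ : 0 < β) (hγ : 0 < γ) (hN : FluxMap N K)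
    (h : ∀ T, FourierSol (linSym α β γ δ) (fluxSym α) T ψ fun t => N (ψ t))
    (h0 : wE univ (fun ξ => 1 + α * wav ξ ^ 2) (ψ 0) ≠ ⊤) {t : ℝ} (ht : 0 ≤ t) :
    wE univ (fun ξ => 1 + α * wav ξ ^ 2) (ψ t)
        + ∫⁻ τ in Ioc 0 t, wE univ (fun ξ => 2 * (γ * wav ξ ^ 4 + β * wav ξ ^ 2)) (ψ τ)
      ≤ wE univ (fun ξ => 1 + α * wav ξ ^ 2) (ψ 0) := by
  have hw := continuous_wav
  have hd := continuous_dsym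
  have c1 := (h t).cont
  have c2 := (h t).cont_forcing
  set a : ℝ → ℝ := fun ξ => 1 + α * wav ξ ^ 2 with ha
  set b : ℝ → ℝ := fun ξ => 2 * (γ * wav ξ ^ 4 + β * wav ξ ^ 2) with hb
  have hac : Continuous a := by fun_prop
  have hbc : Continuous b := by fun_prop
  have ha0 : ∀ ξ, 0 ≤ a ξ := fun ξ => by positivity
  have hb0 : ∀ ξ, 0 ≤ b ξ := fun ξ => by positivity
  set B : ℕ → Set ℝ := fun n => Icc (-n : ℝ) n with hB
  set J : ℕ → ℝ → ℝ := fun n τ => (inner ℂ (win (B n) dsym (ψ τ)) (N (ψ τ))).re with hJ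
  have hJc : ∀ n, Continuous (J n) := fun n => by
    have := Complex.continuous_re
    simp only [hJ]
    exact this.comp (Continuous.inner (𝕜 := ℂ) (by fun_prop) c2)
  -- on windows, the energy law with the flux term `2 ∫ J n`
  have hwin : ∀ n, wE (B n) a (ψ t) + ∫⁻ τ in Ioc 0 t, wE (B n) b (ψ τ)
      ≤ wE univ a (ψ 0) + ENNReal.ofReal |2 * ∫ τ in (0 : ℝ)..t, J n τ| := by
    intro n
    have hBn : Window (B n) := window_Icc n
    have hbq : Continuous fun τ => qE (B n) b (ψ τ) := (continuous_qE hBn hbc).comp c1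
    have hid := (h t).energy_identity hBn hac le_rfl ht le_rfl
    have e0 : ∫ τ in (0 : ℝ)..t, energyRate (B n) (linSym α β γ δ) (fluxSym α) a (ψ τ) (N (ψ τ))
        = -(∫ τ in (0 : ℝ)..t, qE (B n) b (ψ τ)) + 2 * ∫ τ in (0 : ℝ)..t, J n τ := by
      have hbi : IntervalIntegrable (fun τ => -(qE (B n) b (ψ τ))) volume 0 t :=
        hbq.neg.intervalIntegrable _ _
      rw [← intervalIntegral.integral_neg, ← intervalIntegral.integral_const_mul,
        ← intervalIntegral.integral_add hbi
          (((hJc n).const_mul 2).intervalIntegrable _ _)]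
      refine intervalIntegral.integral_congr fun τ _ => ?_
      exact energyRate_eq hBn (continuous_linSym hα) (continuous_fluxSym hα) hd hac hbc
        (energy_law_basic hα) _ _
    rw [e0] at hid
    have e1 : ∫⁻ τ in Ioc 0 t, wE (B n) b (ψ τ)
        = ENNReal.ofReal (∫ τ in (0 : ℝ)..t, qE (B n) b (ψ τ)) := by
      rw [intervalIntegral.integral_of_le ht, ofReal_integral_eq_lintegral_ofReal
        hbq.integrableOn_Ioc (Eventually.of_forall fun τ => qE_nonneg hb0 _)]
      exact lintegral_congr fun τ => (ofReal_qE hBn hbc hb0 _).symm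
    refine le_trans ?_ (add_le_add_left (wE_mono_set (subset_univ (B n)) a (ψ 0)) _)
    rw [e1, ← ofReal_qE hBn hac ha0, ← ofReal_qE hBn hac ha0,
      ← ENNReal.ofReal_add (qE_nonneg ha0 _)
        (intervalIntegral.integral_nonneg ht fun τ _ => qE_nonneg hb0 _),
      ← ENNReal.ofReal_add (qE_nonneg ha0 _) (abs_nonneg _)]
    refine ENNReal.ofReal_le_ofReal ?_
    have := le_abs_self (2 * ∫ τ in (0 : ℝ)..t, J n τ)
    linarith
  -- the flux term vanishes in the limit, by dominated convergence
  set M : ℝ≥0∞ := wE univ a (ψ 0) + ∫⁻ τ in Ioc 0 t, wE univ (fun _ => 1 / β) (N (ψ τ)) with hM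
  have hMt : M ≠ ⊤ := ENNReal.add_ne_top.2
    ⟨h0, lintegral_wE_const_ne_top c2 (by positivity) 0 t⟩
  have hlow : ∀ τ ∈ Icc 0 t, wE univ a (ψ τ) ≤ M := by
    intro τ hτ
    refine (le_self_add.trans (energy_low hα hβ hγ (h t) hτ)).trans ?_
    exact add_le_add_right (lintegral_mono_set (Ioc_subset_Ioc_right hτ.2)) _
  have hfin : ∫⁻ τ in Ioc 0 t, wE univ (fun ξ => wav ξ ^ 4) (ψ τ) ≠ ⊤ := by
    refine lintegral_wE_ne_top_of_le (C := 1 / (2 * γ)) (by positivity)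
      (b := fun ξ => β * wav ξ ^ 2 + 2 * γ * wav ξ ^ 4) (fun ξ => ?_) ?_
    · rw [mul_add]
      have : 0 ≤ 1 / (2 * γ) * (β * wav ξ ^ 2) := by positivity
      have e : 1 / (2 * γ) * (2 * γ * wav ξ ^ 4) = wav ξ ^ 4 := by field_simp
      linarith
    · exact ne_top_of_le_ne_top hMt
        (le_add_self.trans (energy_low hα hβ hγ (h t) ⟨ht, le_rfl⟩))
  have hae : ∀ᵐ τ ∂volume.restrict (Ioc 0 t), wE univ (fun ξ => wav ξ ^ 4) (ψ τ) ≠ ⊤ := by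
    filter_upwards [ae_lt_top' (measurable_wE_comp MeasurableSet.univ (by fun_prop)
      (fun ξ => by positivity) c1).aemeasurable hfin] with τ hτ using hτ.ne
  obtain ⟨M', hM'⟩ := (isCompact_Icc (a := 0) (b := t)).exists_bound_of_continuousOn
    c2.continuousOn
  have hJb : ∀ n, ∀ τ ∈ Icc 0 t, ‖J n τ‖ ≤ √(M.toReal / α) * M' := by
    intro n τ hτ
    have hBn : Window (B n) := window_Icc n
    have h1 : ‖win (B n) dsym (ψ τ)‖ ≤ √(M.toReal / α) := by
      refine Real.le_sqrt_of_sq_le ?_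
      rw [le_div_iff₀ hα, mul_comm]
      have h2 : ENNReal.ofReal (α * ‖win (B n) dsym (ψ τ)‖ ^ 2) ≤ M := by
        rw [ENNReal.ofReal_mul hα.le, ENNReal.ofReal_pow (norm_nonneg _), ofReal_norm, win,
          enorm_mulOp_sq (hBn.bddSymbol hd), ← wE_const_mul _ hα.le]
        refine (wE_mono MeasurableSet.univ (fun ξ _ => ?_) _).trans (hlow τ hτ)
        by_cases hξ : ξ ∈ B n
        · rw [indicator_of_mem hξ, norm_dsym_sq]
          simp only [ha]
          linarith
        · rw [indicator_of_notMem hξ]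
          simpa using ha0 ξ
      have h3 := ENNReal.toReal_mono hMt h2
      rwa [ENNReal.toReal_ofReal (by positivity)] at h3
    refine (Complex.abs_re_le_norm _).trans ((norm_inner_le_norm _ _).trans ?_)
    exact mul_le_mul h1 (hM' τ hτ) (norm_nonneg _) (Real.sqrt_nonneg _)
  have hJlim : Tendsto (fun n => ∫ τ in (0 : ℝ)..t, J n τ) atTop
      (𝓝 (∫ τ in (0 : ℝ)..t, (0 : ℝ))) := by
    refine intervalIntegral.tendsto_integral_filter_of_dominated_convergence
      (fun _ => √(M.toReal / α) * M') (Eventually.of_forall fun n =>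
        (hJc n).aestronglyMeasurable) (Eventually.of_forall fun n =>
        Eventually.of_forall fun τ hτ => hJb n τ ?_) intervalIntegrable_const ?_
    · rw [uIoc_of_le ht] at hτ
      exact ⟨hτ.1.le, hτ.2⟩
    · rw [uIoc_of_le ht, ← ae_restrict_iff' measurableSet_Ioc]
      filter_upwards [hae] with τ hτ using hN.orth _ hτ
  have hlim2 : Tendsto (fun n => wE univ a (ψ 0) + ENNReal.ofReal |2 * ∫ τ in (0 : ℝ)..t, J n τ|)
      atTop (𝓝 (wE univ a (ψ 0) + 0)) := by
    refine Tendsto.add tendsto_const_nhds ?_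
    have h1 : Tendsto (fun n => |2 * ∫ τ in (0 : ℝ)..t, J n τ|) atTop (𝓝 0) := by
      simpa using (hJlim.const_mul 2).abs
    have h2 := (ENNReal.continuous_ofReal.tendsto 0).comp h1
    rwa [ENNReal.ofReal_zero] at h2
  rw [add_zero] at hlim2
  have hmono : Monotone fun n : ℕ => ∫⁻ τ in Ioc 0 t, wE (univ ∩ B n) b (ψ τ) :=
    fun i j hij => lintegral_mono fun τ => monotone_wE_inter univ b _ hij
  have hlhs : wE univ a (ψ t) + ∫⁻ τ in Ioc 0 t, wE univ b (ψ τ)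
      = ⨆ n : ℕ, (wE (univ ∩ B n) a (ψ t) + ∫⁻ τ in Ioc 0 t, wE (univ ∩ B n) b (ψ τ)) := by
    rw [← ENNReal.iSup_add_iSup_of_monotone (monotone_wE_inter univ a _) hmono,
      ← wE_eq_iSup, ← lintegral_iSup]
    · simp_rw [hB, ← wE_eq_iSup]
    · exact fun n => measurable_wE_comp (MeasurableSet.univ.inter measurableSet_Icc) hbc hb0 c1
    · exact fun i j hij τ => monotone_wE_inter univ b _ hij
  have hlhs' := tendsto_atTop_iSup ((monotone_wE_inter univ a (ψ t)).add hmono)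
  rw [hlhs]
  refine le_of_tendsto_of_tendsto' hlhs' hlim2 fun n => ?_
  simpa only [univ_inter] using hwin n

end APriori

end

/-! ### Regularity and decay of the energies -/

noncomputable section

open Classical in
/-- Multiplication of `ψ` by a possibly unbounded symbol; it is `0` unless the product is in
`L²`. -/
def mulTo (s : ℝ → ℂ) (ψ : CLTwo) : CLTwo :=
  if h : MemLp (fun ξ => s ξ * ψ ξ) 2 volume then h.toLp _ else 0

theorem memLp_mul_of_wE {s : ℝ → ℂ} (hs : Continuous s) {ψ : CLTwo}
    (h : wE univ (fun ξ => ‖s ξ‖ ^ 2) ψ ≠ ⊤) : MemLp (fun ξ => s ξ * ψ ξ) 2 volume := by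
  refine ⟨hs.aestronglyMeasurable.mul (Lp.aestronglyMeasurable ψ), ?_⟩
  rw [eLpNorm_lt_top_iff_lintegral_rpow_enorm_lt_top (by norm_num) (by norm_num)]
  refine lt_of_eq_of_lt ?_ h.lt_top
  rw [wE, Measure.restrict_univ]
  refine lintegral_congr fun ξ => ?_
  rw [ENNReal.toReal_ofNat, ENNReal.rpow_ofNat, enorm_mul, mul_pow,
    ENNReal.ofReal_pow (norm_nonneg _), ofReal_norm]

theorem coeFn_mulTo {s : ℝ → ℂ} (hs : Continuous s) {ψ : CLTwo}
    (h : wE univ (fun ξ => ‖s ξ‖ ^ 2) ψ ≠ ⊤) : mulTo s ψ =ᵐ[volume] fun ξ => s ξ * ψ ξ := by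
  rw [mulTo, dif_pos (memLp_mul_of_wE hs h)]
  exact MemLp.coeFn_toLp _

theorem wE_mulTo {s : ℝ → ℂ} (hs : Continuous s) {ψ : CLTwo}
    (h : wE univ (fun ξ => ‖s ξ‖ ^ 2) ψ ≠ ⊤) (B : Set ℝ) {a : ℝ → ℝ} (ha : ∀ ξ, 0 ≤ a ξ) :
    wE B a (mulTo s ψ) = wE B (fun ξ => a ξ * ‖s ξ‖ ^ 2) ψ := by
  rw [wE, wE]
  refine lintegral_congr_ae (ae_restrict_of_ae ?_)
  filter_upwards [coeFn_mulTo hs h] with ξ hξ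
  rw [hξ, enorm_mul, mul_pow, ENNReal.ofReal_mul (ha ξ), ENNReal.ofReal_pow (norm_nonneg _),
    ofReal_norm, mul_assoc]

theorem enorm_mulTo_sq {s : ℝ → ℂ} (hs : Continuous s) {ψ : CLTwo}
    (h : wE univ (fun ξ => ‖s ξ‖ ^ 2) ψ ≠ ⊤) :
    ‖mulTo s ψ‖ₑ ^ 2 = wE univ (fun ξ => ‖s ξ‖ ^ 2) ψ := by
  rw [← wE_one, wE_mulTo hs h _ (fun _ => zero_le_one)]
  simp

theorem win_mulTo {s r : ℝ → ℂ} (hs : Continuous s) (hr : Continuous r) {ψ : CLTwo}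
    (h : wE univ (fun ξ => ‖s ξ‖ ^ 2) ψ ≠ ⊤) {B : Set ℝ} (hB : Window B) :
    win B r (mulTo s ψ) = win B (fun ξ => r ξ * s ξ) ψ := by
  refine Lp.ext ?_
  filter_upwards [coeFn_win hB hr (mulTo s ψ), coeFn_mulTo hs h, coeFn_win hB (hr.mul hs) ψ]
    with ξ h1 h2 h3
  rw [h1, h2]
  refine Eq.trans ?_ h3.symm
  by_cases hξ : ξ ∈ B <;> simp [hξ, mul_assoc]

theorem enorm_mulTo_sub_win_sq {s : ℝ → ℂ} (hs : Continuous s) {ψ : CLTwo}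
    (h : wE univ (fun ξ => ‖s ξ‖ ^ 2) ψ ≠ ⊤) {B : Set ℝ} (hB : Window B) :
    ‖mulTo s ψ - win B s ψ‖ₑ ^ 2 = wE Bᶜ (fun ξ => ‖s ξ‖ ^ 2) ψ := by
  rw [enorm_sq_eq_lintegral, wE, ← lintegral_indicator hB.1.compl]
  refine lintegral_congr_ae ?_
  filter_upwards [coeFn_win hB hs ψ, coeFn_mulTo hs h, Lp.coeFn_sub (mulTo s ψ) (win B s ψ)]
    with ξ h1 h2 h3
  rw [h3, Pi.sub_apply, h1, h2]
  by_cases hξ : ξ ∈ B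
  · simp [hξ]
  · simp [hξ, mul_pow, ENNReal.ofReal_pow (norm_nonneg _), ofReal_norm]

theorem tendsto_win_mulTo {s : ℝ → ℂ} (hs : Continuous s) {ψ : CLTwo}
    (h : wE univ (fun ξ => ‖s ξ‖ ^ 2) ψ ≠ ⊤) :
    Tendsto (fun n : ℕ => win (Icc (-n : ℝ) n) s ψ) atTop (𝓝 (mulTo s ψ)) := by
  refine (tendsto_win_one (mulTo s ψ)).congr fun n => ?_
  rw [win_mulTo hs continuous_one h (window_Icc n)]
  simp

/-- A curve multiplied by an unbounded symbol is continuous if its high-frequency tails are small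
locally uniformly in time. -/
theorem continuousOn_mulTo {s : ℝ → ℂ} (hs : Continuous s) {ψ : ℝ → CLTwo} (hψ : Continuous ψ)
    (hfin : ∀ t, 0 ≤ t → wE univ (fun ξ => ‖s ξ‖ ^ 2) (ψ t) ≠ ⊤) {e : ℕ → ℝ≥0∞}
    (he : Tendsto e atTop (𝓝 0))
    (htail : ∀ᶠ n : ℕ in atTop, ∀ t, 0 ≤ t →
      wE (Icc (-n : ℝ) n)ᶜ (fun ξ => ‖s ξ‖ ^ 2) (ψ t) ≤ e n) :
    ContinuousOn (fun t => mulTo s (ψ t)) (Ici 0) := by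
  have hunif : TendstoUniformlyOn (fun (n : ℕ) t => win (Icc (-n : ℝ) n) s (ψ t))
      (fun t => mulTo s (ψ t)) atTop (Ici 0) := by
    rw [Metric.tendstoUniformlyOn_iff]
    intro ε hε
    have hε2 : (0 : ℝ≥0∞) < ENNReal.ofReal (ε ^ 2) := ENNReal.ofReal_pos.2 (by positivity)
    filter_upwards [htail, he.eventually (gt_mem_nhds hε2)] with n h1 h2 t ht
    have h3 := (h1 t ht).trans_lt h2
    rw [← enorm_mulTo_sub_win_sq hs (hfin t ht) (window_Icc n), ← ofReal_norm,
      ← ENNReal.ofReal_pow (norm_nonneg _), ENNReal.ofReal_lt_ofReal_iff (by positivity)] at h3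
    rw [dist_eq_norm]
    exact lt_of_pow_lt_pow_left₀ 2 hε.le h3
  refine hunif.continuousOn (Frequently.of_forall fun n => ?_)
  exact (by fun_prop : Continuous fun t => win (Icc (-n : ℝ) n) s (ψ t)).continuousOn

/-- A curve multiplied by an unbounded symbol is square integrable if its weighted energy is
integrable. -/
theorem memLp_mulTo {s : ℝ → ℂ} (hs : Continuous s) {ψ : ℝ → CLTwo} (hψ : Continuous ψ)
    (h : ∫⁻ t in Ioi 0, wE univ (fun ξ => ‖s ξ‖ ^ 2) (ψ t) ≠ ⊤) :
    (∀ᵐ t ∂volume.restrict (Ioi 0), wE univ (fun ξ => ‖s ξ‖ ^ 2) (ψ t) ≠ ⊤) ∧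
    MemLp (fun t => mulTo s (ψ t)) 2 (volume.restrict (Ioi (0 : ℝ))) := by
  have hmeas : Measurable fun t => wE univ (fun ξ => ‖s ξ‖ ^ 2) (ψ t) :=
    measurable_wE_comp MeasurableSet.univ (by fun_prop) (fun ξ => by positivity) hψ
  have hae : ∀ᵐ t ∂volume.restrict (Ioi (0 : ℝ)), wE univ (fun ξ => ‖s ξ‖ ^ 2) (ψ t) ≠ ⊤ := by
    filter_upwards [ae_lt_top hmeas h] with t ht using ht.ne
  refine ⟨hae, ?_, ?_⟩
  · refine aestronglyMeasurable_of_tendsto_ae (u := atTop)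
      (f := fun (n : ℕ) t => win (Icc (-n : ℝ) n) s (ψ t)) (fun n => ?_) ?_
    · exact (by fun_prop : Continuous fun t => win (Icc (-n : ℝ) n) s (ψ t)).aestronglyMeasurable
    · filter_upwards [hae] with t ht using tendsto_win_mulTo hs ht
  · rw [eLpNorm_lt_top_iff_lintegral_rpow_enorm_lt_top (by norm_num) (by norm_num)]
    refine lt_of_eq_of_lt (lintegral_congr_ae ?_) h.lt_top
    filter_upwards [hae] with t ht
    rw [ENNReal.toReal_ofNat, ENNReal.rpow_ofNat, enorm_mulTo_sq hs ht]

/-- The symbol of `1 + ∂_x`, whose powers measure Sobolev regularity: `|1 + i k|² = 1 + k²`. -/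
def besselSym (ξ : ℝ) : ℂ := 1 + dsym ξ

theorem continuous_besselSym : Continuous besselSym := continuous_const.add continuous_dsym

theorem norm_besselSym_sq (ξ : ℝ) : ‖besselSym ξ‖ ^ 2 = 1 + wav ξ ^ 2 := by
  rw [besselSym, dsym, Complex.sq_norm, Complex.normSq_apply]
  simp
  ring

theorem besselSym_ne_zero (ξ : ℝ) : besselSym ξ ≠ 0 := by
  intro h
  have := norm_besselSym_sq ξ
  rw [h, norm_zero] at this
  nlinarith [sq_nonneg (wav ξ)]

section Regularity

variable {α β γ δ : ℝ} {N : CLTwo → CLTwo} {K : NNReal} {ψ : ℝ → CLTwo}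

/-- The dissipation of the `H¹` energy controls `∂_x u` and `∂_x² u` in space-time. -/
theorem lintegral_sq_quartic_ne_top (hα : 0 < α) (hβ : 0 < β) (hγ : 0 < γ) (hN : FluxMap N K)
    (h : ∀ T, FourierSol (linSym α β γ δ) (fluxSym α) T ψ fun t => N (ψ t))
    (h0 : wE univ (fun ξ => 1 + α * wav ξ ^ 2) (ψ 0) ≠ ⊤) :
    ∫⁻ τ in Ioi 0, wE univ (fun ξ => wav ξ ^ 2 + wav ξ ^ 4) (ψ τ) ≠ ⊤ := by
  have h1 : ∫⁻ τ in Ioi 0, wE univ (fun ξ => 2 * (γ * wav ξ ^ 4 + β * wav ξ ^ 2)) (ψ τ) ≠ ⊤ :=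
    ne_top_of_le_ne_top h0 (lintegral_Ioi_le_of_forall fun t ht =>
      le_add_self.trans (energy_flux_free hα hβ hγ hN h h0 ht))
  refine lintegral_wE_ne_top_of_le (C := 1 / β + 1 / γ) (by positivity) (fun ξ => ?_) h1
  have e : (1 / β + 1 / γ) * (2 * (γ * wav ξ ^ 4 + β * wav ξ ^ 2))
      = wav ξ ^ 2 + wav ξ ^ 4 + (wav ξ ^ 2 + wav ξ ^ 4 + 2 * (γ / β * wav ξ ^ 4)
        + 2 * (β / γ * wav ξ ^ 2)) := by
    field_simp
    ring
  rw [e]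
  have : 0 ≤ wav ξ ^ 2 + wav ξ ^ 4 + 2 * (γ / β * wav ξ ^ 4) + 2 * (β / γ * wav ξ ^ 2) := by
    positivity
  linarith

/-- The flux term `∂_x g(v)` is square integrable in space-time. -/
theorem lintegral_flux_ne_top (hα : 0 < α) (hβ : 0 < β) (hγ : 0 < γ) (hN : FluxMap N K)
    (h : ∀ T, FourierSol (linSym α β γ δ) (fluxSym α) T ψ fun t => N (ψ t))
    (h0 : wE univ (fun ξ => 1 + α * wav ξ ^ 2) (ψ 0) ≠ ⊤) :
    ∫⁻ τ in Ioi 0, wE univ (fun ξ => wav ξ ^ 2) (N (ψ τ)) ≠ ⊤ := by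
  have hw := continuous_wav
  have h1 := lintegral_sq_quartic_ne_top hα hβ hγ hN h h0
  have h2 : ∫⁻ τ in Ioi 0, wE univ (fun ξ => wav ξ ^ 2) (ψ τ) ≠ ⊤ :=
    lintegral_wE_ne_top_of_le zero_le_one (fun ξ => by
      have : 0 ≤ wav ξ ^ 4 := by positivity
      linarith) h1
  have h4 : ∫⁻ τ in Ioi 0, wE univ (fun ξ => wav ξ ^ 4) (ψ τ) ≠ ⊤ :=
    lintegral_wE_ne_top_of_le zero_le_one (fun ξ => by
      have : 0 ≤ wav ξ ^ 2 := by positivity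
      linarith) h1
  have hle : ∫⁻ τ in Ioi 0, wE univ (fun ξ => wav ξ ^ 2) (N (ψ τ))
      ≤ ∫⁻ τ in Ioi 0, (K : ℝ≥0∞) ^ 2 * wE univ (fun ξ => wav ξ ^ 2) (ψ τ) := by
    refine lintegral_mono_ae ?_
    filter_upwards [ae_lt_top (measurable_wE_comp MeasurableSet.univ (by fun_prop)
      (fun ξ => by positivity) (h 0).cont) h4] with τ hτ using hN.deriv_le _ hτ.ne
  refine ne_top_of_le_ne_top ?_ hle
  rw [lintegral_const_mul' _ _ (by simp)]
  exact ENNReal.mul_ne_top (by simp) h2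

/-- The `H³` energy inequality, localized to an arbitrary set of frequencies. -/
theorem energy_high (hα : 0 < α) (hβ : 0 < β) (hγ : 0 < γ)
    (h : ∀ T, FourierSol (linSym α β γ δ) (fluxSym α) T ψ fun t => N (ψ t)) {B : Set ℝ}
    (hB : MeasurableSet B) {s t : ℝ} (hs : 0 ≤ s) (hst : s ≤ t) :
    wE B (fun ξ => (1 + α * wav ξ ^ 2) * (wav ξ ^ 2 + wav ξ ^ 4)) (ψ t)
        + ∫⁻ τ in Ioc s t, wE B (fun ξ => β * wav ξ ^ 4 + γ * wav ξ ^ 8) (ψ τ)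
      ≤ wE B (fun ξ => (1 + α * wav ξ ^ 2) * (wav ξ ^ 2 + wav ξ ^ 4)) (ψ s)
        + ENNReal.ofReal (1 / β + 1 / γ) * ∫⁻ τ in Ioi s, wE B (fun ξ => wav ξ ^ 2) (N (ψ τ)) := by
  have hw := continuous_wav
  refine ((h t).energy_le (continuous_linSym hα) (continuous_fluxSym hα)
    (κ := fun ξ => (1 / β + 1 / γ) * wav ξ ^ 2) (by fun_prop) (by fun_prop)
    (by fun_prop) (fun ξ => by positivity) (fun ξ => by positivity) (fun ξ => by positivity)
    (energy_law_high hα hβ hγ) hB hs hst le_rfl).trans ?_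
  refine add_le_add_right ?_ _
  rw [← lintegral_const_mul' _ _ ENNReal.ofReal_ne_top]
  refine (lintegral_mono_set Ioc_subset_Ioi_self).trans (lintegral_mono fun τ => ?_)
  simp only
  rw [wE_const_mul _ (by positivity)]

/-- A global solution with `H³` initial data, on the Fourier side.  The two energies of the initial
value together are equivalent to the square of its `H³` norm. -/
structure SmoothSol (α β γ δ : ℝ) (N : CLTwo → CLTwo) (K : NNReal) (ψ : ℝ → CLTwo) : Prop where
  alpha_pos : 0 < α
  beta_pos : 0 < β
  gamma_pos : 0 < γ
  flux : FluxMap N K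
  sol : ∀ T, FourierSol (linSym α β γ δ) (fluxSym α) T ψ fun t => N (ψ t)
  low : wE univ (fun ξ => 1 + α * wav ξ ^ 2) (ψ 0) ≠ ⊤
  high : wE univ (fun ξ => (1 + α * wav ξ ^ 2) * (wav ξ ^ 2 + wav ξ ^ 4)) (ψ 0) ≠ ⊤

namespace SmoothSol

theorem low_le (S : SmoothSol α β γ δ N K ψ) {t : ℝ} (ht : 0 ≤ t) :
    wE univ (fun ξ => 1 + α * wav ξ ^ 2) (ψ t) ≤ wE univ (fun ξ => 1 + α * wav ξ ^ 2) (ψ 0) :=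
  le_self_add.trans (energy_flux_free S.alpha_pos S.beta_pos S.gamma_pos S.flux S.sol S.low ht)

theorem flux_ne_top (S : SmoothSol α β γ δ N K ψ) :
    ∫⁻ τ in Ioi 0, wE univ (fun ξ => wav ξ ^ 2) (N (ψ τ)) ≠ ⊤ :=
  lintegral_flux_ne_top S.alpha_pos S.beta_pos S.gamma_pos S.flux S.sol S.low

theorem high_le (S : SmoothSol α β γ δ N K ψ) {B : Set ℝ}
    (hB : MeasurableSet B) {s t : ℝ} (hs : 0 ≤ s) (hst : s ≤ t) :
    wE B (fun ξ => (1 + α * wav ξ ^ 2) * (wav ξ ^ 2 + wav ξ ^ 4)) (ψ t)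
      ≤ wE B (fun ξ => (1 + α * wav ξ ^ 2) * (wav ξ ^ 2 + wav ξ ^ 4)) (ψ s)
        + ENNReal.ofReal (1 / β + 1 / γ) * ∫⁻ τ in Ioi s, wE B (fun ξ => wav ξ ^ 2) (N (ψ τ)) :=
  le_self_add.trans (energy_high S.alpha_pos S.beta_pos S.gamma_pos S.sol hB hs hst)

theorem high_ne_top (S : SmoothSol α β γ δ N K ψ) {t : ℝ} (ht : 0 ≤ t) :
    wE univ (fun ξ => (1 + α * wav ξ ^ 2) * (wav ξ ^ 2 + wav ξ ^ 4)) (ψ t) ≠ ⊤ :=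
  ne_top_of_le_ne_top (ENNReal.add_ne_top.2 ⟨S.high, ENNReal.mul_ne_top ENNReal.ofReal_ne_top
    S.flux_ne_top⟩) (S.high_le MeasurableSet.univ le_rfl ht)

/-- The dissipation controls `∂_x u` and `∂_x⁴ u` in space-time. -/
theorem lintegral_sq_octic_ne_top (S : SmoothSol α β γ δ N K ψ) :
    ∫⁻ τ in Ioi 0, wE univ (fun ξ => wav ξ ^ 2 + wav ξ ^ 8) (ψ τ) ≠ ⊤ := by
  have hw := continuous_wav
  have hβ := S.beta_pos
  have hγ := S.gamma_pos
  have h8 : ∫⁻ τ in Ioi 0, wE univ (fun ξ => β * wav ξ ^ 4 + γ * wav ξ ^ 8) (ψ τ) ≠ ⊤ :=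
    ne_top_of_le_ne_top (ENNReal.add_ne_top.2 ⟨S.high, ENNReal.mul_ne_top ENNReal.ofReal_ne_top
      S.flux_ne_top⟩) (lintegral_Ioi_le_of_forall fun t ht =>
      le_add_self.trans (energy_high S.alpha_pos hβ hγ S.sol MeasurableSet.univ le_rfl ht))
  have h8' : ∫⁻ τ in Ioi 0, wE univ (fun ξ => wav ξ ^ 8) (ψ τ) ≠ ⊤ := by
    refine lintegral_wE_ne_top_of_le (C := 1 / γ) (by positivity) (fun ξ => ?_) h8
    have e : 1 / γ * (β * wav ξ ^ 4 + γ * wav ξ ^ 8) = wav ξ ^ 8 + β / γ * wav ξ ^ 4 := by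
      field_simp
      ring
    rw [e]
    have : 0 ≤ β / γ * wav ξ ^ 4 := by positivity
    linarith
  have h1 : ∫⁻ τ in Ioi 0, wE univ (fun ξ => wav ξ ^ 2) (ψ τ) ≠ ⊤ :=
    lintegral_wE_ne_top_of_le zero_le_one (fun ξ => by
      have : 0 ≤ wav ξ ^ 4 := by positivity
      linarith) (lintegral_sq_quartic_ne_top S.alpha_pos hβ hγ S.flux S.sol S.low)
  have e : ∀ τ, wE univ (fun ξ => wav ξ ^ 2 + wav ξ ^ 8) (ψ τ)
      = wE univ (fun ξ => wav ξ ^ 2) (ψ τ) + wE univ (fun ξ => wav ξ ^ 8) (ψ τ) := fun τ =>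
    wE_add univ (hw.measurable.pow_const 2) (fun ξ => by positivity) (fun ξ => by positivity) _
  simp_rw [e]
  rw [lintegral_add_left (measurable_wE_comp MeasurableSet.univ (by fun_prop)
    (fun ξ => by positivity) (S.sol 0).cont)]
  exact ENNReal.add_ne_top.2 ⟨h1, h8'⟩

/-- The two energies together bound the `H³` norm at each time. -/
theorem bessel_cube_ne_top (S : SmoothSol α β γ δ N K ψ) {t : ℝ} (ht : 0 ≤ t) :
    wE univ (fun ξ => ‖besselSym ξ ^ 3‖ ^ 2) (ψ t) ≠ ⊤ := by
  have hα := S.alpha_pos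
  have hw := continuous_wav
  have h1 : wE univ (fun ξ => (1 + α * wav ξ ^ 2)
      + (1 + α * wav ξ ^ 2) * (wav ξ ^ 2 + wav ξ ^ 4)) (ψ t) ≠ ⊤ := by
    rw [wE_add univ (by fun_prop) (fun ξ => by positivity) (fun ξ => by positivity)]
    exact ENNReal.add_ne_top.2 ⟨ne_top_of_le_ne_top S.low (S.low_le ht), S.high_ne_top ht⟩
  refine wE_ne_top_of_le (C := 4 + 4 / α) (by positivity) (fun ξ => ?_) h1
  rw [norm_pow, ← pow_mul, mul_comm 3 2, pow_mul, norm_besselSym_sq]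
  have hx : 0 ≤ wav ξ ^ 2 := sq_nonneg _
  have h4 : wav ξ ^ 4 = (wav ξ ^ 2) ^ 2 := by ring
  rw [h4]
  generalize wav ξ ^ 2 = x at hx
  have e : (4 + 4 / α) * ((1 + α * x) + (1 + α * x) * (x + x ^ 2))
      = (1 + x) ^ 3 + 3 * (1 + x) * (1 - x) ^ 2 + (4 * (α * x) + 4 * (1 + α * x) * x + 4 * x ^ 2
        + 4 * α * x ^ 3 + 4 / α * (1 + x + x ^ 2) + 4 * x + 4 * x ^ 2) := by
    field_simp
    ring
  rw [e]
  have : 0 ≤ 3 * (1 + x) * (1 - x) ^ 2 + (4 * (α * x) + 4 * (1 + α * x) * x + 4 * x ^ 2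
        + 4 * α * x ^ 3 + 4 / α * (1 + x + x ^ 2) + 4 * x + 4 * x ^ 2) := by positivity
  linarith

/-- The solution is continuous in time with values in `H³`. -/
theorem continuousOn_bessel (S : SmoothSol α β γ δ N K ψ) :
    ContinuousOn (fun t => mulTo (fun ξ => besselSym ξ ^ 3) (ψ t)) (Ici 0) := by
  have hα := S.alpha_pos
  have hw := continuous_wav
  have hc := (S.sol 0).cont
  have hNc := (S.sol 0).cont_forcing
  set a : ℝ → ℝ := fun ξ => (1 + α * wav ξ ^ 2) * (wav ξ ^ 2 + wav ξ ^ 4) with ha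
  have hlim1 := tendsto_wE_compl S.high
  have hlim2 : Tendsto (fun n : ℕ => ∫⁻ τ in Ioi 0,
      wE (Icc (-n : ℝ) n)ᶜ (fun ξ => wav ξ ^ 2) (N (ψ τ))) atTop (𝓝 0) := by
    have hm : ∀ B, MeasurableSet B → Measurable fun τ => wE B (fun ξ => wav ξ ^ 2) (N (ψ τ)) :=
      fun B hB => measurable_wE_comp hB (by fun_prop) (fun ξ => by positivity) hNc
    have := tendsto_lintegral_of_dominated_convergence (μ := volume.restrict (Ioi (0 : ℝ)))
      (F := fun (n : ℕ) τ => wE (Icc (-n : ℝ) n)ᶜ (fun ξ => wav ξ ^ 2) (N (ψ τ))) (f := 0)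
      (fun τ => wE univ (fun ξ => wav ξ ^ 2) (N (ψ τ)))
      (fun n => hm _ measurableSet_Icc.compl)
      (fun n => Eventually.of_forall fun τ => wE_mono_set (subset_univ _) _ _) S.flux_ne_top ?_
    · simpa using this
    · filter_upwards [ae_lt_top (hm _ MeasurableSet.univ) S.flux_ne_top] with τ hτ
        using tendsto_wE_compl hτ.ne
  have hlim : Tendsto (fun n : ℕ => ENNReal.ofReal (8 / α) * (wE (Icc (-n : ℝ) n)ᶜ a (ψ 0)
      + ENNReal.ofReal (1 / β + 1 / γ) * ∫⁻ τ in Ioi 0,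
        wE (Icc (-n : ℝ) n)ᶜ (fun ξ => wav ξ ^ 2) (N (ψ τ)))) atTop (𝓝 0) := by
    have := ENNReal.Tendsto.const_mul (a := ENNReal.ofReal (8 / α)) (hlim1.add
      (ENNReal.Tendsto.const_mul (a := ENNReal.ofReal (1 / β + 1 / γ)) hlim2
        (Or.inr ENNReal.ofReal_ne_top))) (Or.inr ENNReal.ofReal_ne_top)
    simpa using this
  refine continuousOn_mulTo (continuous_besselSym.pow 3) hc (fun t ht => S.bessel_cube_ne_top ht)
    hlim ?_
  -- for `|ξ| ≥ 1` the energy without its zeroth-order part dominates the `H³` norm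
  filter_upwards [eventually_ge_atTop 1] with n hn t ht
  refine le_trans ?_ (mul_le_mul_right (S.high_le measurableSet_Icc.compl le_rfl ht) _)
  rw [← wE_const_mul _ (by positivity)]
  refine wE_mono measurableSet_Icc.compl (fun ξ hξ => ?_) _
  have h1 : 1 ≤ wav ξ ^ 2 := by
    have hn' : (1 : ℝ) ≤ n := by exact_mod_cast hn
    have h2 : 1 ≤ |ξ| := by
      by_contra hcon
      exact hξ (abs_le.1 ((not_le.1 hcon).le.trans hn'))
    have h3 : 1 ≤ |wav ξ| := by
      rw [wav, abs_neg, abs_mul, abs_mul, abs_of_pos Real.pi_pos, abs_two]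
      nlinarith [Real.pi_gt_three, mul_le_mul Real.pi_gt_three.le h2 zero_le_one Real.pi_pos.le]
    rw [← sq_abs]
    exact one_le_pow₀ h3
  rw [Pi.pow_apply, norm_pow, ← pow_mul, mul_comm 3 2, pow_mul, norm_besselSym_sq]
  have h4 : wav ξ ^ 4 = (wav ξ ^ 2) ^ 2 := by ring
  rw [h4]
  generalize wav ξ ^ 2 = x at h1
  have e : 8 / α * ((1 + α * x) * (x + x ^ 2)) = 8 * x ^ 3 + (8 / α * (x + x ^ 2) + 8 * x ^ 2) := by
    field_simp
    ring
  have h5 : (1 + x) ^ 3 ≤ (2 * x) ^ 3 := by gcongr; linarith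
  have h6 : 0 ≤ 8 / α * (x + x ^ 2) + 8 * x ^ 2 := by positivity
  rw [e]
  nlinarith

/-- The `H³` energy without its zeroth-order part tends to `0`: it is integrable in time, and by
the energy inequality it can grow only by the tail of a convergent integral. -/
theorem tendsto_high (S : SmoothSol α β γ δ N K ψ) :
    Tendsto (fun t => wE univ (fun ξ => (1 + α * wav ξ ^ 2) * (wav ξ ^ 2 + wav ξ ^ 4)) (ψ t))
      atTop (𝓝 0) := by
  have hα := S.alpha_pos
  have hw := continuous_wav
  set a : ℝ → ℝ := fun ξ => (1 + α * wav ξ ^ 2) * (wav ξ ^ 2 + wav ξ ^ 4) with ha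
  have hint : ∫⁻ τ in Ioi 0, wE univ a (ψ τ) ≠ ⊤ := by
    refine lintegral_wE_ne_top_of_le (C := 2 + 2 * α) (by positivity) (fun ξ => ?_)
      S.lintegral_sq_octic_ne_top
    have hx : 0 ≤ wav ξ ^ 2 := sq_nonneg _
    have h4 : wav ξ ^ 4 = (wav ξ ^ 2) ^ 2 := by ring
    have h8 : wav ξ ^ 8 = (wav ξ ^ 2) ^ 4 := by ring
    rw [ha]
    simp only
    rw [h4, h8]
    generalize wav ξ ^ 2 = x at hx
    have e2 : x ^ 2 ≤ x + x ^ 4 := by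
      nlinarith [mul_nonneg hx (sq_nonneg (x - 1)), mul_nonneg hx (sq_nonneg (x ^ 2 - x)),
        mul_nonneg hx (sq_nonneg (x ^ 2 - 1)), sq_nonneg (x ^ 2 - 1), sq_nonneg (x ^ 2 - x),
        mul_nonneg hx (mul_nonneg hx hx)]
    have e3 : x ^ 3 ≤ x + x ^ 4 := by
      nlinarith [mul_nonneg hx (sq_nonneg (x - 1)), sq_nonneg (x ^ 2 - x),
        mul_nonneg hx (mul_nonneg hx hx)]
    have h7 : 0 ≤ x ^ 4 := by positivity
    nlinarith [mul_le_mul_of_nonneg_left e2 hα.le, mul_le_mul_of_nonneg_left e3 hα.le]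
  have htail : Tendsto (fun s : ℝ => ENNReal.ofReal (1 / β + 1 / γ)
      * ∫⁻ τ in Ioi s, wE univ (fun ξ => wav ξ ^ 2) (N (ψ τ))) atTop (𝓝 0) := by
    have h1 : Tendsto (fun s : ℝ => ∫⁻ τ in Ioi s, wE univ (fun ξ => wav ξ ^ 2) (N (ψ τ)))
        atTop (𝓝 0) := by
      have hm : Tendsto (fun s : ℝ => ((volume.restrict (Ioi (0 : ℝ))).withDensity
          fun τ => wE univ (fun ξ => wav ξ ^ 2) (N (ψ τ))) (Ioi s)) atTop
          (𝓝 (((volume.restrict (Ioi (0 : ℝ))).withDensity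
          fun τ => wE univ (fun ξ => wav ξ ^ 2) (N (ψ τ))) (⋂ s : ℝ, Ioi s))) := by
        refine tendsto_measure_iInter_atTop (fun s => measurableSet_Ioi.nullMeasurableSet)
          (fun i j hij => Ioi_subset_Ioi hij) ⟨0, ?_⟩
        refine ne_top_of_le_ne_top S.flux_ne_top ?_
        rw [withDensity_apply _ measurableSet_Ioi]
        exact lintegral_mono' Measure.restrict_le_self le_rfl
      have he : (⋂ s : ℝ, Ioi s) = (∅ : Set ℝ) :=
        eq_empty_of_forall_notMem fun x hx => lt_irrefl x (mem_iInter.1 hx x)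
      rw [he, measure_empty] at hm
      refine hm.congr' ?_
      filter_upwards [eventually_ge_atTop 0] with s hs
      rw [withDensity_apply _ measurableSet_Ioi, Measure.restrict_restrict measurableSet_Ioi,
        inter_eq_left.2 (Ioi_subset_Ioi hs)]
    have := ENNReal.Tendsto.const_mul (a := ENNReal.ofReal (1 / β + 1 / γ)) h1
      (Or.inr ENNReal.ofReal_ne_top)
    simpa using this
  rw [ENNReal.tendsto_nhds_zero]
  intro ε hε
  have hε2 : (0 : ℝ≥0∞) < ε / 2 := ENNReal.half_pos hε.ne'
  obtain ⟨s₀, hs₀⟩ := ((ENNReal.tendsto_nhds_zero.1 htail _ hε2).and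
    (eventually_ge_atTop 0)).exists
  -- a time after `s₀` at which the energy is small
  obtain ⟨s, hs, hsε⟩ : ∃ s, s₀ < s ∧ wE univ a (ψ s) ≤ ε / 2 := by
    by_contra! hcon
    refine hint (top_unique ?_)
    calc (⊤ : ℝ≥0∞) = ∫⁻ _ in Ioi s₀, ε / 2 := by
          rw [setLIntegral_const, Real.volume_Ioi, ENNReal.mul_top hε2.ne']
      _ ≤ ∫⁻ τ in Ioi s₀, wE univ a (ψ τ) :=
          setLIntegral_mono' measurableSet_Ioi fun τ hτ => (hcon τ hτ).le
      _ ≤ ∫⁻ τ in Ioi 0, wE univ a (ψ τ) := lintegral_mono_set (Ioi_subset_Ioi hs₀.2)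
  filter_upwards [eventually_ge_atTop s] with t ht
  refine (S.high_le MeasurableSet.univ (hs₀.2.trans hs.le) ht).trans ?_
  rw [← ENNReal.add_halves ε]
  refine add_le_add hsε (le_trans ?_ hs₀.1)
  exact mul_le_mul_right (lintegral_mono_set (Ioi_subset_Ioi hs.le)) _

/-- `∂_x u` is square integrable in time with values in `H³`. -/
theorem memLp_bessel_deriv (S : SmoothSol α β γ δ N K ψ) :
    (∀ᵐ t ∂volume.restrict (Ioi 0),
      wE univ (fun ξ => ‖besselSym ξ ^ 3 * dsym ξ‖ ^ 2) (ψ t) ≠ ⊤) ∧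
    MemLp (fun t => mulTo (fun ξ => besselSym ξ ^ 3 * dsym ξ) (ψ t)) 2
      (volume.restrict (Ioi (0 : ℝ))) := by
  have := continuous_besselSym
  have := continuous_dsym
  refine memLp_mulTo (by fun_prop) (S.sol 0).cont ?_
  refine lintegral_wE_ne_top_of_le (C := 4) (by norm_num) (fun ξ => ?_)
    S.lintegral_sq_octic_ne_top
  rw [norm_mul, mul_pow, norm_dsym_sq, norm_pow, ← pow_mul, mul_comm 3 2, pow_mul,
    norm_besselSym_sq]
  have h8 : wav ξ ^ 8 = wav ξ ^ 2 * (wav ξ ^ 2) ^ 3 := by ring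
  rw [h8]
  have hx : 0 ≤ wav ξ ^ 2 := sq_nonneg _
  generalize wav ξ ^ 2 = x at hx
  nlinarith [mul_nonneg hx (mul_nonneg (add_nonneg zero_le_one hx) (sq_nonneg (1 - x)))]

/-- The linear part of `∂_t u` is square integrable in time with values in `H²`. -/
theorem memLp_bessel_lin (S : SmoothSol α β γ δ N K ψ) :
    (∀ᵐ t ∂volume.restrict (Ioi 0),
      wE univ (fun ξ => ‖besselSym ξ ^ 2 * linSym α β γ δ ξ‖ ^ 2) (ψ t) ≠ ⊤) ∧
    MemLp (fun t => mulTo (fun ξ => besselSym ξ ^ 2 * linSym α β γ δ ξ) (ψ t)) 2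
      (volume.restrict (Ioi (0 : ℝ))) := by
  have := continuous_besselSym
  have := continuous_linSym (β := β) (γ := γ) (δ := δ) S.alpha_pos
  obtain ⟨C, hC0, hC⟩ := norm_linSym_sq_le (δ := δ) S.alpha_pos S.beta_pos S.gamma_pos
  refine memLp_mulTo (by fun_prop) (S.sol 0).cont ?_
  refine lintegral_wE_ne_top_of_le (C := 4 * C) (by positivity) (fun ξ => ?_)
    S.lintegral_sq_octic_ne_top
  rw [norm_mul, mul_pow, norm_pow, ← pow_mul, mul_comm 2 2, pow_mul, norm_besselSym_sq]
  refine (mul_le_mul_of_nonneg_left (hC ξ) (by positivity)).trans ?_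
  have h8 : wav ξ ^ 8 = (wav ξ ^ 2) ^ 4 := by ring
  have h4 : wav ξ ^ 4 = (wav ξ ^ 2) ^ 2 := by ring
  rw [h8, h4]
  have hx : 0 ≤ wav ξ ^ 2 := sq_nonneg _
  generalize wav ξ ^ 2 = x at hx
  have key : (1 + x) ^ 2 * x ^ 2 ≤ 4 * (x + x ^ 4) := by
    nlinarith [mul_nonneg hx (sq_nonneg (1 - x)), mul_nonneg hx (sq_nonneg (x - 1)),
      sq_nonneg (x ^ 2 - x), mul_nonneg hx (mul_nonneg hx hx), mul_nonneg hx
      (mul_nonneg (add_nonneg zero_le_one hx) (sq_nonneg (1 - x)))]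
  nlinarith [mul_le_mul_of_nonneg_left key hC0]

/-- The flux part of `∂_t u` is square integrable in time with values in `H²`. -/
theorem memLp_bessel_flux (S : SmoothSol α β γ δ N K ψ) :
    (∀ᵐ t ∂volume.restrict (Ioi 0),
      wE univ (fun ξ => ‖besselSym ξ ^ 2 * fluxSym α ξ‖ ^ 2) (N (ψ t)) ≠ ⊤) ∧
    MemLp (fun t => mulTo (fun ξ => besselSym ξ ^ 2 * fluxSym α ξ) (N (ψ t))) 2
      (volume.restrict (Ioi (0 : ℝ))) := by
  have hα := S.alpha_pos
  have := continuous_besselSym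
  have := continuous_fluxSym hα
  refine memLp_mulTo (by fun_prop) (S.sol 0).cont_forcing ?_
  refine lintegral_wE_ne_top_of_le (C := (1 + 1 / α) ^ 2) (by positivity) (fun ξ => ?_)
    S.flux_ne_top
  rw [norm_mul, mul_pow, norm_pow, ← pow_mul, mul_comm 2 2, pow_mul, norm_besselSym_sq,
    norm_fluxSym_sq hα]
  have hb := bbm_pos hα ξ
  rw [← mul_div_assoc, div_le_iff₀ (by positivity)]
  have h1 : 1 + wav ξ ^ 2 ≤ (1 + 1 / α) * (1 + α * wav ξ ^ 2) := by
    have e : (1 + 1 / α) * (1 + α * wav ξ ^ 2) = 1 + wav ξ ^ 2 + (1 / α + α * wav ξ ^ 2) := by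
      field_simp
      ring
    have : 0 ≤ 1 / α + α * wav ξ ^ 2 := by positivity
    linarith
  calc (1 + wav ξ ^ 2) ^ 2 * wav ξ ^ 2
      ≤ ((1 + 1 / α) * (1 + α * wav ξ ^ 2)) ^ 2 * wav ξ ^ 2 := by gcongr
    _ = _ := by ring

end SmoothSol

end Regularity

end

/-! ### The time derivative -/

noncomputable section

theorem integrable_test_smul {E : Type*} [NormedAddCommGroup E] [NormedSpace ℝ E] {s : Set ℝ}
    {g : ℝ → E} (hg : LocallyIntegrableOn g s) {η : ℝ → ℝ} (hη : Continuous η)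
    (hc : HasCompactSupport η) (hs : tsupport η ⊆ s) : Integrable fun x => η x • g x := by
  have h1 : IntegrableOn g (tsupport η) := hg.integrableOn_compact_subset hs hc
  have h2 : IntegrableOn (fun x => η x • g x) (tsupport η) :=
    h1.continuousOn_smul hη.continuousOn hc
  refine (integrableOn_iff_integrable_of_support_subset fun x hx => ?_).1 h2
  refine subset_tsupport η fun h => hx ?_
  simp only [h, zero_smul]

/-- Bounded linear maps commute with weak derivatives. -/
theorem IsWeakDerivOn.map {E F : Type*} [NormedAddCommGroup E] [NormedSpace ℝ E]
    [NormedAddCommGroup F] [NormedSpace ℝ F] [CompleteSpace E] [CompleteSpace F] {s : Set ℝ}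
    {g h : ℝ → E} (H : IsWeakDerivOn s g h) (L : E →L[ℝ] F) :
    IsWeakDerivOn s (fun x => L (g x)) (fun x => L (h x)) := by
  refine ⟨fun x hx => ?_, fun x hx => ?_, fun η hη hc hs => ?_⟩
  · obtain ⟨U, hU, hi⟩ := H.1 x hx
    exact ⟨U, hU, L.integrable_comp hi⟩
  · obtain ⟨U, hU, hi⟩ := H.2.1 x hx
    exact ⟨U, hU, L.integrable_comp hi⟩
  · have h1 := integrable_test_smul H.1 (hη.continuous_deriv (by simp)) hc.deriv
      ((tsupport_deriv_subset).trans hs)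
    have h2 := integrable_test_smul H.2.1 hη.continuous hc hs
    simp_rw [← map_smul]
    rw [L.integral_comp_comm h1, L.integral_comp_comm h2, H.2.2 η hη hc hs, map_neg]

/-- The integrated, frequency-windowed equation gives the weak derivative in time. -/
theorem isWeakDerivOn_of_fourierSol {m σ : ℝ → ℂ} {ψ G r : ℝ → CLTwo}
    (h : ∀ T, FourierSol m σ T ψ G) (hr : MemLp r 2 (volume.restrict (Ioi (0 : ℝ))))
    (hrw : ∀ᵐ t ∂volume.restrict (Ioi (0 : ℝ)), ∀ B, Window B →
      win B 1 (r t) = -(win B m (ψ t)) - win B σ (G t)) :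
    IsWeakDerivOn (Ioi 0) ψ r := by
  have c1 := (h 0).cont
  have c2 := (h 0).cont_forcing
  have hg1 : LocallyIntegrableOn ψ (Ioi 0) := c1.locallyIntegrable.locallyIntegrableOn _
  have hg2 : LocallyIntegrableOn r (Ioi 0) :=
    locallyIntegrableOn_of_locallyIntegrable_restrict (hr.locallyIntegrable (by norm_num))
  refine ⟨hg1, hg2, fun η hη hc hs => ?_⟩
  have i1 := integrable_test_smul hg1 (hη.continuous_deriv (by simp)) hc.deriv
    ((tsupport_deriv_subset).trans hs)
  have i2 := integrable_test_smul hg2 hη.continuous hc hs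
  refine eq_neg_of_add_eq_zero_left (eq_of_forall_win_eq fun B hB => ?_)
  set L : CLTwo →L[ℝ] CLTwo := (win B 1).restrictScalars ℝ with hL
  set g : ℝ → CLTwo := fun t => -(win B m (ψ t)) - win B σ (G t) with hg
  have hgc : Continuous g := by fun_prop
  -- the windowed solution agrees on `[0, ∞)` with a curve differentiable on the whole line
  set Y : ℝ → CLTwo := fun t => win B 1 (ψ 0) + ∫ x in (0 : ℝ)..t, g x with hY
  have hYd : ∀ t, HasDerivAt Y (g t) t := fun t =>
    (intervalIntegral.integral_hasDerivAt_right (hgc.intervalIntegrable _ _)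
      (hgc.stronglyMeasurableAtFilter _ _) hgc.continuousAt).const_add _
  have hYc : Continuous Y := continuous_iff_continuousAt.2 fun t => (hYd t).continuousAt
  have hηd : ∀ t, HasDerivAt η (deriv η t) t := fun t =>
    ((hη.differentiable (by simp)) t).hasDerivAt
  have hηdc : Continuous (deriv η) := hη.continuous_deriv (by simp)
  have hprod : ∫ t, (η t • g t + deriv η t • Y t) = 0 := by
    refine integral_eq_zero_of_hasDerivAt_of_integrable (fun t => (hηd t).smul (hYd t)) ?_ ?_
    · exact ((hη.continuous.smul hgc).integrable_of_hasCompactSupport hc.smul_right).add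
        ((hηdc.smul hYc).integrable_of_hasCompactSupport hc.deriv.smul_right)
    · exact (hη.continuous.smul hYc).integrable_of_hasCompactSupport hc.smul_right
  have hη0 : ∀ t, t ∉ Ioi (0 : ℝ) → η t = 0 := fun t ht =>
    image_eq_zero_of_notMem_tsupport fun hmem => ht (hs hmem)
  have hη0' : ∀ t, t ∉ Ioi (0 : ℝ) → deriv η t = 0 := fun t ht =>
    image_eq_zero_of_notMem_tsupport fun hmem => ht (hs (tsupport_deriv_subset hmem))
  have e1 : L (∫ t, deriv η t • ψ t) = ∫ t, deriv η t • Y t := by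
    rw [← L.integral_comp_comm i1]
    refine integral_congr_ae (Eventually.of_forall fun t => ?_)
    by_cases ht : t ∈ Ioi (0 : ℝ)
    · simp only [map_smul]
      congr 1
      exact (h t).eq B hB t ⟨(mem_Ioi.1 ht).le, le_rfl⟩
    · simp [hη0' t ht]
  have e2 : L (∫ t, η t • r t) = ∫ t, η t • g t := by
    rw [← L.integral_comp_comm i2]
    refine integral_congr_ae ?_
    filter_upwards [(ae_restrict_iff' measurableSet_Ioi).1 hrw] with t ht
    by_cases ht0 : t ∈ Ioi (0 : ℝ)
    · simp only [map_smul]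
      congr 1
      exact ht ht0 B hB
    · simp [hη0 t ht0]
  have j1 : Integrable fun t => η t • g t :=
    (hη.continuous.smul hgc).integrable_of_hasCompactSupport hc.smul_right
  have j2 : Integrable fun t => deriv η t • Y t :=
    (hηdc.smul hYc).integrable_of_hasCompactSupport hc.deriv.smul_right
  rw [integral_add j1 j2] at hprod
  rw [map_zero]
  change L _ = 0
  rw [map_add, e1, e2, add_comm]
  exact hprod

/-- The symbols `(i k)^j / (1 + i k)^n`, bounded by `1` for `j ≤ n`.  They parametrize `H^n` by
`L²`, and give the derivatives of orders `j ≤ n`. -/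
def sobSym (n j : ℕ) (ξ : ℝ) : ℂ := dsym ξ ^ j / besselSym ξ ^ n

theorem norm_dsym_le (ξ : ℝ) : ‖dsym ξ‖ ≤ ‖besselSym ξ‖ := by
  refine le_of_sq_le_sq ?_ (norm_nonneg _)
  rw [norm_dsym_sq, norm_besselSym_sq]
  linarith

theorem one_le_norm_besselSym (ξ : ℝ) : 1 ≤ ‖besselSym ξ‖ := by
  refine le_of_sq_le_sq ?_ (norm_nonneg _)
  rw [norm_besselSym_sq]
  nlinarith [sq_nonneg (wav ξ)]

theorem continuous_sobSym (n j : ℕ) : Continuous (sobSym n j) :=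
  (continuous_dsym.pow j).div (continuous_besselSym.pow n) fun ξ =>
    pow_ne_zero n (besselSym_ne_zero ξ)

theorem bddSymbol_sobSym {n j : ℕ} (hj : j ≤ n) : BddSymbol (sobSym n j) := by
  refine ⟨(continuous_sobSym n j).measurable, 1, fun ξ => ?_⟩
  have h1 := one_le_norm_besselSym ξ
  rw [sobSym, norm_div, norm_pow, norm_pow, div_le_one (by positivity)]
  exact (pow_le_pow_left₀ (norm_nonneg _) (norm_dsym_le ξ) j).trans (pow_le_pow_right₀ h1 hj)

/-- A rate given by the equation almost everywhere satisfies the windowed equation. -/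
theorem win_one_eq_of_ae {m σ : ℝ → ℂ} (hm : Continuous m) (hσ : Continuous σ) {r ψ G : CLTwo}
    (h : r =ᵐ[volume] fun ξ => -(m ξ * ψ ξ) - σ ξ * G ξ) {B : Set ℝ} (hB : Window B) :
    win B 1 r = -(win B m ψ) - win B σ G := by
  refine Lp.ext ?_
  filter_upwards [h, coeFn_win hB continuous_one r, ae_rate hB hm hσ ψ G, coeFn_win hB hm ψ,
    coeFn_win hB hσ G, Lp.coeFn_sub (-(win B m ψ)) (win B σ G), Lp.coeFn_neg (win B m ψ)]
    with ξ h1 h2 h4 h5 h6 h7 h8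
  by_cases hξ : ξ ∈ B
  · rw [h4 hξ, h2, h1, indicator_of_mem hξ, Pi.one_apply, one_mul]
  · rw [h2, h7, Pi.sub_apply, h8, Pi.neg_apply, h5, h6]
    simp [hξ]

section Rate

variable {α β γ δ : ℝ} {N : CLTwo → CLTwo} {K : NNReal} {ψ : ℝ → CLTwo}

/-- The curve `(1 + ∂_x)² ∂_t u`, on the Fourier side. -/
def rateCurve (α β γ δ : ℝ) (N : CLTwo → CLTwo) (ψ : ℝ → CLTwo) (t : ℝ) : CLTwo :=
  -(mulTo (fun ξ => besselSym ξ ^ 2 * linSym α β γ δ ξ) (ψ t))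
    - mulTo (fun ξ => besselSym ξ ^ 2 * fluxSym α ξ) (N (ψ t))

theorem SmoothSol.memLp_rateCurve (S : SmoothSol α β γ δ N K ψ) :
    MemLp (rateCurve α β γ δ N ψ) 2 (volume.restrict (Ioi (0 : ℝ))) :=
  S.memLp_bessel_lin.2.neg.sub S.memLp_bessel_flux.2

/-- Off a null set of times, `∂_t u` is given by the equation. -/
theorem SmoothSol.coeFn_rateCurve (S : SmoothSol α β γ δ N K ψ) :
    ∀ᵐ t ∂volume.restrict (Ioi (0 : ℝ)), rateCurve α β γ δ N ψ t =ᵐ[volume] fun ξ =>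
      besselSym ξ ^ 2 * (-(linSym α β γ δ ξ * ψ t ξ) - fluxSym α ξ * N (ψ t) ξ) := by
  have c1 := continuous_besselSym
  have c2 := continuous_linSym (β := β) (γ := γ) (δ := δ) S.alpha_pos
  have c3 := continuous_fluxSym S.alpha_pos
  filter_upwards [S.memLp_bessel_lin.1, S.memLp_bessel_flux.1] with t h1 h2
  rw [rateCurve]
  set A := mulTo (fun ξ => besselSym ξ ^ 2 * linSym α β γ δ ξ) (ψ t)
  set A' := mulTo (fun ξ => besselSym ξ ^ 2 * fluxSym α ξ) (N (ψ t))
  filter_upwards [coeFn_mulTo (by fun_prop) h1, coeFn_mulTo (by fun_prop) h2,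
    Lp.coeFn_sub (-A) A', Lp.coeFn_neg A] with ξ e1 e2 e3 e4
  rw [e3, Pi.sub_apply, e4, Pi.neg_apply, e1, e2]
  ring

theorem SmoothSol.isWeakDerivOn_rate (S : SmoothSol α β γ δ N K ψ) :
    IsWeakDerivOn (Ioi 0) ψ fun t => mulOp (sobSym 2 0) (rateCurve α β γ δ N ψ t) := by
  have c2 := continuous_linSym (β := β) (γ := γ) (δ := δ) S.alpha_pos
  have c3 := continuous_fluxSym S.alpha_pos
  refine isWeakDerivOn_of_fourierSol S.sol ?_ ?_
  · exact (mulOp (sobSym 2 0)).comp_memLp' S.memLp_rateCurve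
  · filter_upwards [S.coeFn_rateCurve] with t ht B hB
    refine win_one_eq_of_ae c2 c3 ?_ hB
    filter_upwards [ht, coeFn_mulOp (bddSymbol_sobSym (Nat.zero_le 2))
      (rateCurve α β γ δ N ψ t)] with ξ h1 h3
    have hb := besselSym_ne_zero ξ
    rw [h3, h1, sobSym, pow_zero]
    field_simp

end Rate

end

/-! ### Passage between functions and their Fourier representation -/

noncomputable section

open FourierTransform SchwartzMap

/-- The complex Fourier representation of a real `L²` function: `v = 𝓕 (toFreq v)`. -/
def toFreq : LTwo →L[ℝ] CLTwo :=
  ((Lp.fourierTransformₗᵢ ℝ ℂ).symm.toContinuousLinearEquiv : CLTwo →L[ℂ] CLTwo).restrictScalars ℝ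
    ∘L Complex.ofRealCLM.compLpL 2 volume

/-- The real part of the function `𝓕 ψ` represented by `ψ`. -/
def ofFreq : CLTwo →L[ℝ] LTwo :=
  Complex.reCLM.compLpL 2 volume ∘L
    ((Lp.fourierTransformₗᵢ ℝ ℂ).toContinuousLinearEquiv : CLTwo →L[ℂ] CLTwo).restrictScalars ℝ

theorem coeFn_ofFreq (ψ : CLTwo) : ofFreq ψ =ᵐ[volume] fun x => ((𝓕 ψ : CLTwo) x).re :=
  Complex.reCLM.coeFn_compLpL (𝓕 ψ : CLTwo)

theorem fourier_toFreq (v : LTwo) :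
    (𝓕 (toFreq v) : CLTwo) = Complex.ofRealCLM.compLpL 2 volume v :=
  (Lp.fourierTransformₗᵢ ℝ ℂ).apply_symm_apply _

theorem coeFn_fourier_toFreq (v : LTwo) :
    (𝓕 (toFreq v) : CLTwo) =ᵐ[volume] fun x => (v x : ℂ) := by
  rw [fourier_toFreq]
  exact Complex.ofRealCLM.coeFn_compLpL v

theorem ofFreq_toFreq (v : LTwo) : ofFreq (toFreq v) = v := by
  refine Lp.ext ?_
  filter_upwards [coeFn_ofFreq (toFreq v), coeFn_fourier_toFreq v] with x h1 h2
  rw [h1, h2, Complex.ofReal_re]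

theorem norm_toFreq (v : LTwo) : ‖toFreq v‖ = ‖v‖ := by
  rw [← Lp.norm_fourier_eq, Lp.norm_def, Lp.norm_def]
  congr 1
  refine eLpNorm_congr_norm_ae ?_
  filter_upwards [coeFn_fourier_toFreq v] with x h
  rw [h, Complex.norm_real]

theorem norm_ofFreq_le (ψ : CLTwo) : ‖ofFreq ψ‖ ≤ ‖ψ‖ := by
  rw [← Lp.norm_fourier_eq ψ]
  refine Lp.norm_le_norm_of_ae_le ?_
  filter_upwards [coeFn_ofFreq ψ] with x h
  rw [h, Real.norm_eq_abs]
  exact Complex.abs_re_le_norm _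

/-- The `L²` Fourier transform is moved onto a test function. -/
theorem integral_mul_fourier (η : 𝓢(ℝ, ℂ)) (ψ : CLTwo) :
    ∫ x, η x * (𝓕 ψ : CLTwo) x = ∫ ξ, (𝓕 η) ξ * ψ ξ := by
  have h := congrArg (fun T : TemperedDistribution ℝ ℂ => T η)
    (Lp.fourier_toTemperedDistribution_eq ψ)
  simp only [TemperedDistribution.fourier_apply, Lp.toTemperedDistribution_apply] at h
  exact h.symm

/-- On integrable `L²` functions the `L²` Fourier transform is given by the Fourier integral. -/
theorem coeFn_fourier_of_integrable {ψ : CLTwo} (h : Integrable (ψ : ℝ → ℂ)) :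
    (𝓕 ψ : CLTwo) =ᵐ[volume] 𝓕 (ψ : ℝ → ℂ) := by
  have hcont : Continuous (𝓕 (ψ : ℝ → ℂ)) :=
    VectorFourier.fourierIntegral_continuous Real.continuous_fourierChar
      (by exact continuous_inner) h
  refine ae_eq_of_integral_contDiff_smul_eq
    ((Lp.memLp (𝓕 ψ : CLTwo)).locallyIntegrable (by norm_num)) hcont.locallyIntegrable
    fun g hg hc => ?_
  have hgc : HasCompactSupport fun x => (g x : ℂ) := hc.comp_left (g := fun r : ℝ => (r : ℂ)) rfl
  set η : 𝓢(ℝ, ℂ) := hgc.toSchwartzMap (Complex.ofRealCLM.contDiff.comp hg) with hη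
  have e1 : ∫ x, g x • (𝓕 ψ : CLTwo) x = ∫ x, η x * (𝓕 ψ : CLTwo) x := rfl
  have e2 : ∫ x, g x • (𝓕 (ψ : ℝ → ℂ)) x = ∫ x, η x * (𝓕 (ψ : ℝ → ℂ)) x := rfl
  rw [e1, e2, integral_mul_fourier]
  have := VectorFourier.integral_fourierIntegral_smul_eq_flip (L := innerₗ ℝ)
    (μ := volume) (ν := volume) (f := (η : ℝ → ℂ)) (g := (ψ : ℝ → ℂ)) Real.continuous_fourierChar
    (by exact continuous_inner) η.integrable h
  simp only [flip_innerₗ] at this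
  exact this

theorem fourier_derivCLM (η : 𝓢(ℝ, ℂ)) (ξ : ℝ) :
    (𝓕 (derivCLM ℂ ℂ η)) ξ = -(dsym ξ * (𝓕 η) ξ) := by
  have h : (𝓕 (derivCLM ℂ ℂ η)) ξ = 𝓕 (deriv (η : ℝ → ℂ)) ξ := rfl
  rw [h, Real.fourier_deriv η.integrable η.differentiable (derivCLM ℂ ℂ η).integrable]
  have h2 : 𝓕 (η : ℝ → ℂ) ξ = (𝓕 η) ξ := rfl
  simp only [h2, smul_eq_mul, dsym, wav]
  push_cast
  ring

/-- A product with `i k` on the Fourier side is a weak derivative. -/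
theorem isWeakDerivOn_ofFreq {ψ θ : CLTwo} (h : θ =ᵐ[volume] fun ξ => dsym ξ * ψ ξ) :
    IsWeakDerivOn univ (ofFreq ψ : ℝ → ℝ) (ofFreq θ) := by
  refine ⟨(LTwo.locallyIntegrable _).locallyIntegrableOn _,
    (LTwo.locallyIntegrable _).locallyIntegrableOn _, fun g hg hc _ => ?_⟩
  have hgc : HasCompactSupport fun x => (g x : ℂ) := hc.comp_left (g := fun r : ℝ => (r : ℂ)) rfl
  set η : 𝓢(ℝ, ℂ) := hgc.toSchwartzMap (Complex.ofRealCLM.contDiff.comp hg) with hη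
  have hre : ∀ (θ : ℝ → ℝ), Continuous θ → HasCompactSupport θ → ∀ χ : CLTwo,
      ∫ x, θ x • ofFreq χ x = (∫ x, (θ x : ℂ) * (𝓕 χ : CLTwo) x).re := by
    intro θ hθ hθc χ
    have hi : Integrable fun x => (θ x : ℂ) * (𝓕 χ : CLTwo) x := by
      have := ((Lp.memLp (𝓕 χ : CLTwo)).locallyIntegrable
        (by norm_num)).integrable_smul_left_of_hasCompactSupport hθ hθc
      exact this
    refine Eq.trans ?_ (integral_re (𝕜 := ℂ) hi)
    refine integral_congr_ae ?_
    filter_upwards [coeFn_ofFreq χ] with x hx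
    rw [hx]
    exact (Complex.re_ofReal_mul _ _).symm
  have hd : ∀ x, ((deriv g x : ℝ) : ℂ) = derivCLM ℂ ℂ η x := by
    intro x
    have h1 : HasDerivAt (fun x => (g x : ℂ)) ((deriv g x : ℝ) : ℂ) x :=
      ((hg.differentiable (by simp)) x).hasDerivAt.ofReal_comp
    exact h1.deriv.symm
  rw [hre _ (hg.continuous_deriv (by simp)) hc.deriv, hre _ hg.continuous hc]
  simp_rw [hd]
  have h2 : ∫ x, (g x : ℂ) * (𝓕 θ : CLTwo) x = ∫ x, η x * (𝓕 θ : CLTwo) x := rfl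
  rw [h2, integral_mul_fourier, integral_mul_fourier, ← Complex.neg_re, ← integral_neg]
  congr 1
  refine integral_congr_ae ?_
  filter_upwards [h] with ξ hξ
  rw [fourier_derivCLM, hξ]
  ring

/-- The weak derivative may be tested against smooth functions that are only square integrable
together with their derivative. -/
theorem IsWeakDerivOn.integral_deriv_mul {g h : LTwo}
    (H : IsWeakDerivOn univ (g : ℝ → ℝ) h) {η : ℝ → ℝ} (hη : ContDiff ℝ ∞ η)
    (h0 : MemLp η 2 volume) (h1 : MemLp (deriv η) 2 volume) :
    ∫ x, deriv η x * g x = -∫ x, η x * h x := by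
  set χ : ContDiffBump (0 : ℝ) := ⟨1, 2, one_pos, one_lt_two⟩ with hχ
  have hχd : ContDiff ℝ ∞ (χ : ℝ → ℝ) := χ.contDiff
  obtain ⟨C, hC⟩ := (χ.hasCompactSupport.deriv).exists_bound_of_continuous
    (hχd.continuous_deriv (by simp))
  -- smooth cutoffs tending to `1`
  set c : ℕ → ℝ → ℝ := fun n x => χ ((n + 1 : ℝ)⁻¹ * x) with hc
  have hcs : ∀ n, ContDiff ℝ ∞ (c n) := fun n => hχd.comp (contDiff_const.mul contDiff_id)
  have hcd : ∀ n x, HasDerivAt (c n) ((n + 1 : ℝ)⁻¹ * deriv χ ((n + 1 : ℝ)⁻¹ * x)) x := by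
    intro n x
    have e1 : HasDerivAt (fun x : ℝ => (n + 1 : ℝ)⁻¹ * x) ((n + 1 : ℝ)⁻¹) x := by
      simpa using (hasDerivAt_id x).const_mul ((n + 1 : ℝ)⁻¹)
    have e2 : HasDerivAt (χ : ℝ → ℝ) (deriv χ ((n + 1 : ℝ)⁻¹ * x)) ((n + 1 : ℝ)⁻¹ * x) :=
      ((hχd.differentiable (by simp)) _).hasDerivAt
    have := e2.comp x e1
    rwa [mul_comm] at this
  have hcc : ∀ n, HasCompactSupport (c n) := by
    intro n
    have hne : ((n + 1 : ℝ)⁻¹) ≠ 0 := by positivity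
    exact χ.hasCompactSupport.comp_homeomorph (Homeomorph.mulLeft₀ _ hne)
  have hcl : ∀ x, Tendsto (fun n : ℕ => (n + 1 : ℝ)⁻¹ * x) atTop (𝓝 0) := by
    intro x
    have := tendsto_one_div_add_atTop_nhds_zero_nat (𝕜 := ℝ)
    simpa using this.mul_const x
  have hηd : ∀ x, HasDerivAt η (deriv η x) x := fun x =>
    ((hη.differentiable (by simp)) x).hasDerivAt
  have key : ∀ n : ℕ, ∫ x, ((n + 1 : ℝ)⁻¹ * deriv χ ((n + 1 : ℝ)⁻¹ * x) * η x
      + c n x * deriv η x) * g x = -∫ x, c n x * η x * h x := by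
    intro n
    have := H.2.2 (fun x => c n x * η x) ((hcs n).mul hη) ((hcc n).mul_right) (subset_univ _)
    simp only [smul_eq_mul] at this
    rw [← this]
    refine integral_congr_ae (Eventually.of_forall fun x => ?_)
    simp only
    rw [((hcd n x).fun_mul (hηd x)).deriv]
  have ig0 : Integrable fun x => η x * g x := h0.integrable_mul (Lp.memLp g)
  have ig1 : Integrable fun x => deriv η x * g x := h1.integrable_mul (Lp.memLp g)
  have ih0 : Integrable fun x => η x * h x := h0.integrable_mul (Lp.memLp h)
  have hc1 : ∀ n x, |c n x| ≤ 1 := fun n x => abs_le.2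
    ⟨by linarith [χ.nonneg' ((n + 1 : ℝ)⁻¹ * x)], χ.le_one⟩
  have hclim : ∀ x, Tendsto (fun n => c n x) atTop (𝓝 1) := by
    intro x
    have := (hχd.continuous.tendsto 0).comp (hcl x)
    rwa [χ.one_of_mem_closedBall (by simp [hχ])] at this
  have hχdc : Continuous (deriv (χ : ℝ → ℝ)) := hχd.continuous_deriv (by simp)
  have L1 : Tendsto (fun n : ℕ => ∫ x, ((n + 1 : ℝ)⁻¹ * deriv χ ((n + 1 : ℝ)⁻¹ * x) * η x
      + c n x * deriv η x) * g x) atTop (𝓝 (∫ x, deriv η x * g x)) := by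
    refine tendsto_integral_of_dominated_convergence
      (fun x => C * |η x * g x| + |deriv η x * g x|) (fun n => ?_)
      ((ig0.abs.const_mul C).add ig1.abs) (fun n => Eventually.of_forall fun x => ?_)
      (Eventually.of_forall fun x => ?_)
    · refine AEStronglyMeasurable.mul (Continuous.aestronglyMeasurable ?_)
        (Lp.aestronglyMeasurable g)
      have q1 := hη.continuous
      have q2 := hη.continuous_deriv (n := ∞) (by simp)
      have q3 := (hcs n).continuous
      fun_prop
    · rw [add_mul, Real.norm_eq_abs]
      refine (abs_add_le _ _).trans (add_le_add ?_ ?_)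
      · rw [mul_assoc, abs_mul, abs_mul]
        have e1 : |((n + 1 : ℝ)⁻¹)| ≤ 1 := by
          rw [abs_of_pos (by positivity)]
          exact inv_le_one_of_one_le₀ (by linarith [n.cast_nonneg (α := ℝ)])
        have e2 : |deriv χ ((n + 1 : ℝ)⁻¹ * x)| ≤ C := hC _
        have e3 := mul_le_mul e1 e2 (abs_nonneg _) zero_le_one
        rw [one_mul] at e3
        exact mul_le_mul_of_nonneg_right e3 (abs_nonneg _)
      · rw [mul_assoc, abs_mul]
        simpa using mul_le_mul_of_nonneg_right (hc1 n x) (abs_nonneg (deriv η x * g x))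
    · have e1 : Tendsto (fun n : ℕ => (n + 1 : ℝ)⁻¹ * deriv χ ((n + 1 : ℝ)⁻¹ * x) * η x) atTop
          (𝓝 0) := by
        have a1 := tendsto_one_div_add_atTop_nhds_zero_nat (𝕜 := ℝ)
        have a2 := (hχdc.tendsto 0).comp (hcl x)
        have := (a1.mul a2).mul_const (η x)
        simpa using this
      have := (e1.add ((hclim x).mul_const (deriv η x))).mul_const (g x)
      simpa using this
  have L2 : Tendsto (fun n : ℕ => -∫ x, c n x * η x * h x) atTop (𝓝 (-∫ x, η x * h x)) := by
    refine Tendsto.neg (tendsto_integral_of_dominated_convergence (fun x => |η x * h x|)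
      (fun n => ?_) ih0.abs (fun n => Eventually.of_forall fun x => ?_)
      (Eventually.of_forall fun x => ?_))
    · exact ((hcs n).continuous.mul hη.continuous).aestronglyMeasurable.mul
        (Lp.aestronglyMeasurable h)
    · rw [mul_assoc, Real.norm_eq_abs, abs_mul]
      simpa using mul_le_mul_of_nonneg_right (hc1 n x) (abs_nonneg (η x * h x))
    · have := ((hclim x).mul_const (η x)).mul_const (h x)
      simpa using this
  exact tendsto_nhds_unique (L1.congr key) L2

/-- A weak derivative in `L²` is a product with `i k` on the Fourier side. -/
theorem IsWeakDerivOn.toFreq_ae {g h : LTwo} (H : IsWeakDerivOn univ (g : ℝ → ℝ) h) :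
    toFreq h =ᵐ[volume] fun ξ => dsym ξ * toFreq g ξ := by
  -- the inverse Fourier transform of a compactly supported function is a Schwartz function but
  -- not a compactly supported one, hence the wider class of test functions
  have hS : ∀ η : 𝓢(ℝ, ℂ), ∫ x, deriv η x * (g x : ℂ) = -∫ x, η x * (h x : ℂ) := by
    intro η
    have hηs : ContDiff ℝ ∞ η := η.smooth _
    have hηd : ∀ x, HasDerivAt η (deriv η x) x := η.hasDerivAt
    have m0 : MemLp η 2 volume := η.memLp 2
    have m1 : MemLp (deriv η) 2 volume := by
      have := (derivCLM ℂ ℂ η).memLp 2 volume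
      exact this
    have split : ∀ (θ : ℝ → ℂ), MemLp θ 2 volume → ∀ v : LTwo, ∫ x, θ x * (v x : ℂ)
        = ((∫ x, (θ x).re * v x : ℝ) : ℂ) + ((∫ x, (θ x).im * v x : ℝ) : ℂ) * Complex.I := by
      intro θ hθ v
      have i1 : Integrable fun x => (θ x).re * v x := hθ.re.integrable_mul (Lp.memLp v)
      have i2 : Integrable fun x => (θ x).im * v x := hθ.im.integrable_mul (Lp.memLp v)
      rw [← integral_complex_ofReal, ← integral_complex_ofReal, ← integral_mul_const,
        ← integral_add i1.ofReal (i2.ofReal.mul_const _)]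
      refine integral_congr_ae (Eventually.of_forall fun x => ?_)
      apply Complex.ext <;> simp
    have dre : deriv (fun x => (η x).re) = fun x => (deriv η x).re := by
      ext x
      exact (Complex.reCLM.hasFDerivAt.comp_hasDerivAt x (hηd x)).deriv
    have dim : deriv (fun x => (η x).im) = fun x => (deriv η x).im := by
      ext x
      exact (Complex.imCLM.hasFDerivAt.comp_hasDerivAt x (hηd x)).deriv
    have r1 := H.integral_deriv_mul (η := fun x => (η x).re) (Complex.reCLM.contDiff.comp hηs)
      m0.re (by rw [dre]; exact m1.re)
    have r2 := H.integral_deriv_mul (η := fun x => (η x).im) (Complex.imCLM.contDiff.comp hηs)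
      m0.im (by rw [dim]; exact m1.im)
    rw [dre] at r1
    rw [dim] at r2
    rw [split _ m1, split _ m0, r1, r2]
    push_cast
    ring
  have hl1 : LocallyIntegrable (toFreq h : ℝ → ℂ) :=
    (Lp.memLp (toFreq h)).locallyIntegrable (by norm_num)
  have hl2 : LocallyIntegrable fun ξ => dsym ξ * toFreq g ξ := by
    have := ((Lp.memLp (toFreq g)).locallyIntegrable (by norm_num))
    exact this.continuous_smul continuous_dsym
  refine ae_eq_of_integral_contDiff_smul_eq hl1 hl2 fun ρ hρ hc => ?_
  have hρc : HasCompactSupport fun x => (ρ x : ℂ) := hc.comp_left (g := fun r : ℝ => (r : ℂ)) rfl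
  set R : 𝓢(ℝ, ℂ) := hρc.toSchwartzMap (Complex.ofRealCLM.contDiff.comp hρ) with hR
  set η : 𝓢(ℝ, ℂ) := 𝓕⁻ R with hη
  have hFη : 𝓕 η = R := by rw [hη, fourier_fourierInv_eq]
  have a1 : ∫ x, η x * (h x : ℂ) = ∫ ξ, R ξ * toFreq h ξ := by
    rw [← hFη, ← integral_mul_fourier]
    refine integral_congr_ae ?_
    filter_upwards [coeFn_fourier_toFreq h] with x hx
    rw [hx]
  have a2 : ∫ x, deriv η x * (g x : ℂ) = ∫ ξ, -(dsym ξ * R ξ) * toFreq g ξ := by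
    have : ∫ x, deriv η x * (g x : ℂ) = ∫ x, derivCLM ℂ ℂ η x * (𝓕 (toFreq g) : CLTwo) x := by
      refine integral_congr_ae ?_
      filter_upwards [coeFn_fourier_toFreq g] with x hx
      rw [hx]
      rfl
    rw [this, integral_mul_fourier]
    refine integral_congr_ae (Eventually.of_forall fun ξ => ?_)
    simp only
    rw [fourier_derivCLM, hFη]
  have a3 := hS η
  rw [a1, a2] at a3
  have b1 : ∫ ξ, ρ ξ • toFreq h ξ = ∫ ξ, R ξ * toFreq h ξ := rfl
  have b2 : ∫ ξ, ρ ξ • (dsym ξ * toFreq g ξ) = -∫ ξ, -(dsym ξ * R ξ) * toFreq g ξ := by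
    rw [← integral_neg]
    refine integral_congr_ae (Eventually.of_forall fun ξ => ?_)
    change R ξ * (dsym ξ * toFreq g ξ) = _
    ring
  rw [b1, b2, a3, neg_neg]

/-- The parametrization of `H^n(ℝ)` by `L²`: `χ` represents the real part of
`𝓕 ((1 + i k)^{-n} χ)`. -/
def sobolevOfFreq (n : ℕ) : CLTwo →L[ℝ] SobolevSpace n :=
  ContinuousLinearMap.codRestrict
    (((PiLp.continuousLinearEquiv 2 ℝ fun _ : Fin (n + 1) => LTwo).symm :
      (Fin (n + 1) → LTwo) →L[ℝ] PiLp 2 fun _ : Fin (n + 1) => LTwo) ∘L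
      ContinuousLinearMap.pi fun j : Fin (n + 1) =>
        ofFreq ∘L (mulOp (sobSym n j)).restrictScalars ℝ)
    (SobolevSpace n) (fun χ j => by
      refine isWeakDerivOn_ofFreq ?_
      filter_upwards [coeFn_mulOp (bddSymbol_sobSym (n := n) (j := j.succ) (Nat.succ_le_of_lt j.2)) χ,
        coeFn_mulOp (bddSymbol_sobSym (n := n) (j := j.castSucc) j.2.le) χ]
        with ξ h1 h2
      refine h1.trans ?_
      refine Eq.trans ?_ (congrArg (dsym ξ * ·) h2.symm)
      simp only [sobSym, Fin.val_succ, Fin.val_castSucc]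
      ring)

theorem wderiv_sobolevOfFreq (n : ℕ) (χ : CLTwo) (j : Fin (n + 1)) :
    wderiv (sobolevOfFreq n χ) j = ofFreq (mulOp (sobSym n j) χ) := rfl

end

/-! ### Weak derivatives in time of continuous curves -/

noncomputable section

theorem deriv_smoothTransition_eq_zero {y : ℝ} (hy : y ∉ Icc (0 : ℝ) 1) :
    deriv Real.smoothTransition y = 0 := by
  rw [mem_Icc, not_and_or, not_le, not_le] at hy
  rcases hy with hy | hy
  · have : Real.smoothTransition =ᶠ[𝓝 y] fun _ => 0 := by
      filter_upwards [gt_mem_nhds hy] with z hz using Real.smoothTransition.zero_of_nonpos hz.le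
    rw [this.deriv_eq, deriv_const]
  · have : Real.smoothTransition =ᶠ[𝓝 y] fun _ => 1 := by
      filter_upwards [lt_mem_nhds hy] with z hz using Real.smoothTransition.one_of_one_le hz.le
    rw [this.deriv_eq, deriv_const]

theorem continuous_deriv_smoothTransition : Continuous (deriv Real.smoothTransition) :=
  (Real.smoothTransition.contDiff (n := (⊤ : ℕ∞))).continuous_deriv (by simp)

theorem hasCompactSupport_deriv_smoothTransition :
    HasCompactSupport (deriv Real.smoothTransition) :=
  HasCompactSupport.intro isCompact_Icc fun _ hy => deriv_smoothTransition_eq_zero hy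

theorem integral_deriv_smoothTransition : ∫ y, deriv Real.smoothTransition y = 1 := by
  have h := integral_of_hasDerivAt_of_tendsto (f := Real.smoothTransition) (m := 0) (n := 1)
    (fun y => ((Real.smoothTransition.contDiff (n := (⊤ : ℕ∞))).differentiable
      (by simp) y).hasDerivAt)
    (continuous_deriv_smoothTransition.integrable_of_hasCompactSupport
      hasCompactSupport_deriv_smoothTransition) ?_ ?_
  · simpa using h
  · refine tendsto_const_nhds.congr' ?_
    filter_upwards [eventually_le_atBot 0] with y hy
    exact (Real.smoothTransition.zero_of_nonpos hy).symm
  · refine tendsto_const_nhds.congr' ?_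
    filter_upwards [eventually_ge_atTop 1] with y hy
    exact (Real.smoothTransition.one_of_one_le hy).symm

section WeakDerivative

variable {E : Type*} [NormedAddCommGroup E] [NormedSpace ℝ E] [CompleteSpace E]

/-- The derivatives of the steep transitions `x ↦ S (n (x - a))` concentrate at `a`. -/
theorem tendsto_integral_steep_deriv {g : ℝ → E} (hg : ContinuousOn g (Ici 0)) {a : ℝ}
    (ha : 0 ≤ a) :
    Tendsto (fun n : ℕ => ∫ x, ((n + 1 : ℝ) * deriv Real.smoothTransition ((n + 1 : ℝ) * (x - a)))
      • g x) atTop (𝓝 (g a)) := by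
  have hS := continuous_deriv_smoothTransition
  have key : ∀ n : ℕ, ∫ x, ((n + 1 : ℝ) * deriv Real.smoothTransition ((n + 1 : ℝ) * (x - a)))
      • g x = ∫ y, deriv Real.smoothTransition y • g (a + (n + 1 : ℝ)⁻¹ * y) := by
    intro n
    have hn : (0 : ℝ) < n + 1 := by positivity
    set F : ℝ → E := fun y => deriv Real.smoothTransition y • g (a + (n + 1 : ℝ)⁻¹ * y) with hF
    have e1 : ∫ x, F ((n + 1 : ℝ) * (x - a)) = ∫ x, F ((n + 1 : ℝ) * x) :=
      integral_sub_right_eq_self (fun x => F ((n + 1 : ℝ) * x)) a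
    rw [Measure.integral_comp_mul_left, abs_of_pos (by positivity)] at e1
    have e2 : ∀ x, ((n + 1 : ℝ) * deriv Real.smoothTransition ((n + 1 : ℝ) * (x - a))) • g x
        = (n + 1 : ℝ) • F ((n + 1 : ℝ) * (x - a)) := by
      intro x
      simp only [hF]
      rw [smul_smul, inv_mul_cancel_left₀ hn.ne', add_sub_cancel]
    simp_rw [e2]
    rw [integral_smul, e1, smul_smul, mul_inv_cancel₀ hn.ne', one_smul]
  have hlim : Tendsto (fun n : ℕ => ∫ y, deriv Real.smoothTransition y
      • g (a + (n + 1 : ℝ)⁻¹ * y)) atTop (𝓝 (∫ y, deriv Real.smoothTransition y • g a)) := by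
    obtain ⟨M, hM⟩ := (isCompact_Icc (a := a) (b := a + 1)).exists_bound_of_continuousOn
      (hg.mono fun x hx => ha.trans hx.1)
    have hinv : ∀ n : ℕ, 0 < (n + 1 : ℝ)⁻¹ ∧ (n + 1 : ℝ)⁻¹ ≤ 1 := fun n =>
      ⟨by positivity, inv_le_one_of_one_le₀ (by linarith [n.cast_nonneg (α := ℝ)])⟩
    have hmem : ∀ (n : ℕ), ∀ y ∈ Icc (0 : ℝ) 1, a + (n + 1 : ℝ)⁻¹ * y ∈ Icc a (a + 1) := by
      intro n y hy
      obtain ⟨h1, h2⟩ := hinv n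
      exact ⟨by nlinarith [hy.1], by nlinarith [hy.1, hy.2]⟩
    refine tendsto_integral_of_dominated_convergence
      (fun y => ‖deriv Real.smoothTransition y‖ * M) (fun n => ?_)
      ((hS.integrable_of_hasCompactSupport hasCompactSupport_deriv_smoothTransition).norm.mul_const
        M) (fun n => Eventually.of_forall fun y => ?_) (Eventually.of_forall fun y => ?_)
    · have e : (fun y => deriv Real.smoothTransition y • g (a + (n + 1 : ℝ)⁻¹ * y))
          = (Icc (0 : ℝ) 1).indicator fun y => deriv Real.smoothTransition y
            • g (a + (n + 1 : ℝ)⁻¹ * y) := by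
        ext y
        by_cases hy : y ∈ Icc (0 : ℝ) 1
        · rw [indicator_of_mem hy]
        · rw [indicator_of_notMem hy, deriv_smoothTransition_eq_zero hy, zero_smul]
      rw [e, aestronglyMeasurable_indicator_iff measurableSet_Icc]
      refine ContinuousOn.aestronglyMeasurable ?_ measurableSet_Icc
      refine hS.continuousOn.smul (hg.comp (by fun_prop) fun y hy => ?_)
      exact ha.trans (hmem n y hy).1
    · rw [norm_smul]
      by_cases hy : y ∈ Icc (0 : ℝ) 1
      · exact mul_le_mul_of_nonneg_left (hM _ (hmem n y hy)) (norm_nonneg _)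
      · rw [deriv_smoothTransition_eq_zero hy]
        simp
    · by_cases hy : y ∈ Icc (0 : ℝ) 1
      · refine Tendsto.const_smul ?_ _
        have h1 : Tendsto (fun n : ℕ => a + (n + 1 : ℝ)⁻¹ * y) atTop (𝓝 a) := by
          have := (tendsto_one_div_add_atTop_nhds_zero_nat (𝕜 := ℝ)).mul_const y
          simpa using this.const_add a
        refine (hg a ha).tendsto.comp (tendsto_nhdsWithin_iff.2 ⟨h1, ?_⟩)
        exact Eventually.of_forall fun n => ha.trans (hmem n y hy).1
      · simp [deriv_smoothTransition_eq_zero hy]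
  rw [integral_smul_const, integral_deriv_smoothTransition, one_smul] at hlim
  exact hlim.congr fun n => (key n).symm

/-- A continuous curve with an integrable weak derivative is the integral of the latter. -/
theorem IsWeakDerivOn.eq_add_integral {g h : ℝ → E} (H : IsWeakDerivOn (Ioi 0) g h)
    (hg : ContinuousOn g (Ici 0)) (hh : LocallyIntegrable h (volume.restrict (Ioi 0))) {t : ℝ}
    (ht : 0 ≤ t) : g t = g 0 + ∫ s in (0 : ℝ)..t, h s := by
  have hint : ∀ b, IntegrableOn h (Ioc 0 b) := by
    intro b
    have h1 := hh.integrableOn_isCompact (k := Icc 0 b) isCompact_Icc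
    rw [IntegrableOn, Measure.restrict_restrict measurableSet_Icc] at h1
    have : Ioc 0 b ⊆ Icc 0 b ∩ Ioi 0 := fun x hx => ⟨⟨hx.1.le, hx.2⟩, hx.1⟩
    exact IntegrableOn.mono_set h1 this
  -- away from the initial time, test with the difference of two steep transitions
  have hpos : ∀ a, 0 < a → ∀ b, a ≤ b → g b = g a + ∫ s in Ioc a b, h s := by
    intro a ha b hab
    set S := Real.smoothTransition with hS
    have hSs : ContDiff ℝ ∞ S := Real.smoothTransition.contDiff
    set η : ℕ → ℝ → ℝ := fun n x => S ((n + 1 : ℝ) * (x - a)) - S ((n + 1 : ℝ) * (x - b)) with hη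
    have hηs : ∀ n, ContDiff ℝ ∞ (η n) := fun n =>
      (hSs.comp (by fun_prop)).sub (hSs.comp (by fun_prop))
    have hη0 : ∀ n, ∀ x, x ∉ Icc a (b + 1) → η n x = 0 := by
      intro n x hx
      have hn : (0 : ℝ) < n + 1 := by positivity
      have hn1 : (1 : ℝ) ≤ n + 1 := by linarith [n.cast_nonneg (α := ℝ)]
      rw [mem_Icc, not_and_or, not_le, not_le] at hx
      simp only [hη, hS]
      rcases hx with hx | hx
      · rw [Real.smoothTransition.zero_of_nonpos (by nlinarith),
          Real.smoothTransition.zero_of_nonpos (by nlinarith), sub_zero]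
      · rw [Real.smoothTransition.one_of_one_le (by nlinarith),
          Real.smoothTransition.one_of_one_le (by nlinarith), sub_self]
    have hηc : ∀ n, HasCompactSupport (η n) := fun n =>
      HasCompactSupport.intro isCompact_Icc (hη0 n)
    have hηt : ∀ n, tsupport (η n) ⊆ Ioi 0 := by
      intro n
      have : tsupport (η n) ⊆ Icc a (b + 1) := by
        refine closure_minimal (fun x hx => ?_) isClosed_Icc
        by_contra hcon
        exact hx (hη0 n x hcon)
      exact this.trans fun x hx => ha.trans_le hx.1
    have hηd : ∀ n x, deriv (η n) x = (n + 1 : ℝ) * deriv S ((n + 1 : ℝ) * (x - a))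
        - (n + 1 : ℝ) * deriv S ((n + 1 : ℝ) * (x - b)) := by
      intro n x
      have d : ∀ c, HasDerivAt (fun x => S ((n + 1 : ℝ) * (x - c)))
          ((n + 1 : ℝ) * deriv S ((n + 1 : ℝ) * (x - c))) x := by
        intro c
        have e1 : HasDerivAt (fun x : ℝ => (n + 1 : ℝ) * (x - c)) (n + 1 : ℝ) x := by
          simpa using ((hasDerivAt_id x).sub_const c).const_mul (n + 1 : ℝ)
        have e2 := ((hSs.differentiable (by simp)) ((n + 1 : ℝ) * (x - c))).hasDerivAt
        have := e2.comp x e1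
        rwa [mul_comm] at this
      exact ((d a).fun_sub (d b)).deriv
    have hi : ∀ n : ℕ, ∀ c, 0 < c → Integrable fun x =>
        ((n + 1 : ℝ) * deriv S ((n + 1 : ℝ) * (x - c))) • g x := by
      intro n c hc
      have hn : (0 : ℝ) < n + 1 := by positivity
      have hn1 : (1 : ℝ) ≤ n + 1 := by linarith [n.cast_nonneg (α := ℝ)]
      have hz : ∀ x, x ∉ Icc c (c + 1) → (n + 1 : ℝ) * deriv S ((n + 1 : ℝ) * (x - c)) = 0 := by
        intro x hx
        rw [hS, deriv_smoothTransition_eq_zero, mul_zero]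
        intro hy
        exact hx ⟨by nlinarith [hy.1], by nlinarith [hy.1, hy.2]⟩
      have hcS : Continuous (deriv S) := continuous_deriv_smoothTransition
      refine integrable_test_smul H.1 (by fun_prop) (HasCompactSupport.intro isCompact_Icc hz) ?_
      refine (closure_minimal (fun x hx => ?_) isClosed_Icc).trans
        (fun x (hx : x ∈ Icc c (c + 1)) => hc.trans_le hx.1)
      by_contra hcon
      exact hx (hz x hcon)
    have hb : 0 < b := ha.trans_le hab
    have L1 : Tendsto (fun n : ℕ => ∫ x, deriv (η n) x • g x) atTop (𝓝 (g a - g b)) := by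
      refine ((tendsto_integral_steep_deriv hg ha.le).sub
        (tendsto_integral_steep_deriv hg hb.le)).congr fun n => ?_
      rw [← integral_sub (hi n a ha) (hi n b hb)]
      refine integral_congr_ae (Eventually.of_forall fun x => ?_)
      simp only [hηd, sub_smul]
    have L2 : Tendsto (fun n : ℕ => ∫ x, η n x • h x) atTop (𝓝 (∫ s in Ioc a b, h s)) := by
      rw [← integral_indicator measurableSet_Ioc]
      have hb1 : IntegrableOn h (Icc a (b + 1)) :=
        (hint (b + 1)).mono_set fun x hx => ⟨ha.trans_le hx.1, hx.2⟩
      refine tendsto_integral_of_dominated_convergence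
        ((Icc a (b + 1)).indicator fun x => ‖h x‖) (fun n => ?_)
        ((integrable_indicator_iff measurableSet_Icc).2 hb1.norm)
        (fun n => Eventually.of_forall fun x => ?_) (Eventually.of_forall fun x => ?_)
      · exact (integrable_test_smul H.2.1 (hηs n).continuous (hηc n) (hηt n)).aestronglyMeasurable
      · by_cases hx : x ∈ Icc a (b + 1)
        · rw [indicator_of_mem hx, norm_smul]
          have : ‖η n x‖ ≤ 1 := by
            rw [Real.norm_eq_abs, abs_le]
            simp only [hη, hS]
            constructor <;> linarith [Real.smoothTransition.nonneg ((n + 1 : ℝ) * (x - a)),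
              Real.smoothTransition.nonneg ((n + 1 : ℝ) * (x - b)),
              Real.smoothTransition.le_one ((n + 1 : ℝ) * (x - a)),
              Real.smoothTransition.le_one ((n + 1 : ℝ) * (x - b))]
          simpa using mul_le_mul_of_nonneg_right this (norm_nonneg (h x))
        · rw [indicator_of_notMem hx, hη0 n x hx]
          simp
      · -- each transition is eventually `0` or `1`
        have hev : ∀ c, ∀ᶠ n : ℕ in atTop, S ((n + 1 : ℝ) * (x - c)) = if c < x then 1 else 0 := by
          intro c
          split_ifs with hc
          · have h1 : Tendsto (fun n : ℕ => (n + 1 : ℝ) * (x - c)) atTop atTop :=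
              (tendsto_atTop_add_const_right _ _ tendsto_natCast_atTop_atTop).atTop_mul_const
                (sub_pos.2 hc)
            filter_upwards [h1.eventually_ge_atTop 1] with n hn
            exact Real.smoothTransition.one_of_one_le hn
          · refine Eventually.of_forall fun n => Real.smoothTransition.zero_of_nonpos ?_
            have hn : (0 : ℝ) < n + 1 := by positivity
            nlinarith [not_lt.1 hc]
        refine tendsto_const_nhds.congr' ?_
        filter_upwards [hev a, hev b] with n h1 h2
        simp only [hη, h1, h2]
        by_cases hxa : a < x
        · by_cases hxb : b < x
          · simp [hxa, hxb]
          · simp [hxa, hxb, not_lt.1 hxb]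
        · have hxb : ¬ b < x := fun hc => hxa (hab.trans_lt hc)
          simp [hxa, hxb]
    have e := tendsto_nhds_unique L1 (L2.neg.congr fun n =>
      (H.2.2 (η n) (hηs n) (hηc n) (hηt n)).symm)
    have e3 := sub_eq_iff_eq_add.1 e
    rw [e3]
    abel
  rcases ht.eq_or_lt with rfl | htpos
  · simp
  have hIoc : IntervalIntegrable h volume 0 t :=
    (intervalIntegrable_iff_integrableOn_Ioc_of_le ht).2 (hint t)
  -- let the lower limit tend to `0`
  have hcont : ContinuousOn (fun a => ∫ s in a..t, h s) (Icc 0 t) := by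
    have := intervalIntegral.continuousOn_primitive_interval_left (a := 0) (b := t) (f := h)
      (μ := volume) ?_
    · rwa [uIcc_of_le ht] at this
    · rw [uIcc_of_le ht]
      exact (integrableOn_Icc_iff_integrableOn_Ioc).2 (hint t)
  have hsub : Tendsto (fun a => g a + ∫ s in a..t, h s) (𝓝[Ioc 0 t] 0)
      (𝓝 (g 0 + ∫ s in (0 : ℝ)..t, h s)) := by
    refine Tendsto.add ?_ ?_
    · exact ((hg 0 self_mem_Ici).mono (fun x hx => hx.1.le)).tendsto
    · exact ((hcont 0 ⟨le_rfl, ht⟩).mono Ioc_subset_Icc_self).tendsto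
  have hne : (𝓝[Ioc 0 t] (0 : ℝ)).NeBot := by
    rw [nhdsWithin_Ioc_eq_nhdsGT htpos]
    infer_instance
  refine tendsto_nhds_unique (tendsto_const_nhds.congr' ?_) hsub
  filter_upwards [self_mem_nhdsWithin] with a ha
  rw [intervalIntegral.integral_of_le ha.2]
  exact hpos a ha.1 t ha.2

end WeakDerivative

end

/-! ### Supremum bounds and the nonlinear flux -/

noncomputable section

open FourierTransform

/-- The real part of the Fourier integral of `f`. -/
def reFourier (f : ℝ → ℂ) (x : ℝ) : ℝ := (𝓕 f x).re

theorem continuous_reFourier {f : ℝ → ℂ} (h : Integrable f) : Continuous (reFourier f) :=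
  Complex.continuous_re.comp (VectorFourier.fourierIntegral_continuous Real.continuous_fourierChar
    (by exact continuous_inner) h)

theorem enorm_reFourier_le (f : ℝ → ℂ) (x : ℝ) : ‖reFourier f x‖ₑ ≤ ∫⁻ ξ, ‖f ξ‖ₑ := by
  have h1 : ‖reFourier f x‖ₑ ≤ ‖𝓕 f x‖ₑ := by
    rw [enorm_le_iff_norm_le, reFourier, Real.norm_eq_abs]
    exact Complex.abs_re_le_norm _
  refine h1.trans ?_
  rw [Real.fourier_eq]
  refine (enorm_integral_le_lintegral_enorm _).trans (le_of_eq (lintegral_congr fun ξ => ?_))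
  rw [← ofReal_norm, Circle.norm_smul, ofReal_norm]

theorem hasDerivAt_reFourier {f : ℝ → ℂ} (h0 : Integrable f)
    (h1 : Integrable fun ξ => dsym ξ * f ξ) (x : ℝ) :
    HasDerivAt (reFourier f) (reFourier (fun ξ => dsym ξ * f ξ) x) x := by
  have hpi : (2 * Real.pi) ≠ 0 := by positivity
  have h2 : Integrable fun ξ : ℝ => ξ • f ξ := by
    refine (h1.const_mul (Complex.I / (2 * Real.pi))).congr (Eventually.of_forall fun ξ => ?_)
    simp only [dsym, wav, Complex.real_smul]
    push_cast
    have : (Real.pi : ℂ) ≠ 0 := Complex.ofReal_ne_zero.2 Real.pi_ne_zero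
    field_simp
    linear_combination (-(ξ : ℂ) * f ξ) * Complex.I_sq
  have h3 := Real.hasDerivAt_fourier h0 h2 x
  have h4 : (fun ξ : ℝ => (-2 * Real.pi * Complex.I * ξ : ℂ) • f ξ)
      = fun ξ => dsym ξ * f ξ := by
    ext ξ
    simp only [dsym, wav, smul_eq_mul]
    push_cast
    ring
  rw [h4] at h3
  exact Complex.reCLM.hasFDerivAt.comp_hasDerivAt x h3

theorem reFourier_ae {ψ : CLTwo} (h : Integrable (ψ : ℝ → ℂ)) :
    reFourier ψ =ᵐ[volume] ofFreq ψ := by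
  filter_upwards [coeFn_ofFreq ψ, coeFn_fourier_of_integrable h] with x h1 h2
  rw [h1, h2, reFourier]

/-- The constant `∫ (1 + k²)⁻¹ dξ` of the Sobolev embedding. -/
def supConst : ℝ := ∫ ξ, (1 + wav ξ ^ 2)⁻¹

theorem integrable_inv_one_add_wav_sq : Integrable fun ξ => (1 + wav ξ ^ 2)⁻¹ := by
  have hpi : -(2 * Real.pi) ≠ 0 := neg_ne_zero.2 (by positivity)
  have := integrable_inv_one_add_sq.comp_mul_left' hpi
  simpa only [wav, ← neg_mul] using this

/-- By scaling the value does not depend on `ε`. -/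
theorem lintegral_weight {ε : ℝ} (hε : 0 < ε) :
    ∫⁻ ξ, ENNReal.ofReal ((ε + ε⁻¹ * wav ξ ^ 2)⁻¹) = ENNReal.ofReal supConst := by
  have e : ∀ ξ, (ε + ε⁻¹ * wav ξ ^ 2)⁻¹ = ε⁻¹ * (1 + wav (ε⁻¹ * ξ) ^ 2)⁻¹ := by
    intro ξ
    rw [← mul_inv]
    congr 1
    simp only [wav]
    field_simp
  have hi : Integrable fun ξ => ε⁻¹ * (1 + wav (ε⁻¹ * ξ) ^ 2)⁻¹ :=
    (integrable_inv_one_add_wav_sq.comp_mul_left' (inv_pos.2 hε).ne').const_mul _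
  simp_rw [e]
  rw [← ofReal_integral_eq_lintegral_ofReal hi
    (Eventually.of_forall fun ξ => mul_nonneg (inv_pos.2 hε).le (by positivity)),
    integral_const_mul, Measure.integral_comp_mul_left (fun ξ => (1 + wav ξ ^ 2)⁻¹), inv_inv,
    abs_of_pos hε, smul_eq_mul, inv_mul_cancel_left₀ hε.ne', supConst]

/-- The `L¹` norm on the Fourier side, which dominates the supremum norm, interpolates between
`L²` and `H¹`; the parameter `ε` distributes the weight between the two. -/
theorem sq_lintegral_enorm_le {s : ℝ → ℂ} (hs : Continuous s) (ψ : CLTwo) {ε : ℝ} (hε : 0 < ε) :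
    (∫⁻ ξ, ‖s ξ * ψ ξ‖ₑ) ^ 2 ≤ ENNReal.ofReal supConst
      * wE univ (fun ξ => (ε + ε⁻¹ * wav ξ ^ 2) * ‖s ξ‖ ^ 2) ψ := by
  have hw := continuous_wav
  set a : ℝ → ℝ := fun ξ => ε + ε⁻¹ * wav ξ ^ 2 with ha
  have ha0 : ∀ ξ, 0 < a ξ := fun ξ => by positivity
  have hac : Continuous a := by fun_prop
  have hψ : AEMeasurable (fun ξ => ‖s ξ * ψ ξ‖ₑ) :=
    (hs.aestronglyMeasurable.mul (Lp.aestronglyMeasurable ψ)).enorm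
  -- the Cauchy–Schwarz inequality for `a^{-1/2}` and `a^{1/2} |s ψ|`
  set F : ℝ → ℝ≥0∞ := fun ξ => ENNReal.ofReal (Real.sqrt (a ξ)⁻¹) with hF
  set G : ℝ → ℝ≥0∞ := fun ξ => ENNReal.ofReal (Real.sqrt (a ξ)) * ‖s ξ * ψ ξ‖ₑ with hG
  have hFm : AEMeasurable F := by
    have : Continuous fun ξ => Real.sqrt (a ξ)⁻¹ :=
      Real.continuous_sqrt.comp (hac.inv₀ fun ξ => (ha0 ξ).ne')
    exact this.measurable.ennreal_ofReal.aemeasurable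
  have hGm : AEMeasurable G :=
    ((Real.continuous_sqrt.comp hac).measurable.ennreal_ofReal.aemeasurable).mul hψ
  have e1 : ∫⁻ ξ, ‖s ξ * ψ ξ‖ₑ = ∫⁻ ξ, (F * G) ξ := by
    refine lintegral_congr fun ξ => ?_
    rw [Pi.mul_apply, hF, hG]
    simp only
    rw [← mul_assoc, ← ENNReal.ofReal_mul (Real.sqrt_nonneg _), Real.sqrt_inv,
      inv_mul_cancel₀ (Real.sqrt_pos.2 (ha0 ξ)).ne', ENNReal.ofReal_one, one_mul]
  have e2 : ∫⁻ ξ, F ξ ^ (2 : ℝ) = ENNReal.ofReal supConst := by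
    rw [← lintegral_weight hε]
    refine lintegral_congr fun ξ => ?_
    rw [ENNReal.rpow_ofNat, hF]
    simp only
    rw [← ENNReal.ofReal_pow (Real.sqrt_nonneg _), Real.sq_sqrt (inv_pos.2 (ha0 ξ)).le]
  have e3 : ∫⁻ ξ, G ξ ^ (2 : ℝ) = wE univ (fun ξ => a ξ * ‖s ξ‖ ^ 2) ψ := by
    rw [wE, Measure.restrict_univ]
    refine lintegral_congr fun ξ => ?_
    rw [ENNReal.rpow_ofNat, hG]
    simp only
    rw [mul_pow, ← ENNReal.ofReal_pow (Real.sqrt_nonneg _), Real.sq_sqrt (ha0 ξ).le, enorm_mul,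
      mul_pow, ENNReal.ofReal_mul (ha0 ξ).le, ENNReal.ofReal_pow (norm_nonneg _), ofReal_norm,
      mul_assoc]
  have h := ENNReal.lintegral_mul_le_Lp_mul_Lq volume Real.HolderConjugate.two_two hFm hGm
  rw [← e1, e2, e3] at h
  refine (pow_le_pow_left' h 2).trans (le_of_eq ?_)
  have e4 : ∀ x : ℝ≥0∞, (x ^ (1 / 2 : ℝ)) ^ 2 = x := by
    intro x
    rw [← ENNReal.rpow_natCast, ← ENNReal.rpow_mul]
    norm_num
  rw [mul_pow, e4, e4]

theorem integrable_mul_of_wE {s : ℝ → ℂ} (hs : Continuous s) {ψ : CLTwo}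
    (h : wE univ (fun ξ => (1 + wav ξ ^ 2) * ‖s ξ‖ ^ 2) ψ ≠ ⊤) :
    Integrable fun ξ => s ξ * ψ ξ := by
  refine ⟨hs.aestronglyMeasurable.mul (Lp.aestronglyMeasurable ψ), ?_⟩
  have h1 := sq_lintegral_enorm_le hs ψ one_pos
  simp only [inv_one, one_mul] at h1
  have h2 := ne_top_of_le_ne_top (ENNReal.mul_ne_top ENNReal.ofReal_ne_top h) h1
  rw [HasFiniteIntegral, lt_top_iff_ne_top]
  intro hc
  rw [hc] at h2
  exact h2 (by simp)

theorem isWeakDerivOn_of_hasDerivAt {v v' : ℝ → ℝ} (h : ∀ x, HasDerivAt v (v' x) x)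
    (hc : Continuous v') : IsWeakDerivOn univ v v' := by
  have hv : Continuous v := continuous_iff_continuousAt.2 fun x => (h x).continuousAt
  refine ⟨hv.locallyIntegrable.locallyIntegrableOn _, hc.locallyIntegrable.locallyIntegrableOn _,
    fun η hη hηc _ => ?_⟩
  have hd : Continuous (deriv η) := hη.continuous_deriv (by simp)
  have i1 : Integrable fun x => deriv η x * v x :=
    (hd.mul hv).integrable_of_hasCompactSupport hηc.deriv.mul_right
  have i2 : Integrable fun x => η x * v' x :=
    (hη.continuous.mul hc).integrable_of_hasCompactSupport hηc.mul_right
  have i3 : Integrable fun x => η x * v x :=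
    (hη.continuous.mul hv).integrable_of_hasCompactSupport hηc.mul_right
  have := integral_eq_zero_of_hasDerivAt_of_integrable
    (fun x => (((hη.differentiable (by simp)) x).hasDerivAt).fun_mul (h x)) (i1.add i2) i3
  have e : (∫ x, deriv η x * v x) + ∫ x, η x * v' x = 0 := by
    rw [← integral_add i1 i2]
    exact this
  simp only [smul_eq_mul]
  linarith

theorem IsWeakDerivOn.congr_ae {g h g' h' : ℝ → ℝ} (H : IsWeakDerivOn univ g h)
    (hg : g =ᵐ[volume] g') (hh : h =ᵐ[volume] h') : IsWeakDerivOn univ g' h' := by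
  obtain ⟨h1, h2, h3⟩ := H
  rw [locallyIntegrableOn_univ] at h1 h2
  refine ⟨locallyIntegrableOn_univ.2 (h1.congr hg), locallyIntegrableOn_univ.2 (h2.congr hh),
    fun η hη hc hs => ?_⟩
  have := h3 η hη hc hs
  rw [integral_congr_ae (g := fun x => deriv η x • g' x),
    integral_congr_ae (f := fun x => η x • h x) (g := fun x => η x • h' x)] at this
  · exact this
  · filter_upwards [hh] with x hx
    rw [hx]
  · filter_upwards [hg] with x hx
    rw [hx]

section Flux

variable {g : ℝ → ℝ} {K : NNReal}

/-- The nonlinearity `v ↦ g ∘ v` in the Fourier representation. -/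
def fluxOp (hg : LipschitzWith K g) (g0 : g 0 = 0) (ψ : CLTwo) : CLTwo :=
  toFreq (hg.compLp g0 (ofFreq ψ))

theorem ofFreq_fluxOp (hg : LipschitzWith K g) (g0 : g 0 = 0) (ψ : CLTwo) :
    ofFreq (fluxOp hg g0 ψ) =ᵐ[volume] fun x => g (ofFreq ψ x) := by
  rw [fluxOp, ofFreq_toFreq]
  exact hg.coeFn_compLp g0 _

theorem norm_fluxOp_sub_le (hg : LipschitzWith K g) (g0 : g 0 = 0) (ψ χ : CLTwo) :
    ‖fluxOp hg g0 ψ - fluxOp hg g0 χ‖ ≤ K * ‖ψ - χ‖ := by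
  rw [fluxOp, fluxOp, ← map_sub, norm_toFreq]
  refine (hg.norm_compLp_sub_le g0 _ _).trans ?_
  rw [← map_sub]
  gcongr
  exact norm_ofFreq_le _

/-- Plancherel's identity. -/
theorem re_inner_toFreq (ψ : CLTwo) (w : LTwo) :
    (inner ℂ ψ (toFreq w)).re = ∫ x, ofFreq ψ x * w x := by
  rw [← Lp.inner_fourier_eq, L2.inner_def]
  have hi := L2.integrable_inner (𝕜 := ℂ) (𝓕 ψ : CLTwo) (𝓕 (toFreq w) : CLTwo)
  refine (integral_re (𝕜 := ℂ) hi).symm.trans (integral_congr_ae ?_)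
  filter_upwards [coeFn_ofFreq ψ, coeFn_fourier_toFreq w] with x h1 h2
  rw [h1, h2]
  simp [mul_comm]

/-- The classical data of `v = 𝓕 ψ` when `ψ` has finite `H²` energy. -/
theorem exists_deriv_of_wE {ψ : CLTwo} (h : wE univ (fun ξ => wav ξ ^ 4) ψ ≠ ⊤) :
    wE univ (fun ξ => ‖dsym ξ‖ ^ 2) ψ ≠ ⊤ ∧ Integrable (ψ : ℝ → ℂ) ∧
      Integrable fun ξ => dsym ξ * ψ ξ := by
  have hw := continuous_wav
  have h1 : wE univ (fun ξ => 1 + wav ξ ^ 4) ψ ≠ ⊤ := by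
    rw [wE_add _ measurable_const (fun _ => zero_le_one) (fun ξ => by positivity), wE_one]
    exact ENNReal.add_ne_top.2 ⟨by simp, h⟩
  refine ⟨wE_ne_top_of_le zero_le_one (fun ξ => ?_) h1, ?_, ?_⟩
  · rw [norm_dsym_sq]
    nlinarith [sq_nonneg (wav ξ ^ 2 - 1)]
  · have := integrable_mul_of_wE (s := fun _ => 1) continuous_const (ψ := ψ)
      (wE_ne_top_of_le (C := 2) zero_le_two (fun ξ => ?_) h1)
    · simpa using this
    · rw [norm_one]
      nlinarith [sq_nonneg (wav ξ ^ 2 - 1)]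
  · refine integrable_mul_of_wE continuous_dsym
      (wE_ne_top_of_le (C := 2) zero_le_two (fun ξ => ?_) h1)
    rw [norm_dsym_sq]
    nlinarith [sq_nonneg (wav ξ ^ 2 - 1)]

theorem coeFn_mulTo_dsym {ψ : CLTwo} (h : wE univ (fun ξ => ‖dsym ξ‖ ^ 2) ψ ≠ ⊤)
    (hi : Integrable fun ξ => dsym ξ * ψ ξ) :
    reFourier (fun ξ => dsym ξ * ψ ξ) =ᵐ[volume] ofFreq (mulTo dsym ψ) := by
  have e := coeFn_mulTo continuous_dsym h
  have e2 : reFourier (fun ξ => dsym ξ * ψ ξ) = reFourier (mulTo dsym ψ) := by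
    ext x
    rw [reFourier, reFourier, Real.fourier_eq, Real.fourier_eq]
    congr 1
    refine integral_congr_ae ?_
    filter_upwards [e] with ξ hξ
    rw [hξ]
  rw [e2]
  exact reFourier_ae (hi.congr e.symm)

/-- Composition with a continuously differentiable Lipschitz function is an admissible flux. -/
theorem fluxMap_fluxOp (hg : LipschitzWith K g) (g0 : g 0 = 0) (hgd : ContDiff ℝ 1 g) :
    FluxMap (fluxOp hg g0) K := by
  have hgc : Continuous (deriv g) := hgd.continuous_deriv le_rfl
  have hgh : ∀ y, HasDerivAt g (deriv g y) y := fun y =>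
    ((hgd.differentiable (by simp)) y).hasDerivAt
  have hgK : ∀ y, ‖deriv g y‖ ≤ K := fun y => norm_deriv_le_of_lipschitz hg
  have hgy : ∀ y, |g y| ≤ K * |y| := by
    intro y
    have := hg.dist_le_mul y 0
    simpa [g0] using this
  refine ⟨LipschitzWith.of_dist_le_mul fun ψ χ => ?_, ?_, fun ψ hψ => ?_, fun ψ hψ => ?_⟩
  · rw [dist_eq_norm, dist_eq_norm]
    exact norm_fluxOp_sub_le hg g0 ψ χ
  · rw [fluxOp, map_zero, hg.compLp_zero g0, map_zero]
  · obtain ⟨h1, hi0, hi1⟩ := exists_deriv_of_wE hψ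
    have hr := reFourier_ae hi0
    have hr' := coeFn_mulTo_dsym h1 hi1
    set r := reFourier ψ with hrd
    set r' := reFourier (fun ξ => dsym ξ * ψ ξ) with hrd'
    have hd : ∀ x, HasDerivAt r (r' x) x := hasDerivAt_reFourier hi0 hi1
    have hrc : Continuous r := continuous_reFourier hi0
    have hrc' : Continuous r' := continuous_reFourier hi1
    have hle : ∀ x, ‖deriv g (r x) * r' x‖ ≤ K * ‖r' x‖ := fun x => by
      rw [norm_mul]
      gcongr
      exact hgK _
    have hm' : MemLp r' 2 volume := (memLp_congr_ae hr').2 (Lp.memLp _)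
    have hcD : Continuous fun x => deriv g (r x) * r' x := (hgc.comp hrc).mul hrc'
    have hm : MemLp (fun x => deriv g (r x) * r' x) 2 volume :=
      hm'.of_le_mul hcD.aestronglyMeasurable (Eventually.of_forall hle)
    have W : IsWeakDerivOn univ (hg.compLp g0 (ofFreq ψ) : ℝ → ℝ) (hm.toLp _) := by
      refine (isWeakDerivOn_of_hasDerivAt (fun x => (hgh (r x)).comp x (hd x)) hcD).congr_ae ?_
        hm.coeFn_toLp.symm
      filter_upwards [hg.coeFn_compLp g0 (ofFreq ψ), hr] with x e1 e2
      rw [e1, Function.comp_apply, Function.comp_apply, e2]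
    have e1 : wE univ (fun ξ => wav ξ ^ 2) (fluxOp hg g0 ψ) = ‖toFreq (hm.toLp _)‖ₑ ^ 2 := by
      rw [enorm_sq_eq_lintegral, wE, Measure.restrict_univ]
      refine lintegral_congr_ae ?_
      filter_upwards [W.toFreq_ae] with ξ hξ
      rw [hξ, enorm_mul, mul_pow, ← ofReal_norm (dsym ξ), ← ENNReal.ofReal_pow (norm_nonneg _),
        norm_dsym_sq, fluxOp]
    have e2 : wE univ (fun ξ => wav ξ ^ 2) ψ = ‖mulTo dsym ψ‖ₑ ^ 2 := by
      rw [enorm_mulTo_sq continuous_dsym h1]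
      simp only [norm_dsym_sq]
    have e3 : ‖hm.toLp _‖ ≤ K * ‖mulTo dsym ψ‖ := by
      refine (Lp.norm_le_mul_norm_of_ae_le_mul (g := ofFreq (mulTo dsym ψ)) ?_).trans
        (mul_le_mul_of_nonneg_left (norm_ofFreq_le _) K.2)
      filter_upwards [hm.coeFn_toLp, hr'] with x e4 e5
      rw [e4, ← e5]
      exact hle x
    rw [e1, e2, ← mul_pow, ← ofReal_norm, norm_toFreq, ← ofReal_norm]
    refine pow_le_pow_left' ?_ 2
    rw [← ENNReal.ofReal_coe_nnreal, ← ENNReal.ofReal_mul K.coe_nonneg]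
    exact ENNReal.ofReal_le_ofReal e3
  · obtain ⟨h1, hi0, hi1⟩ := exists_deriv_of_wE hψ
    have hr := reFourier_ae hi0
    have hr' := coeFn_mulTo_dsym h1 hi1
    set r := reFourier ψ with hrd
    set r' := reFourier (fun ξ => dsym ξ * ψ ξ) with hrd'
    have hd : ∀ x, HasDerivAt r (r' x) x := hasDerivAt_reFourier hi0 hi1
    have hrc : Continuous r := continuous_reFourier hi0
    have hT : Tendsto (fun n : ℕ => (inner ℂ (win (Icc (-n : ℝ) n) dsym ψ)
        (fluxOp hg g0 ψ)).re) atTop (𝓝 (inner ℂ (mulTo dsym ψ) (fluxOp hg g0 ψ)).re) :=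
      (Complex.continuous_re.tendsto _).comp
        ((tendsto_win_mulTo continuous_dsym h1).inner tendsto_const_nhds)
    -- the flux is orthogonal to `∂_x v` since `g(v) ∂_x v` is a total derivative
    have hmr : MemLp r 2 volume := (memLp_congr_ae hr).2 (Lp.memLp _)
    have hmr' : MemLp r' 2 volume := (memLp_congr_ae hr').2 (Lp.memLp _)
    have hgr : MemLp (fun x => g (r x)) 2 volume :=
      hmr.of_le_mul (hg.continuous.comp hrc).aestronglyMeasurable
        (Eventually.of_forall fun x => hgy (r x))
    set P : ℝ → ℝ := fun y => ∫ s in (0 : ℝ)..y, g s with hP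
    have hPd : ∀ y, HasDerivAt P (g y) y := fun y =>
      intervalIntegral.integral_hasDerivAt_right (hg.continuous.intervalIntegrable _ _)
        hg.continuous.stronglyMeasurable.stronglyMeasurableAtFilter hg.continuous.continuousAt
    have hPle : ∀ y, ‖P y‖ ≤ K * ‖y ^ 2‖ := by
      intro y
      have := intervalIntegral.norm_integral_le_of_norm_le_const (a := 0) (b := y) (f := g)
        (C := K * |y|) (fun s hs => (hgy s).trans ?_)
      · rw [sub_zero, mul_assoc, abs_mul_abs_self, ← sq] at this
        rwa [Real.norm_of_nonneg (sq_nonneg y)]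
      · refine mul_le_mul_of_nonneg_left ?_ K.coe_nonneg
        rcases le_total 0 y with h0 | h0
        · rw [uIoc_of_le h0] at hs
          rw [abs_of_pos hs.1, abs_of_nonneg h0]
          exact hs.2
        · rw [uIoc_of_ge h0] at hs
          rw [abs_of_nonpos hs.2, abs_of_nonpos h0]
          linarith [hs.1]
    have hPc : Continuous P := continuous_iff_continuousAt.2 fun y => (hPd y).continuousAt
    have iP : Integrable fun x => P (r x) := by
      refine (hmr.integrable_sq.norm.const_mul K).mono' (hPc.comp hrc).aestronglyMeasurable ?_
      exact Eventually.of_forall fun x => hPle (r x)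
    have iD : Integrable fun x => g (r x) * r' x := hgr.integrable_mul hmr'
    have hz := integral_eq_zero_of_hasDerivAt_of_integrable
      (fun x => (hPd (r x)).comp x (hd x)) iD iP
    have e : (inner ℂ (mulTo dsym ψ) (fluxOp hg g0 ψ)).re = 0 := by
      rw [fluxOp, re_inner_toFreq, ← hz]
      refine integral_congr_ae ?_
      filter_upwards [hg.coeFn_compLp g0 (ofFreq ψ), hr, hr'] with x e1 e2 e3
      rw [e1, Function.comp_apply, ← e2, ← e3, mul_comm]
    rwa [e] at hT

end Flux

end

/-! ### Truncation of the flux, classical regularity and decay -/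

noncomputable section

/-- Outside of a bounded range of values the flux can be replaced by one with globally bounded
derivative. -/
theorem exists_truncation {f : ℝ → ℝ} (hf : ContDiff ℝ 1 f) (c R : ℝ) :
    ∃ (g : ℝ → ℝ) (K : NNReal), LipschitzWith K g ∧ g 0 = 0 ∧ ContDiff ℝ 1 g ∧
      ∀ v, |v| ≤ R → g v = f (c + v) - f c := by
  rcases lt_or_ge R 0 with hR | hR
  · exact ⟨fun _ => 0, 0, LipschitzWith.const' 0, rfl, contDiff_const, fun v hv =>
      absurd ((abs_nonneg v).trans hv) (not_le.2 hR)⟩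
  set k : ℝ → ℝ := fun s => deriv f (c + max (-R) (min R s)) with hk
  have hkc : Continuous k := (hf.continuous_deriv le_rfl).comp (by fun_prop)
  obtain ⟨C, hC⟩ := (isCompact_Icc (a := c - R) (b := c + R)).exists_bound_of_continuousOn
    (hf.continuous_deriv le_rfl).continuousOn
  have hkC : ∀ s, ‖k s‖ ≤ C := fun s => hC _
    ⟨by linarith [le_max_left (-R) (min R s)],
      by linarith [max_le (by linarith : -R ≤ R) (min_le_left R s)]⟩
  have hC0 : 0 ≤ C := (norm_nonneg _).trans (hkC 0)
  set g : ℝ → ℝ := fun v => ∫ s in (0 : ℝ)..v, k s with hg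
  have hgd : ∀ v, HasDerivAt g (k v) v := fun v =>
    intervalIntegral.integral_hasDerivAt_right (hkc.intervalIntegrable _ _)
      (hkc.stronglyMeasurableAtFilter _ _) hkc.continuousAt
  have hdk : deriv g = k := funext fun v => (hgd v).deriv
  refine ⟨g, C.toNNReal, ?_, intervalIntegral.integral_same, ?_, fun v hv => ?_⟩
  · refine lipschitzWith_of_nnnorm_deriv_le (fun v => (hgd v).differentiableAt) fun v => ?_
    rw [hdk, ← NNReal.coe_le_coe, coe_nnnorm, Real.coe_toNNReal C hC0]
    exact hkC v
  · rw [contDiff_one_iff_deriv, hdk]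
    exact ⟨fun v => (hgd v).differentiableAt, hkc⟩
  · have e : g v = ∫ s in (0 : ℝ)..v, deriv f (c + s) := by
      refine intervalIntegral.integral_congr fun s hs => ?_
      have hs' : |s| ≤ R := by
        refine le_trans ?_ hv
        rcases le_total 0 v with h | h
        · rw [uIcc_of_le h] at hs
          rw [abs_of_nonneg hs.1, abs_of_nonneg h]
          exact hs.2
        · rw [uIcc_of_ge h] at hs
          rw [abs_of_nonpos hs.2, abs_of_nonpos h]
          linarith [hs.1]
      rw [abs_le] at hs'
      simp only [hk]
      rw [min_eq_right hs'.2, max_eq_right hs'.1]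
    have hd : ∀ s, HasDerivAt (fun s => f (c + s)) (deriv f (c + s)) s := fun s =>
      HasDerivAt.comp_const_add c s ((hf.differentiable (by simp)) _).hasDerivAt
    rw [e, intervalIntegral.integral_eq_sub_of_hasDerivAt (fun s _ => hd s)
      (((hf.continuous_deriv le_rfl).comp (by fun_prop)).intervalIntegrable _ _), add_zero]

theorem isWeakDerivOn_const (c : ℝ) : IsWeakDerivOn univ (fun _ : ℝ => c) fun _ => 0 :=
  isWeakDerivOn_of_hasDerivAt (fun x => hasDerivAt_const x c) continuous_const

theorem IsWeakDerivOn.add_const {v h : ℝ → ℝ} (H : IsWeakDerivOn univ v h) (c : ℝ) :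
    IsWeakDerivOn univ (fun x => v x + c) h := by
  obtain ⟨h1, h2, h3⟩ := H
  refine ⟨h1.add (isWeakDerivOn_const c).1, h2, fun η hη hc hs => ?_⟩
  have e := (isWeakDerivOn_const c).2.2 η hη hc hs
  have i1 := integrable_test_smul h1 (hη.continuous_deriv (by simp)) hc.deriv (subset_univ _)
  have i2 := integrable_test_smul (isWeakDerivOn_const c).1 (hη.continuous_deriv (by simp))
    hc.deriv (subset_univ _)
  simp only [smul_zero, integral_zero, neg_zero] at e
  simp only [smul_add]
  rw [integral_add i1 i2, h3 η hη hc hs, e, add_zero]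

/-- Only the values on `s` matter for a weak derivative on `s`. -/
theorem IsWeakDerivOn.congr_on {E : Type*} [NormedAddCommGroup E] [NormedSpace ℝ E] {s : Set ℝ}
    (hs : IsOpen s) {g g' h : ℝ → E} (H : IsWeakDerivOn s g h) (hg : EqOn g g' s) :
    IsWeakDerivOn s g' h := by
  obtain ⟨h1, h2, h3⟩ := H
  refine ⟨fun x hx => ?_, h2, fun η hη hc ht => ?_⟩
  · obtain ⟨U, hU, hi⟩ := h1 x hx
    rw [hs.nhdsWithin_eq hx] at hU
    obtain ⟨V, hV, hVo, hxV⟩ := mem_nhds_iff.1 hU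
    refine ⟨V ∩ s, mem_nhdsWithin_of_mem_nhds ((hVo.inter hs).mem_nhds ⟨hxV, hx⟩), ?_⟩
    exact (hi.mono_set (inter_subset_left.trans hV)).congr_fun
      (fun y hy => hg hy.2) (hVo.inter hs).measurableSet
  · rw [← h3 η hη hc ht]
    refine integral_congr_ae (Eventually.of_forall fun x => ?_)
    by_cases hx : x ∈ s
    · simp only [hg hx]
    · have : deriv η x = 0 := image_eq_zero_of_notMem_tsupport fun hm =>
        hx (ht (tsupport_deriv_subset hm))
      simp [this]

/-- A bounded `H¹` energy bounds the values of the function. -/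
theorem abs_reFourier_le {ψ : CLTwo} {C : ℝ} (hC : 0 ≤ C)
    (h : wE univ (fun ξ => 1 + wav ξ ^ 2) ψ ≤ ENNReal.ofReal C) (x : ℝ) :
    |reFourier ψ x| ≤ Real.sqrt (supConst * C) := by
  have hA : 0 ≤ supConst := integral_nonneg fun ξ => by positivity
  have h1 := sq_lintegral_enorm_le (s := fun _ => 1) continuous_const ψ one_pos
  simp only [one_mul, inv_one, norm_one, one_pow, mul_one] at h1
  have h2 := (pow_le_pow_left' (enorm_reFourier_le ψ x) 2).trans
    (h1.trans (mul_le_mul_right h _))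
  rw [← ENNReal.ofReal_mul hA, ← ofReal_norm, ← ENNReal.ofReal_pow (norm_nonneg _)] at h2
  refine Real.abs_le_sqrt ?_
  rw [← sq_abs]
  exact (ENNReal.ofReal_le_ofReal_iff (mul_nonneg hA hC)).1 h2

theorem wE_norm_sq_eq_of_ae {s : ℝ → ℂ} {χ ψ : CLTwo}
    (h : χ =ᵐ[volume] fun ξ => s ξ * ψ ξ) : wE univ (fun ξ => ‖s ξ‖ ^ 2) ψ = ‖χ‖ₑ ^ 2 := by
  rw [enorm_sq_eq_lintegral, wE, Measure.restrict_univ]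
  refine lintegral_congr_ae ?_
  filter_upwards [h] with ξ hξ
  rw [hξ, enorm_mul, mul_pow, ENNReal.ofReal_pow (norm_nonneg _), ofReal_norm]

/-- The components of an element of `H^n` on the Fourier side. -/
theorem toFreq_wderiv {n : ℕ} (v : SobolevSpace n) (j : Fin (n + 1)) :
    toFreq (wderiv v j) =ᵐ[volume] fun ξ => dsym ξ ^ (j : ℕ) * toFreq (wderiv v 0) ξ := by
  induction j using Fin.induction with
  | zero => simp
  | succ i ih =>
    have h : IsWeakDerivOn univ (wderiv v i.castSucc : ℝ → ℝ) (wderiv v i.succ) := v.2 i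
    filter_upwards [h.toFreq_ae, ih] with ξ h1 h2
    rw [h1, h2, Fin.val_succ, Fin.val_castSucc]
    ring

theorem wE_toFreq_wderiv {n : ℕ} (v : SobolevSpace n) (j : Fin (n + 1)) :
    wE univ (fun ξ => wav ξ ^ (2 * (j : ℕ))) (toFreq (wderiv v 0)) = ‖wderiv v j‖ₑ ^ 2 := by
  have e : ∀ ξ, wav ξ ^ (2 * (j : ℕ)) = ‖dsym ξ ^ (j : ℕ)‖ ^ 2 := by
    intro ξ
    rw [norm_pow, norm_dsym, ← abs_pow, sq_abs, ← pow_mul, mul_comm]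
  simp_rw [e]
  rw [wE_norm_sq_eq_of_ae (toFreq_wderiv v j), ← ofReal_norm, norm_toFreq, ofReal_norm]

/-- Application of the Sobolev parametrization undoes the weight `(1 + i k)^n`. -/
theorem mulOp_sobSym_mulTo {n j : ℕ} (hj : j ≤ n) {s : ℝ → ℂ} (hs : Continuous s) {ψ : CLTwo}
    (h : wE univ (fun ξ => ‖besselSym ξ ^ n * s ξ‖ ^ 2) ψ ≠ ⊤) :
    mulOp (sobSym n j) (mulTo (fun ξ => besselSym ξ ^ n * s ξ) ψ)
      =ᵐ[volume] fun ξ => dsym ξ ^ j * (s ξ * ψ ξ) := by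
  have hb := continuous_besselSym
  filter_upwards [coeFn_mulOp (bddSymbol_sobSym hj) (mulTo (fun ξ => besselSym ξ ^ n * s ξ) ψ),
    coeFn_mulTo (by fun_prop) h] with ξ h1 h2
  have := besselSym_ne_zero ξ
  rw [h1, h2, sobSym]
  field_simp

section Regularity

variable {α β γ δ : ℝ} {N : CLTwo → CLTwo} {K : NNReal} {ψ : ℝ → CLTwo}

/-- Finiteness of the energies that bound `∂_x^j u`, `j ≤ 2`, uniformly. -/
theorem SmoothSol.wE_ne_top (S : SmoothSol α β γ δ N K ψ) {t : ℝ} (ht : 0 ≤ t) {j : ℕ}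
    (hj : j ≤ 2) : wE univ (fun ξ => (1 + wav ξ ^ 2) * ‖dsym ξ ^ j‖ ^ 2) (ψ t) ≠ ⊤ := by
  refine wE_ne_top_of_le zero_le_one (fun ξ => ?_) (S.bessel_cube_ne_top ht)
  have h1 := one_le_norm_besselSym ξ
  have h2 := norm_dsym_le ξ
  rw [← norm_besselSym_sq, one_mul, norm_pow, norm_pow, ← mul_pow]
  refine pow_le_pow_left₀ (by positivity) ?_ 2
  calc ‖besselSym ξ‖ * ‖dsym ξ‖ ^ j ≤ ‖besselSym ξ‖ * ‖besselSym ξ‖ ^ j := by gcongr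
    _ = ‖besselSym ξ‖ ^ (j + 1) := by ring
    _ ≤ ‖besselSym ξ‖ ^ 3 := pow_le_pow_right₀ h1 (by omega)

theorem SmoothSol.integrable (S : SmoothSol α β γ δ N K ψ) {t : ℝ} (ht : 0 ≤ t) {j : ℕ}
    (hj : j ≤ 2) : Integrable fun ξ => dsym ξ ^ j * ψ t ξ :=
  integrable_mul_of_wE (continuous_dsym.pow j) (S.wE_ne_top ht hj)

theorem SmoothSol.integrable_zero (S : SmoothSol α β γ δ N K ψ) {t : ℝ} (ht : 0 ≤ t) :
    Integrable (ψ t : ℝ → ℂ) := by simpa using S.integrable ht zero_le_two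

theorem SmoothSol.hasDerivAt (S : SmoothSol α β γ δ N K ψ) {t : ℝ} (ht : 0 ≤ t) {j : ℕ}
    (hj : j + 1 ≤ 2) (x : ℝ) :
    HasDerivAt (reFourier fun ξ => dsym ξ ^ j * ψ t ξ)
      (reFourier (fun ξ => dsym ξ ^ (j + 1) * ψ t ξ) x) x := by
  have e : (fun ξ => dsym ξ ^ (j + 1) * ψ t ξ) = fun ξ => dsym ξ * (dsym ξ ^ j * ψ t ξ) := by
    ext ξ
    ring
  have h := S.integrable ht hj
  rw [e] at h ⊢
  exact hasDerivAt_reFourier (S.integrable ht (by omega)) h x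

/-- The function `c + Re 𝓕 ψ` of `x`, as an everywhere defined function when `ψ` is integrable. -/
def profile (c : ℝ) (ψ : CLTwo) (x : ℝ) : ℝ := reFourier ψ x + c

theorem SmoothSol.hasDerivAt_profile (S : SmoothSol α β γ δ N K ψ) (c : ℝ) {t : ℝ} (ht : 0 ≤ t)
    (x : ℝ) : HasDerivAt (profile c (ψ t)) (reFourier (fun ξ => dsym ξ ^ 1 * ψ t ξ) x) x := by
  have h := S.hasDerivAt ht (j := 0) (by norm_num) x
  simp only [pow_zero, one_mul] at h
  exact h.add_const c

theorem SmoothSol.deriv_profile (S : SmoothSol α β γ δ N K ψ) (c : ℝ) {t : ℝ} (ht : 0 ≤ t) :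
    deriv (profile c (ψ t)) = reFourier fun ξ => dsym ξ ^ 1 * ψ t ξ :=
  funext fun x => (S.hasDerivAt_profile c ht x).deriv

theorem SmoothSol.iteratedDeriv_two_profile (S : SmoothSol α β γ δ N K ψ) (c : ℝ) {t : ℝ}
    (ht : 0 ≤ t) :
    iteratedDeriv 2 (profile c (ψ t)) = reFourier fun ξ => dsym ξ ^ 2 * ψ t ξ := by
  rw [iteratedDeriv_succ, iteratedDeriv_one, S.deriv_profile c ht]
  exact funext fun x => (S.hasDerivAt ht (j := 1) le_rfl x).deriv

theorem SmoothSol.contDiff_profile (S : SmoothSol α β γ δ N K ψ) (c : ℝ) {t : ℝ} (ht : 0 ≤ t) :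
    ContDiff ℝ 2 (profile c (ψ t)) := by
  have h2 := continuous_reFourier (S.integrable ht (j := 2) le_rfl)
  have h1 : ContDiff ℝ 1 (deriv (profile c (ψ t))) := by
    rw [S.deriv_profile c ht, contDiff_one_iff_deriv]
    refine ⟨fun x => (S.hasDerivAt ht (j := 1) le_rfl x).differentiableAt, ?_⟩
    rwa [funext fun x => (S.hasDerivAt ht (j := 1) le_rfl x).deriv]
  have : ContDiff ℝ (1 + 1) (profile c (ψ t)) := by
    rw [contDiff_succ_iff_deriv]
    exact ⟨fun x => (S.hasDerivAt_profile c ht x).differentiableAt, by simp, h1⟩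
  simpa [one_add_one_eq_two] using this

theorem SmoothSol.profile_ae (S : SmoothSol α β γ δ N K ψ) (c : ℝ) {t : ℝ} (ht : 0 ≤ t) :
    (fun x => profile c (ψ t) x - c) =ᵐ[volume] ofFreq (ψ t) := by
  filter_upwards [reFourier_ae (S.integrable_zero ht)] with x hx
  rw [profile, add_sub_cancel_right, hx]

/-- Decay of the supremum norms: the energies with at least one derivative tend to zero, and the
bounded `L²` norm enters the interpolation inequality with an arbitrarily small factor. -/
theorem SmoothSol.tendsto_lintegral (S : SmoothSol α β γ δ N K ψ) {j : ℕ} (hj : j ≤ 2) :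
    Tendsto (fun t => ∫⁻ ξ, ‖dsym ξ ^ j * ψ t ξ‖ₑ) atTop (𝓝 0) := by
  have hα := S.alpha_pos
  have hw := continuous_wav
  set a2 : ℝ → ℝ := fun ξ => (1 + α * wav ξ ^ 2) * (wav ξ ^ 2 + wav ξ ^ 4) with ha2
  set C0 : ℝ≥0∞ := wE univ (fun ξ => 1 + α * wav ξ ^ 2) (ψ 0) with hC0
  have hC0t : C0 ≠ ⊤ := S.low
  -- the weight at order `j`, split into a small multiple of the `L²` weight and a multiple of `a2`
  have hwt : ∀ ε, 0 < ε → ∃ C, 0 ≤ C ∧ ∀ ξ, (ε + ε⁻¹ * wav ξ ^ 2) * ‖dsym ξ ^ j‖ ^ 2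
      ≤ ε * (1 + α * wav ξ ^ 2) + C * a2 ξ := by
    intro ε hε
    refine ⟨ε + ε⁻¹ * (1 + 1 / α), by positivity, fun ξ => ?_⟩
    have e : ‖dsym ξ ^ j‖ ^ 2 = (wav ξ ^ 2) ^ j := by
      rw [norm_pow, ← pow_mul, mul_comm, pow_mul, norm_dsym_sq]
    rw [e]
    set y := wav ξ ^ 2 with hy
    have hy0 : 0 ≤ y := sq_nonneg _
    have e4 : wav ξ ^ 4 = y ^ 2 := by rw [hy]; ring
    have hi : 0 < ε⁻¹ := inv_pos.2 hε
    have eα : 1 / α * α = 1 := one_div_mul_cancel hα.ne'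
    have hA : 0 < 1 / α := by positivity
    simp only [ha2, e4, ← hy]
    have k1 : y + y ^ 2 ≤ (1 + α * y) * (y + y ^ 2) := by
      nlinarith [mul_nonneg hα.le hy0, mul_nonneg (mul_nonneg hα.le hy0) (by positivity : 0 ≤ y + y ^ 2)]
    have k2 : y ^ 2 + y ^ 3 ≤ 1 / α * ((1 + α * y) * (y + y ^ 2)) := by
      have : 1 / α * ((1 + α * y) * (y + y ^ 2))
          = 1 / α * (y + y ^ 2) + (1 / α * α) * (y ^ 2 + y ^ 3) := by ring
      rw [this, eα]
      have : 0 ≤ 1 / α * (y + y ^ 2) := by positivity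
      linarith
    set W := (1 + α * y) * (y + y ^ 2) with hW
    have hW0 : 0 ≤ W := by positivity
    have m1 : y ≤ W := by nlinarith
    have m2 : y ^ 2 ≤ W := by nlinarith
    have m3 : y ^ 3 ≤ 1 / α * W := by nlinarith
    have m4 : 0 ≤ 1 / α * W := by positivity
    have hy1 : 0 ≤ ε * (α * y) := by positivity
    interval_cases j
    · nlinarith [mul_le_mul_of_nonneg_left m1 hi.le, mul_nonneg hε.le hW0,
        mul_nonneg hi.le m4]
    · nlinarith [mul_le_mul_of_nonneg_left m1 hε.le, mul_le_mul_of_nonneg_left m2 hi.le,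
        mul_nonneg hi.le m4]
    · nlinarith [mul_le_mul_of_nonneg_left m2 hε.le, mul_le_mul_of_nonneg_left m3 hi.le,
        mul_nonneg hi.le hW0]
  have hA : 0 ≤ supConst := integral_nonneg fun ξ => by positivity
  have hsq : Tendsto (fun t => (∫⁻ ξ, ‖dsym ξ ^ j * ψ t ξ‖ₑ) ^ 2) atTop (𝓝 0) := by
    rw [ENNReal.tendsto_nhds_zero]
    intro κ hκ
    -- choose `ε` so that the low-frequency part is at most `κ / 2`
    obtain ⟨ε, hε, hεκ⟩ : ∃ ε : ℝ, 0 < ε ∧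
        ENNReal.ofReal supConst * (ENNReal.ofReal ε * C0) ≤ κ / 2 := by
      have ht : Tendsto (fun ε : ℝ => ENNReal.ofReal supConst * (ENNReal.ofReal ε * C0))
          (𝓝[>] 0) (𝓝 (ENNReal.ofReal supConst * (ENNReal.ofReal 0 * C0))) := by
        refine ENNReal.Tendsto.const_mul (ENNReal.Tendsto.mul_const ?_ (Or.inr hC0t))
          (Or.inr ENNReal.ofReal_ne_top)
        exact (ENNReal.continuous_ofReal.tendsto 0).mono_left nhdsWithin_le_nhds
      rw [ENNReal.ofReal_zero, zero_mul, mul_zero] at ht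
      have h := ht.eventually (ge_mem_nhds (ENNReal.half_pos hκ.ne'))
      obtain ⟨ε, h1, h2⟩ := (h.and self_mem_nhdsWithin).exists
      exact ⟨ε, h2, h1⟩
    obtain ⟨C, hC, hCw⟩ := hwt ε hε
    have ht : Tendsto (fun t => ENNReal.ofReal supConst * (ENNReal.ofReal C * wE univ a2 (ψ t)))
        atTop (𝓝 (ENNReal.ofReal supConst * (ENNReal.ofReal C * 0))) :=
      ENNReal.Tendsto.const_mul (ENNReal.Tendsto.const_mul S.tendsto_high
        (Or.inr ENNReal.ofReal_ne_top)) (Or.inr ENNReal.ofReal_ne_top)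
    rw [mul_zero, mul_zero] at ht
    filter_upwards [ht.eventually (ge_mem_nhds (ENNReal.half_pos hκ.ne')), eventually_ge_atTop 0]
      with t h1 h2
    refine (sq_lintegral_enorm_le (continuous_dsym.pow j) (ψ t) hε).trans ?_
    calc ENNReal.ofReal supConst
          * wE univ (fun ξ => (ε + ε⁻¹ * wav ξ ^ 2) * ‖dsym ξ ^ j‖ ^ 2) (ψ t)
        ≤ ENNReal.ofReal supConst
          * wE univ (fun ξ => ε * (1 + α * wav ξ ^ 2) + C * a2 ξ) (ψ t) :=
          mul_le_mul_right (wE_mono MeasurableSet.univ (fun ξ _ => hCw ξ) _) _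
      _ = ENNReal.ofReal supConst * (ENNReal.ofReal ε * wE univ (fun ξ => 1 + α * wav ξ ^ 2) (ψ t))
          + ENNReal.ofReal supConst * (ENNReal.ofReal C * wE univ a2 (ψ t)) := by
          rw [wE_add _ (by fun_prop) (fun ξ => by positivity) (fun ξ => by positivity),
            wE_const_mul _ hε.le, wE_const_mul _ hC, mul_add]
      _ ≤ κ / 2 + κ / 2 := by
          refine add_le_add (le_trans ?_ hεκ) h1
          gcongr
          exact S.low_le h2
      _ = κ := ENNReal.add_halves κ
  have h := hsq.ennrpow_const (1 / 2)
  rw [ENNReal.zero_rpow_of_pos (by norm_num)] at h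
  refine h.congr fun t => ?_
  rw [← ENNReal.rpow_natCast, ← ENNReal.rpow_mul]
  norm_num

theorem SmoothSol.tendsto_sup (S : SmoothSol α β γ δ N K ψ) (c : ℝ) :
    Tendsto (fun t => (⨆ x, ‖profile c (ψ t) x - c‖ₑ) + (⨆ x, ‖deriv (profile c (ψ t)) x‖ₑ)
      + ⨆ x, ‖iteratedDeriv 2 (profile c (ψ t)) x‖ₑ) atTop (𝓝 0) := by
  have h := ((S.tendsto_lintegral (j := 0) (by norm_num)).add
    (S.tendsto_lintegral (j := 1) (by norm_num))).add (S.tendsto_lintegral (j := 2) le_rfl)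
  rw [add_zero, add_zero] at h
  refine tendsto_of_tendsto_of_tendsto_of_le_of_le' tendsto_const_nhds h
    (Eventually.of_forall fun _ => zero_le) ?_
  filter_upwards [eventually_ge_atTop 0] with t ht
  rw [S.deriv_profile c ht, S.iteratedDeriv_two_profile c ht]
  refine add_le_add (add_le_add ?_ ?_) ?_
  · refine iSup_le fun x => ?_
    rw [profile, add_sub_cancel_right]
    simpa using enorm_reFourier_le (ψ t) x
  · exact iSup_le fun x => enorm_reFourier_le _ x
  · exact iSup_le fun x => enorm_reFourier_le _ x

end Regularity

end

/-! ### Existence of a global solution -/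

noncomputable section

section Existence

variable {α β γ δ : ℝ} {K : NNReal} {ψ : ℝ → CLTwo}

/-- The solution with a globally Lipschitz flux whose values never leave the range on which this
flux is the given one. -/
theorem exists_smoothSol (hα : 0 < α) (hβ : 0 < β) (hγ : 0 < γ) {f : ℝ → ℝ}
    (hf : ContDiff ℝ 1 f) (c : ℝ) {ψ₀ : CLTwo}
    (low : wE univ (fun ξ => 1 + α * wav ξ ^ 2) ψ₀ ≠ ⊤)
    (high : wE univ (fun ξ => (1 + α * wav ξ ^ 2) * (wav ξ ^ 2 + wav ξ ^ 4)) ψ₀ ≠ ⊤) :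
    ∃ (g : ℝ → ℝ) (K : NNReal) (hg : LipschitzWith K g) (g0 : g 0 = 0) (ψ : ℝ → CLTwo),
      SmoothSol α β γ δ (fluxOp hg g0) K ψ ∧ ψ 0 = ψ₀ ∧
      ∀ t, 0 ≤ t → ∀ x, g (reFourier (ψ t) x) = f (c + reFourier (ψ t) x) - f c := by
  -- the `H¹` energy of the datum fixes the truncation radius before the solution is constructed
  set E := wE univ (fun ξ => 1 + α * wav ξ ^ 2) ψ₀ with hE
  set C : ℝ := ((1 + 1 / α) * E.toReal) with hC
  obtain ⟨g, K, hg, g0, hgd, hgf⟩ := exists_truncation hf c (Real.sqrt (supConst * C))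
  have F := fluxMap_fluxOp hg g0 hgd
  obtain ⟨ψ, hψc, h0, hsol⟩ := exists_fourierSol (continuous_linSym (δ := δ) hα)
    (linSym_re_nonneg hα hβ hγ) (bddSymbol_fluxSym hα) F.lip F.zero ψ₀
  have S : SmoothSol α β γ δ (fluxOp hg g0) K ψ :=
    ⟨hα, hβ, hγ, F, hsol, by rwa [h0], by rwa [h0]⟩
  refine ⟨g, K, hg, g0, ψ, S, h0, fun t ht x => hgf _ (abs_reFourier_le (by positivity) ?_ x)⟩
  have h1 := S.low_le ht
  rw [h0, ← hE] at h1
  rw [hC, ENNReal.ofReal_mul (by positivity), ENNReal.ofReal_toReal low]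
  refine le_trans ?_ (mul_le_mul_right h1 _)
  rw [← wE_const_mul _ (by positivity)]
  refine wE_mono MeasurableSet.univ (fun ξ _ => ?_) _
  have e : (1 + 1 / α) * (1 + α * wav ξ ^ 2)
      = 1 + wav ξ ^ 2 + (1 / α + α * wav ξ ^ 2) := by
    field_simp
    ring
  rw [e]
  have : 0 ≤ 1 / α + α * wav ξ ^ 2 := by positivity
  linarith

theorem one_sub_dsym_sq (α ξ : ℝ) :
    (1 - (α : ℂ) * dsym ξ ^ 2) = ((1 + α * wav ξ ^ 2 : ℝ) : ℂ) := by
  rw [dsym, mul_pow, Complex.I_sq]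
  push_cast
  ring

/-- The differential equation as an identity of symbols: the rate `-m z - σ w` satisfies the
equation in which `z` stands for `u` and `w` for the flux. -/
theorem symbol_identity (hα : 0 < α) (ξ : ℝ) (z w : ℂ) :
    (-(linSym α β γ δ ξ * z) - fluxSym α ξ * w) + dsym ξ * w
      - α * (dsym ξ ^ 2 * (-(linSym α β γ δ ξ * z) - fluxSym α ξ * w))
      - β * (dsym ξ * (dsym ξ * z)) + δ * (dsym ξ ^ 2 * (dsym ξ * z))
      + γ * (dsym ξ ^ 3 * (dsym ξ * z)) = 0 := by
  have h := bbm_ne_zero hα ξ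
  have d2 : dsym ξ ^ 2 = -(wav ξ : ℂ) ^ 2 := by
    rw [dsym, mul_pow, Complex.I_sq]
    ring
  have e := one_sub_dsym_sq α ξ
  have e1 : (1 - (α : ℂ) * dsym ξ ^ 2) * linSym α β γ δ ξ
      = γ * dsym ξ ^ 4 - β * dsym ξ ^ 2 + δ * dsym ξ ^ 3 := by
    rw [e, linSym, mul_div_cancel₀ _ h]
    have d3 : dsym ξ ^ 3 = -(Complex.I * (wav ξ : ℂ) ^ 3) := by
      rw [pow_succ, d2, dsym]
      ring
    have d4 : dsym ξ ^ 4 = (wav ξ : ℂ) ^ 4 := by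
      have : dsym ξ ^ 4 = (dsym ξ ^ 2) ^ 2 := by ring
      rw [this, d2]
      ring
    rw [d2, d3, d4]
    push_cast
    ring
  have e2 : (1 - (α : ℂ) * dsym ξ ^ 2) * fluxSym α ξ = dsym ξ := by
    rw [e, fluxSym, mul_div_cancel₀ _ h]
  linear_combination (-z) * e1 - w * e2

variable {g : ℝ → ℝ}

/-- A smooth solution on the Fourier side, with a flux that agrees with the given one on the values
taken, is a global solution. -/
theorem SmoothSol.isGlobalSolution {hg : LipschitzWith K g} {g0 : g 0 = 0}
    (S : SmoothSol α β γ δ (fluxOp hg g0) K ψ) {f : ℝ → ℝ} {c : ℝ} {u₀ : ℝ → ℝ}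
    (hgf : ∀ t, 0 ≤ t → ∀ x, g (reFourier (ψ t) x) = f (c + reFourier (ψ t) x) - f c)
    (h0 : (fun x => u₀ x - c) =ᵐ[volume] ofFreq (ψ 0)) :
    IsGlobalSolution α β γ δ c f u₀ fun t => profile c (ψ t) := by
  have hα := S.alpha_pos
  have hb := continuous_besselSym
  have hd := continuous_dsym
  set p : ℝ → SobolevSpace 3 := fun t =>
    sobolevOfFreq 3 (mulTo (fun ξ => besselSym ξ ^ 3 * dsym ξ) (ψ t)) with hp
  have hpj : ∀ᵐ t ∂volume.restrict (Ioi (0 : ℝ)), ∀ j ≤ 3,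
      mulOp (sobSym 3 j) (mulTo (fun ξ => besselSym ξ ^ 3 * dsym ξ) (ψ t))
        =ᵐ[volume] fun ξ => dsym ξ ^ j * (dsym ξ * ψ t ξ) := by
    filter_upwards [S.memLp_bessel_deriv.1] with t ht j hj
    exact mulOp_sobSym_mulTo hj hd ht
  have hpos : ∀ᵐ t ∂volume.restrict (Ioi (0 : ℝ)), 0 < t := ae_restrict_mem measurableSet_Ioi
  have hφ0 : ∀ t, 0 ≤ t →
      wderiv (sobolevOfFreq 3 (mulTo (fun ξ => besselSym ξ ^ 3) (ψ t))) 0 = ofFreq (ψ t) := by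
    intro t ht
    rw [wderiv_sobolevOfFreq]
    congr 1
    refine Lp.ext ?_
    have h := mulOp_sobSym_mulTo (n := 3) (j := 0) (by norm_num) (s := fun _ => 1)
      continuous_const (ψ := ψ t) (by simpa using S.bessel_cube_ne_top ht)
    simpa using h
  refine ⟨fun t ht => (S.contDiff_profile c ht).continuous, ?_,
    fun t => sobolevOfFreq 3 (mulTo (fun ξ => besselSym ξ ^ 3) (ψ t)), p,
    fun t => sobolevOfFreq 2 (rateCurve α β γ δ (fluxOp hg g0) ψ t), fun t ht => ?_, ?_, ?_, ?_,
    ?_, ?_, ?_⟩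
  · filter_upwards [h0, S.profile_ae c le_rfl] with x h1 h2
    linarith
  · rw [hφ0 t ht]
    exact S.profile_ae c ht
  · exact (sobolevOfFreq 3).continuous.comp_continuousOn S.continuousOn_bessel
  · filter_upwards [hpj, hpos] with t h1 ht
    have h2 : IsWeakDerivOn univ (ofFreq (ψ t) : ℝ → ℝ) (wderiv (p t) 0) := by
      refine isWeakDerivOn_ofFreq ?_
      filter_upwards [h1 0 (by norm_num)] with ξ hξ
      refine hξ.trans ?_
      rw [pow_zero, one_mul]
    refine (h2.add_const c).congr_ae ?_ EventuallyEq.rfl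
    filter_upwards [S.profile_ae c ht.le] with x hx
    linarith
  · exact (sobolevOfFreq 3).comp_memLp' S.memLp_bessel_deriv.2
  · refine IsWeakDerivOn.congr_on isOpen_Ioi (S.isWeakDerivOn_rate.map ofFreq) fun t ht => ?_
    exact (hφ0 t (mem_Ioi.1 ht).le).symm
  · exact (sobolevOfFreq 2).comp_memLp' S.memLp_rateCurve
  · filter_upwards [hpj, hpos, S.coeFn_rateCurve, S.memLp_bessel_deriv.1] with t h1 ht h2 h3
    have h4 : wE univ (fun ξ => wav ξ ^ 4) (ψ t) ≠ ⊤ := by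
      refine wE_ne_top_of_le zero_le_one (fun ξ => ?_) (S.wE_ne_top ht.le (j := 2) le_rfl)
      have : ‖dsym ξ ^ 2‖ ^ 2 = wav ξ ^ 4 := by
        rw [norm_pow, norm_dsym_sq]
        ring
      rw [this]
      nlinarith [sq_nonneg (wav ξ), (by positivity : 0 ≤ wav ξ ^ 2 * wav ξ ^ 4)]
    have h5 : wE univ (fun ξ => ‖dsym ξ‖ ^ 2) (fluxOp hg g0 (ψ t)) ≠ ⊤ := by
      simp only [norm_dsym_sq]
      refine ne_top_of_le_ne_top (ENNReal.mul_ne_top (by finiteness) ?_) (S.flux.deriv_le _ h4)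
      have := (exists_deriv_of_wE h4).1
      simpa only [norm_dsym_sq] using this
    set G := mulTo dsym (fluxOp hg g0 (ψ t)) with hG
    have hGe := coeFn_mulTo hd h5
    refine ⟨ofFreq G, ?_, ?_⟩
    · refine ((isWeakDerivOn_ofFreq hGe).add_const (f c)).congr_ae ?_ EventuallyEq.rfl
      filter_upwards [ofFreq_fluxOp hg g0 (ψ t), reFourier_ae (S.integrable_zero ht.le)]
        with x e1 e2
      rw [e1, ← e2, hgf t ht.le, sub_add_cancel, profile, add_comm]
    · set r := rateCurve α β γ δ (fluxOp hg g0) ψ t with hr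
      set P := mulTo (fun ξ => besselSym ξ ^ 3 * dsym ξ) (ψ t) with hP
      have key : mulOp (sobSym 2 0) r + G - (α : ℂ) • mulOp (sobSym 2 2) r
          - (β : ℂ) • mulOp (sobSym 3 1) P + (δ : ℂ) • mulOp (sobSym 3 2) P
          + (γ : ℂ) • mulOp (sobSym 3 3) P = 0 := by
        refine Lp.ext ?_
        set q0 := mulOp (sobSym 2 0) r
        set q2 := mulOp (sobSym 2 2) r
        set p1 := mulOp (sobSym 3 1) P
        set p2 := mulOp (sobSym 3 2) P
        set p3 := mulOp (sobSym 3 3) P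
        filter_upwards [h2, hGe, h1 1 (by norm_num), h1 2 (by norm_num), h1 3 le_rfl,
          coeFn_mulOp (bddSymbol_sobSym (Nat.zero_le 2)) r,
          coeFn_mulOp (bddSymbol_sobSym (le_refl 2)) r,
          Lp.coeFn_add (q0 + G - (α : ℂ) • q2 - (β : ℂ) • p1 + (δ : ℂ) • p2) ((γ : ℂ) • p3),
          Lp.coeFn_add (q0 + G - (α : ℂ) • q2 - (β : ℂ) • p1) ((δ : ℂ) • p2),
          Lp.coeFn_sub (q0 + G - (α : ℂ) • q2) ((β : ℂ) • p1),
          Lp.coeFn_sub (q0 + G) ((α : ℂ) • q2), Lp.coeFn_add q0 G,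
          Lp.coeFn_smul (α : ℂ) q2, Lp.coeFn_smul (β : ℂ) p1, Lp.coeFn_smul (δ : ℂ) p2,
          Lp.coeFn_smul (γ : ℂ) p3, Lp.coeFn_zero ℂ 2 (volume : Measure ℝ)]
          with ξ a1 a2 a3 a4 a5 a6 a7 b1 b2 b3 b4 b5 b6 b7 b8 b9 b10
        rw [b1, Pi.add_apply, b2, Pi.add_apply, b3, Pi.sub_apply, b4, Pi.sub_apply, b5,
          Pi.add_apply, b6, b7, b8, b9, b10, Pi.smul_apply, Pi.smul_apply, Pi.smul_apply,
          Pi.smul_apply, a6, a7, a2, a3, a4, a5, a1]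
        have hne := besselSym_ne_zero ξ
        have s0 : ∀ z, sobSym 2 0 ξ * (besselSym ξ ^ 2 * z) = z := by
          intro z
          rw [sobSym]
          field_simp
        have s2 : ∀ z, sobSym 2 2 ξ * (besselSym ξ ^ 2 * z) = dsym ξ ^ 2 * z := by
          intro z
          rw [sobSym]
          field_simp
        rw [s0, s2, pow_one]
        exact symbol_identity hα ξ (ψ t ξ) (fluxOp hg g0 (ψ t) ξ)
      have hsm : ∀ (a : ℝ) (χ : CLTwo), ofFreq ((a : ℂ) • χ) = a • ofFreq χ := by
        intro a χ
        rw [← map_smul]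
        rfl
      have key2 := congrArg ofFreq key
      rw [map_add, map_add, map_sub, map_sub, map_add, map_zero, hsm, hsm, hsm, hsm] at key2
      simp only [wderiv_sobolevOfFreq, hp]
      set q0 := ofFreq (mulOp (sobSym 2 0) r) with hq0
      set q2 := ofFreq (mulOp (sobSym 2 2) r) with hq2
      set p1 := ofFreq (mulOp (sobSym 3 1) P) with hp1
      set p2 := ofFreq (mulOp (sobSym 3 2) P) with hp2
      set p3 := ofFreq (mulOp (sobSym 3 3) P) with hp3
      set F := ofFreq G
      filter_upwards [
        Lp.coeFn_add (q0 + F - α • q2 - β • p1 + δ • p2) (γ • p3),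
        Lp.coeFn_add (q0 + F - α • q2 - β • p1) (δ • p2),
        Lp.coeFn_sub (q0 + F - α • q2) (β • p1),
        Lp.coeFn_sub (q0 + F) (α • q2), Lp.coeFn_add q0 F,
        Lp.coeFn_smul α q2, Lp.coeFn_smul β p1, Lp.coeFn_smul δ p2,
        Lp.coeFn_smul γ p3, Lp.coeFn_zero ℝ 2 (volume : Measure ℝ)]
        with x b1 b2 b3 b4 b5 b6 b7 b8 b9 b10
      rw [key2, b10, Pi.zero_apply, Pi.add_apply, b2, Pi.add_apply, b3, Pi.sub_apply, b4,
        Pi.sub_apply, b5, Pi.add_apply, b6, b7, b8, b9, Pi.smul_apply, Pi.smul_apply,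
        Pi.smul_apply, Pi.smul_apply] at b1
      simp only [smul_eq_mul] at b1
      exact b1.symm

/-- Initial data of the class of the theorem have finite energies. -/
theorem initial_energy (hα : 0 < α) {c : ℝ} {u₀ : ℝ → ℝ} {w : LTwo}
    (hw : (fun x => u₀ x - c) =ᵐ[volume] w)
    {v : SobolevSpace 2} (hv : IsWeakDerivOn univ u₀ (wderiv v 0)) :
    wE univ (fun ξ => 1 + α * wav ξ ^ 2) (toFreq w) ≠ ⊤ ∧
    wE univ (fun ξ => (1 + α * wav ξ ^ 2) * (wav ξ ^ 2 + wav ξ ^ 4)) (toFreq w) ≠ ⊤ := by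
  have cw := continuous_wav
  have H : IsWeakDerivOn univ (w : ℝ → ℝ) (wderiv v 0) := by
    refine (hv.add_const (-c)).congr_ae ?_ EventuallyEq.rfl
    filter_upwards [hw] with x hx
    rw [← hx, sub_eq_add_neg]
  have hj : ∀ j : Fin 3, wE univ (fun ξ => wav ξ ^ (2 * (j + 1 : ℕ))) (toFreq w) ≠ ⊤ := by
    intro j
    have e : (fun ξ => wav ξ ^ (2 * (j + 1 : ℕ))) = fun ξ => ‖dsym ξ ^ (j + 1 : ℕ)‖ ^ 2 := by
      ext ξ
      rw [norm_pow, norm_dsym, ← abs_pow, sq_abs, ← pow_mul, mul_comm]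
    rw [e, wE_norm_sq_eq_of_ae (χ := toFreq (wderiv v j))]
    · simp
    · filter_upwards [toFreq_wderiv v j, H.toFreq_ae] with ξ h1 h2
      rw [h1, h2]
      ring
  have h2 := hj 0
  have h4 := hj 1
  have h6 := hj 2
  norm_num at h2 h4 h6
  have h : wE univ (fun ξ => 1 + (wav ξ ^ 2 + (wav ξ ^ 4 + wav ξ ^ 6))) (toFreq w) ≠ ⊤ := by
    rw [wE_add _ (by fun_prop) (fun ξ => by positivity) (fun ξ => by positivity),
      wE_add _ (by fun_prop) (fun ξ => by positivity) (fun ξ => by positivity),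
      wE_add _ (by fun_prop) (fun ξ => by positivity) (fun ξ => by positivity), wE_one]
    finiteness
  have q2 : ∀ ξ, 0 ≤ wav ξ ^ 2 := fun ξ => by positivity
  have q4 : ∀ ξ, 0 ≤ wav ξ ^ 4 := fun ξ => by positivity
  have q6 : ∀ ξ, 0 ≤ wav ξ ^ 6 := fun ξ => by positivity
  refine ⟨wE_ne_top_of_le (C := 1 + α) (by positivity) (fun ξ => ?_) h,
    wE_ne_top_of_le (C := 1 + α) (by positivity) (fun ξ => ?_) h⟩
  · nlinarith [q2 ξ, q4 ξ, q6 ξ, mul_nonneg hα.le (q4 ξ), mul_nonneg hα.le (q6 ξ)]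
  · nlinarith [q2 ξ, q4 ξ, q6 ξ, mul_nonneg hα.le (q2 ξ)]

end Existence

end

/-! ### Uniqueness -/

noncomputable section

/-- The weak derivative of order `j` as a continuous linear map. -/
def wderivL (n : ℕ) (j : Fin (n + 1)) : SobolevSpace n →L[ℝ] LTwo :=
  (PiLp.proj 2 (fun _ : Fin (n + 1) => LTwo) j).comp (SobolevSpace n).subtypeL

theorem norm_wderiv_le {n : ℕ} (v : SobolevSpace n) (j : Fin (n + 1)) : ‖wderiv v j‖ ≤ ‖v‖ :=
  PiLp.norm_apply_le (v : PiLp 2 fun _ : Fin (n + 1) => LTwo) j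

/-- The embedding of `H³` into the bounded functions. -/
theorem abs_wderiv_zero_le (v : SobolevSpace 3) {M : ℝ} (hM : ‖v‖ ≤ M) :
    ∀ᵐ x, |wderiv v 0 x| ≤ Real.sqrt (supConst * (2 * M ^ 2)) := by
  have hM0 : 0 ≤ M := (norm_nonneg _).trans hM
  have hj : ∀ j, ‖wderiv v j‖ₑ ^ 2 ≤ ENNReal.ofReal (M ^ 2) := by
    intro j
    rw [← ofReal_norm, ← ENNReal.ofReal_pow (norm_nonneg _)]
    exact ENNReal.ofReal_le_ofReal
      (pow_le_pow_left₀ (norm_nonneg _) ((norm_wderiv_le v j).trans hM) 2)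
  have h : wE univ (fun ξ => 1 + wav ξ ^ 2) (toFreq (wderiv v 0))
      ≤ ENNReal.ofReal (2 * M ^ 2) := by
    rw [wE_add _ measurable_const (fun _ => zero_le_one) (fun ξ => sq_nonneg _), two_mul,
      ENNReal.ofReal_add (sq_nonneg M) (sq_nonneg M)]
    refine add_le_add ?_ ?_
    · have := wE_toFreq_wderiv v 0
      simp only [Fin.val_zero, mul_zero, pow_zero] at this
      rw [this]
      exact hj 0
    · have := wE_toFreq_wderiv v 1
      simp only [Fin.val_one, mul_one] at this
      rw [this]
      exact hj 1
  have hi : Integrable (toFreq (wderiv v 0) : ℝ → ℂ) := by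
    have := integrable_mul_of_wE (s := fun _ => 1) continuous_const
      (ψ := toFreq (wderiv v 0)) (by simpa using ne_top_of_le_ne_top ENNReal.ofReal_ne_top h)
    simpa using this
  have e := reFourier_ae hi
  rw [ofFreq_toFreq] at e
  filter_upwards [e] with x hx
  rw [← hx]
  exact abs_reFourier_le (by positivity) h x

section Uniqueness

variable {α β γ δ c : ℝ} {f u₀ : ℝ → ℝ}

/-- On the Fourier side the equation, which holds almost everywhere, determines `∂_t u`. -/
theorem toFreq_rate (hα : 0 < α) {g : ℝ → ℝ} {K : NNReal} (hg : LipschitzWith K g)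
    (g0 : g 0 = 0) {v : LTwo} {p : SobolevSpace 3} {q : SobolevSpace 2} {F : ℝ → ℝ}
    (hp : IsWeakDerivOn univ (v : ℝ → ℝ) (wderiv p 0))
    (hF : IsWeakDerivOn univ (fun x => g (v x)) F)
    (heq : ∀ᵐ x, wderiv q 0 x + F x - α * wderiv q 2 x - β * wderiv p 1 x
        + δ * wderiv p 2 x + γ * wderiv p 3 x = 0) :
    toFreq (wderiv q 0) =ᵐ[volume] fun ξ => -(linSym α β γ δ ξ * toFreq v ξ)
      - fluxSym α ξ * fluxOp hg g0 (toFreq v) ξ := by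
  set q0 := wderiv q 0 with hq0
  set q2 := wderiv q 2 with hq2
  set p1 := wderiv p 1 with hp1
  set p2 := wderiv p 2 with hp2
  set p3 := wderiv p 3 with hp3
  set h : LTwo := α • q2 + β • p1 - δ • p2 - γ • p3 - q0 with hh
  -- the flux term lies in `L²`, being a combination of the other terms
  have hFh : F =ᵐ[volume] h := by
    filter_upwards [heq, Lp.coeFn_sub (α • q2 + β • p1 - δ • p2 - γ • p3) q0,
      Lp.coeFn_sub (α • q2 + β • p1 - δ • p2) (γ • p3), Lp.coeFn_sub (α • q2 + β • p1) (δ • p2),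
      Lp.coeFn_add (α • q2) (β • p1), Lp.coeFn_smul α q2, Lp.coeFn_smul β p1,
      Lp.coeFn_smul δ p2, Lp.coeFn_smul γ p3] with x a1 b1 b2 b3 b4 b5 b6 b7 b8
    rw [b1, Pi.sub_apply, b2, Pi.sub_apply, b3, Pi.sub_apply, b4, Pi.add_apply, b5, b6, b7, b8]
    simp only [Pi.smul_apply, smul_eq_mul]
    linarith
  have hW : IsWeakDerivOn univ (hg.compLp g0 v : ℝ → ℝ) h :=
    hF.congr_ae (hg.coeFn_compLp g0 v).symm hFh
  have e1 := hW.toFreq_ae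
  have e2 : toFreq h = (α : ℂ) • toFreq q2 + (β : ℂ) • toFreq p1 - (δ : ℂ) • toFreq p2
      - (γ : ℂ) • toFreq p3 - toFreq q0 := by
    rw [hh, map_sub, map_sub, map_sub, map_add, map_smul, map_smul, map_smul, map_smul]
    rfl
  have e3 : fluxOp hg g0 (toFreq v) = toFreq (hg.compLp g0 v) := by rw [fluxOp, ofFreq_toFreq]
  rw [e2, ← e3] at e1
  filter_upwards [e1, hp.toFreq_ae, toFreq_wderiv q 2, toFreq_wderiv p 1, toFreq_wderiv p 2,
    toFreq_wderiv p 3,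
    Lp.coeFn_sub ((α : ℂ) • toFreq q2 + (β : ℂ) • toFreq p1 - (δ : ℂ) • toFreq p2
      - (γ : ℂ) • toFreq p3) (toFreq q0),
    Lp.coeFn_sub ((α : ℂ) • toFreq q2 + (β : ℂ) • toFreq p1 - (δ : ℂ) • toFreq p2)
      ((γ : ℂ) • toFreq p3),
    Lp.coeFn_sub ((α : ℂ) • toFreq q2 + (β : ℂ) • toFreq p1) ((δ : ℂ) • toFreq p2),
    Lp.coeFn_add ((α : ℂ) • toFreq q2) ((β : ℂ) • toFreq p1), Lp.coeFn_smul (α : ℂ) (toFreq q2),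
    Lp.coeFn_smul (β : ℂ) (toFreq p1), Lp.coeFn_smul (δ : ℂ) (toFreq p2),
    Lp.coeFn_smul (γ : ℂ) (toFreq p3)] with ξ a1 a2 a3 a4 a5 a6 b1 b2 b3 b4 b5 b6 b7 b8
  rw [b1, Pi.sub_apply, b2, Pi.sub_apply, b3, Pi.sub_apply, b4, Pi.add_apply, b5, b6, b7, b8,
    Pi.smul_apply, Pi.smul_apply, Pi.smul_apply, Pi.smul_apply, a3, a4, a5, a6, a2] at a1
  have s := symbol_identity (β := β) (γ := γ) (δ := δ) hα ξ (toFreq v ξ)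
    (fluxOp hg g0 (toFreq v) ξ)
  have hne := bbm_ne_zero hα ξ
  rw [← one_sub_dsym_sq] at hne
  refine mul_left_cancel₀ hne ?_
  have i1 : ((1 : Fin 4) : ℕ) = 1 := rfl
  have i2 : ((2 : Fin 4) : ℕ) = 2 := rfl
  have i3 : ((3 : Fin 4) : ℕ) = 3 := rfl
  have i4 : ((2 : Fin 3) : ℕ) = 2 := rfl
  rw [i1, i2, i3, i4] at a1
  simp only [smul_eq_mul, pow_one] at a1
  linear_combination -a1 - s

theorem lipschitzWith_fluxOp {g : ℝ → ℝ} {K : NNReal} (hg : LipschitzWith K g) (g0 : g 0 = 0) :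
    LipschitzWith K (fluxOp hg g0) :=
  LipschitzWith.of_dist_le_mul fun ψ χ => by
    rw [dist_eq_norm, dist_eq_norm]
    exact norm_fluxOp_sub_le hg g0 ψ χ

/-- A global solution solves the integrated equation on the Fourier side; on a bounded time
interval the flux matters only on a bounded range of values. -/
theorem IsGlobalSolution.exists_fourierSol (hα : 0 < α) {u : ℝ → ℝ → ℝ}
    (H : IsGlobalSolution α β γ δ c f u₀ u) :
    ∃ ψ : ℝ → CLTwo, (∀ t, 0 ≤ t → (fun x => u t x - c) =ᵐ[volume] ofFreq (ψ t)) ∧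
      (∀ t, toFreq (ofFreq (ψ t)) = ψ t) ∧
      ∀ T, 0 ≤ T → ∃ R : ℝ, ∀ (g : ℝ → ℝ) (K : NNReal) (hg : LipschitzWith K g) (g0 : g 0 = 0),
        (∀ v, |v| ≤ R → g v = f (c + v) - f c) →
        FourierSol (linSym α β γ δ) (fluxSym α) T ψ fun t => fluxOp hg g0 (ψ t) := by
  obtain ⟨-, -, φ, p, q, hu, hφ, hp, -, hq, hqL, heq⟩ := H
  have c2 := continuous_linSym (β := β) (γ := γ) (δ := δ) hα
  have c3 := continuous_fluxSym hα
  -- extended to negative times by its initial value, to be continuous on the whole line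
  set ψ : ℝ → CLTwo := fun t => toFreq (wderiv (φ (max t 0)) 0) with hψ
  have hψc : Continuous ψ := by
    have h1 : Continuous fun t : ℝ => φ (max t 0) :=
      hφ.comp_continuous (by fun_prop) fun t => le_max_right t 0
    exact toFreq.continuous.comp ((wderivL 3 0).continuous.comp h1)
  have hψt : ∀ t, 0 ≤ t → ψ t = toFreq (wderiv (φ t) 0) := fun t ht => by
    rw [hψ]
    simp only
    rw [max_eq_left ht]
  refine ⟨ψ, fun t ht => ?_, fun t => ?_, fun T hT => ?_⟩
  · rw [hψt t ht, ofFreq_toFreq]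
    exact hu t ht
  · rw [hψ]
    simp only
    rw [ofFreq_toFreq]
  obtain ⟨M, hM⟩ := (isCompact_Icc (a := (0 : ℝ)) (b := T)).exists_bound_of_continuousOn
    (hφ.mono fun t ht => ht.1)
  refine ⟨Real.sqrt (supConst * (2 * M ^ 2)), fun g K hg g0 hgf => ⟨hψc,
    (lipschitzWith_fluxOp hg g0).continuous.comp hψc, fun B hB t ht => ?_⟩⟩
  set L : LTwo →L[ℝ] CLTwo := ((win B 1).restrictScalars ℝ).comp toFreq with hL
  have hcont : ContinuousOn (fun t => L (wderiv (φ t) 0)) (Ici 0) :=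
    L.continuous.comp_continuousOn ((wderivL 3 0).continuous.comp_continuousOn hφ)
  have hint : LocallyIntegrable (fun t => L (wderiv (q t) 0)) (volume.restrict (Ioi 0)) :=
    ((L.comp (wderivL 2 0)).comp_memLp' hqL).locallyIntegrable (by norm_num)
  have e := (hq.map L).eq_add_integral hcont hint ht.1
  have e0 : L (wderiv (φ t) 0) = win B 1 (ψ t) := by
    rw [hψt t ht.1]
    rfl
  have e00 : L (wderiv (φ 0) 0) = win B 1 (ψ 0) := by
    rw [hψt 0 le_rfl]
    rfl
  rw [e0, e00] at e
  rw [e]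
  congr 1
  refine intervalIntegral.integral_congr_ae ?_
  rw [uIoc_of_le ht.1]
  filter_upwards [(ae_restrict_iff' measurableSet_Ioi).1 hp,
    (ae_restrict_iff' measurableSet_Ioi).1 heq] with s h1 h2 hs
  obtain ⟨F, hF, hFeq⟩ := h2 hs.1
  have hs0 : 0 ≤ s := hs.1.le
  rw [hψt s hs0]
  refine win_one_eq_of_ae c2 c3 (toFreq_rate hα hg g0 (p := p s) ?_ (F := F) ?_ hFeq) hB
  · refine ((h1 hs.1).add_const (-c)).congr_ae ?_ EventuallyEq.rfl
    filter_upwards [hu s hs0] with x hx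
    rw [← hx, sub_eq_add_neg]
  · refine (hF.add_const (-f c)).congr_ae ?_ EventuallyEq.rfl
    filter_upwards [hu s hs0, abs_wderiv_zero_le (φ s) (hM s ⟨hs0, hs.2.trans ht.2⟩)]
      with x h3 h4
    rw [hgf _ h4, ← h3, add_sub_cancel, sub_eq_add_neg]

/-- Two global solutions with the same initial datum agree. -/
theorem IsGlobalSolution.unique (hα : 0 < α) (hβ : 0 < β) (hγ : 0 < γ) (hf : ContDiff ℝ 1 f)
    {u v : ℝ → ℝ → ℝ} (H : IsGlobalSolution α β γ δ c f u₀ u)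
    (H' : IsGlobalSolution α β γ δ c f u₀ v) : ∀ t, 0 ≤ t → ∀ x, u t x = v t x := by
  obtain ⟨ψ, h1, h2, h3⟩ := H.exists_fourierSol hα
  obtain ⟨ψ', h1', h2', h3'⟩ := H'.exists_fourierSol hα
  intro T hT
  obtain ⟨R, hR⟩ := h3 T hT
  obtain ⟨R', hR'⟩ := h3' T hT
  obtain ⟨g, K, hg, g0, -, hgf⟩ := exists_truncation hf c (max R R')
  have S := hR g K hg g0 fun y hy => hgf y (hy.trans (le_max_left _ _))
  have S' := hR' g K hg g0 fun y hy => hgf y (hy.trans (le_max_right _ _))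
  have h0 : ψ 0 = ψ' 0 := by
    rw [← h2, ← h2']
    congr 1
    refine Lp.ext ?_
    filter_upwards [h1 0 le_rfl, h1' 0 le_rfl, H.2.1, H'.2.1] with x e1 e2 e3 e4
    rw [← e1, ← e2, e3, e4]
  have e := S.eq_of_lipschitz hα hβ hγ S' h0
    (fun t _ => norm_fluxOp_sub_le hg g0 (ψ t) (ψ' t)) T ⟨hT, le_rfl⟩
  have hae : u T =ᵐ[volume] v T := by
    filter_upwards [h1 T hT, h1' T hT] with x e1 e2
    rw [e, ← e2] at e1
    linarith
  exact fun x => congrFun (((H.1 T hT).ae_eq_iff_eq volume (H'.1 T hT)).1 hae) x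

end Uniqueness

end

theorem theorem1p3 (α β γ δ c : ℝ) (hα : 0 < α) (hβ : 0 < β) (hγ : 0 < γ)
    (f : ℝ → ℝ) (hf : ContDiff ℝ 2 f)
    (u₀ : ℝ → ℝ) (hu₀ : MemLp (fun x => u₀ x - c) 2 volume)
    (hu₀' : ∃ g : SobolevSpace 2, IsWeakDerivOn univ u₀ (wderiv g 0)) :
    ∃ u : ℝ → ℝ → ℝ,
      IsGlobalSolution α β γ δ c f u₀ u ∧
      (∀ v : ℝ → ℝ → ℝ, IsGlobalSolution α β γ δ c f u₀ v →
        ∀ t, 0 ≤ t → ∀ x, v t x = u t x) ∧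
      (∀ t, 0 ≤ t → ContDiff ℝ 2 (u t)) ∧
      Tendsto (fun t => (⨆ x, ‖u t x - c‖ₑ) + (⨆ x, ‖deriv (u t) x‖ₑ)
        + ⨆ x, ‖iteratedDeriv 2 (u t) x‖ₑ) atTop (𝓝 0) := by
  obtain ⟨g, hgu⟩ := hu₀'
  have hf1 : ContDiff ℝ 1 f := hf.of_le (by norm_num)
  obtain ⟨low, high⟩ := initial_energy hα hu₀.coeFn_toLp.symm hgu
  obtain ⟨g, K, hg, g0, ψ, S, h0, hgf⟩ :=
    exists_smoothSol (δ := δ) hα hβ hγ hf1 c low high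
  have H : IsGlobalSolution α β γ δ c f u₀ fun t => profile c (ψ t) := by
    refine S.isGlobalSolution hgf ?_
    rw [h0, ofFreq_toFreq]
    exact hu₀.coeFn_toLp.symm
  exact ⟨_, H, fun v hv => hv.unique hα hβ hγ hf1 H, fun t ht => S.contDiff_profile c ht,
    S.tendsto_sup c⟩
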